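/- Fix $n\ge 0$ and a finite set of labelled prototiles $p_1,\dots,p_N\subset\mathbb R^n$, each homeomorphic to the closed unit ball and with the origin in its interior. A tile is a labelled translate $t=p_i+x$; $x(t)=x$ is its puncture. A partial tiling is a set of tiles with pairwise disjoint interiors, a patch is a finite partial tiling, the support of a partial tiling is the union of its tiles, and a tiling is a partial tiling with support $\mathbb R^n$. For $U\subset\mathbb R^n$ let $T(U)$ be the set of tiles of $T$ that meet $U$, and let $$d(T,T')=\inf\bigl(\{1\}\cup\{\varepsilon : \exists\,x,x',\ |x|,|x'|<\varepsilon,\ (T-x)(B(0,1/\varepsilon))=(T'-x')(B(0,1/\varepsilon))\}\bigr)$$ be the tiling metric. The hull $\Omega_T$ is the set of tilings that are $d$-limits of translates of $T$, and $\Omega_{punc}\subset\Omega_T$ is the subspace of tilings with a puncture at the origin. Let $T$ be a tiling which has finite local complexity (for each $r>0$ there are only finitely many patches $T(B(x,r))$, $x\in\mathbb R^n$, up to translation), is repetitive (for each patch $P\subset T$ there is $R>0$ such that every $T(B(x,R))$ contains a translate of $P$), and is strongly aperiodic ($T'+x\ne T'$ for all $T'\in\Omega_T$ and $x\neq0$).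 Let $\mathcal R_{punc}=\{(T_1,T_1+x): T_1,T_1+x\in\Omega_{punc}\}$ be the groupoid of translational equivalence with product $(T_1,T_2)(T_2,T_3)=(T_1,T_3)$, inverse $(T_1,T_2)^{-1}=(T_2,T_1)$, and the topology from $\Omega_{punc}\times\mathbb R^n$ under $(T_1,T_1+x)\leftrightarrow(T_1,x)$. Let $\mathcal S$ be the inverse semigroup consisting of $0$ and the translation classes $[t_1,P,t_2]$ of triples, where $P$ is a patch with a translate contained in $T$ and whose support has connected interior, and $t_1,t_2\in P$. The product is $[t_1,P,t_2][t_1',P',t_2']=[t_1,P\cup P',t_2']$ if representatives can be chosen with $P,P'\subset T$ and $t_2=t_1'$, and it is $0$ otherwise; $[t_1,P,t_2]^*=[t_2,P,t_1]$. Let $E$ be the set of idempotents of $\mathcal S$, ordered by $e\le f\iff e=ef$; a character is a non-zero multiplicative map $\phi:E\to\{0,1\}$ with $\phi(0)=0$, and $\hat E_{tight}$ is the closure, for pointwise convergence, of the set of characters for which $\{e:\phi(e)=1\}$ is a maximal filter. $\mathcal S$ acts on $\hat E_{tight}$ by $\theta_s(\phi)(e)=\phi(s^*es)$, defined for $\phi(s^*s)=1$.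 Let $\mathcal G_{tight}$ be the groupoid of germs of this action: the classes $[s,\phi]$ of pairs with $\phi(s^*s)=1$, where $[s,\phi]=[t,\psi]$ iff $\phi=\psi$ and $se=te$ for some $e\in E$ with $\phi(e)=1$, with $[s,\theta_t(\phi)][t,\phi]=[st,\phi]$, $[s,\phi]^{-1}=[s^*,\theta_s(\phi)]$ and the topology with basis $\{[s,\phi]:\phi\in U\}$ for $s\in\mathcal S$ and $U$ open in the domain of $\theta_s$. Then $\mathcal R_{punc}$ and $\mathcal G_{tight}$ are topological groupoids, and they are isomorphic as topological groupoids. Consequently the tight C*-algebra $C^*(\mathcal G_{tight})$ of $\mathcal S$ is *-isomorphic to the tiling C*-algebra $C^*(\mathcal R_{punc})$, where $C^*(\mathcal G)$ denotes the full groupoid C*-algebra, i.e. the completion of the convolution *-algebra $C_c(\mathcal G)$ in the supremum of the operator norms over all its *-representations on Hilbert spaces. -/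

import Mathlib

open Set Topology
open scoped ENNReal CompactlySupported

universe u

noncomputable section

namespace TilingTight

/-! ## Groupoids

A groupoid is a set of arrows with a partially defined product and an inversion. The product is
recorded by its graph: `IsProd a b c` says that `(a, b)` is a composable pair with product `c`. -/

/-- A partially defined product (through its graph) and an inversion on a set of arrows. -/
class GroupoidOps (G : Type*) where
  IsProd : G → G → G → Prop
  inv : G → G

open GroupoidOps

/-- The composable pairs. -/
def ComposablePairs (G : Type*) [GroupoidOps G] : Set (G × G) :=
  {q | ∃ c, IsProd q.1 q.2 c}

/-- The product on composable pairs. -/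
def gmul {G : Type*} [GroupoidOps G] (q : ComposablePairs G) : G := Classical.choose q.2

/-- The axioms of a topological groupoid: the product is single valued, the groupoid axioms hold,
product and inversion are continuous. -/
structure IsTopologicalGroupoid (G : Type*) [TopologicalSpace G] [GroupoidOps G] : Prop where
  prod_unique : ∀ a b c c' : G, IsProd a b c → IsProd a b c' → c = c'
  inv_inv : ∀ a : G, inv (inv a) = a
  assoc : ∀ a b c ab bc : G, IsProd a b ab → IsProd b c bc →
    ∃ abc, IsProd ab c abc ∧ IsProd a bc abc
  inv_left : ∀ a : G, ∃ u, IsProd (inv a) a u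
  cancel_left : ∀ a b c : G, IsProd a b c → IsProd (inv a) c b
  cancel_right : ∀ a b c : G, IsProd a b c → IsProd c (inv b) a
  continuous_inv : Continuous (inv : G → G)
  continuous_mul : Continuous (gmul : ComposablePairs G → G)

/-- Isomorphisms of topological groupoids: homeomorphisms which preserve, in both directions, the
composable pairs and their products, and which preserve inverses. -/
structure TopGroupoidIso (G H : Type*) [TopologicalSpace G] [GroupoidOps G] [TopologicalSpace H]
    [GroupoidOps H] extends G ≃ₜ H where
  map_prod : ∀ a b c : G, IsProd a b c ↔ IsProd (toFun a) (toFun b) (toFun c)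
  map_inv : ∀ a : G, toFun (inv a) = inv (toFun a)

/-! ## The (full) C*-algebra of an étale groupoid -/

/-- `h` is the convolution of `f` and `g`: `h γ` is the sum of `f α * g β` over all factorizations
`γ = α β`. (In an étale Hausdorff groupoid only finitely many terms are non-zero when `f` and `g`
are compactly supported and continuous.) -/
def IsConvolution {G : Type*} [GroupoidOps G] (f g h : G → ℂ) : Prop :=
  ∀ γ, h γ = ∑ᶠ q : {q : G × G // IsProd q.1 q.2 γ}, f q.1.1 * g q.1.2

/-- `g` is the adjoint of `f`, i.e. the complex conjugate of `f` at the inverse arrow. -/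
def IsInvolution {G : Type*} [GroupoidOps G] (f g : G → ℂ) : Prop :=
  ∀ γ, g γ = star (f (inv γ))

/-- A *-representation of the convolution *-algebra `C_c(G)` on a Hilbert space. -/
structure StarRep (G : Type u) [TopologicalSpace G] [GroupoidOps G] where
  H : Type u
  [normed : NormedAddCommGroup H]
  [inner : InnerProductSpace ℂ H]
  [complete : CompleteSpace H]
  rep : C_c(G, ℂ) →ₗ[ℂ] (H →L[ℂ] H)
  map_conv : ∀ f g h : C_c(G, ℂ), IsConvolution f g h → rep h = rep f * rep g
  map_star : ∀ f g : C_c(G, ℂ), IsInvolution f g → rep g = star (rep f)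

attribute [instance] StarRep.normed StarRep.inner StarRep.complete

/-- The C*-algebra of all bounded families of operators, one for each *-representation of
`C_c(G)`, with the supremum norm. -/
abbrev RepProduct (G : Type u) [TopologicalSpace G] [GroupoidOps G] : Type (u + 1) :=
  lp (fun π : StarRep G => π.H →L[ℂ] π.H) ∞

/-- The groupoid C*-algebra `C*(G)`: the completion of `C_c(G)` in the norm
`‖f‖ = sup_π ‖π f‖`, where `π` runs through the *-representations of `C_c(G)`. It is realized as
the norm closure of the image of `C_c(G)` under the direct sum of all its *-representations. -/
def groupoidCStarSubalgebra (G : Type u) [TopologicalSpace G] [GroupoidOps G] :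
    NonUnitalStarSubalgebra ℂ (RepProduct G) :=
  (NonUnitalStarAlgebra.adjoin ℂ
    {a : RepProduct G | ∃ f : C_c(G, ℂ), ∀ π : StarRep G, a π = π.rep f}).topologicalClosure

/-- `C*(G)` as a C*-algebra. -/
def GroupoidCStar (G : Type u) [TopologicalSpace G] [GroupoidOps G] : Type (u + 1) :=
  groupoidCStarSubalgebra G

instance (G : Type u) [TopologicalSpace G] [GroupoidOps G] :
    NonUnitalCStarAlgebra (GroupoidCStar G) :=
  haveI : IsClosed (groupoidCStarSubalgebra G : Set (RepProduct G)) :=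
    NonUnitalStarSubalgebra.isClosed_topologicalClosure _
  NonUnitalStarSubalgebra.nonUnitalCStarAlgebra (groupoidCStarSubalgebra G)

/-! ## Inverse semigroups, filters of idempotents and the tight groupoid -/

/-- Inverse semigroups with zero: semigroups with an involution `s ↦ s*` with `s s* s = s`
(and hence `s* s s* = s*`) in which idempotents commute. -/
class InvSemigroup (S : Type*) extends SemigroupWithZero S, StarMul S where
  mul_star_mul : ∀ s : S, s * star s * s = s
  idem_comm : ∀ e f : S, e * e = e → f * f = f → e * f = f * e

section InvSemigroup

variable {S : Type*} [InvSemigroup S]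

theorem star_mul_star (s : S) : star s * s * star s = star s := by
  have h := congrArg star (InvSemigroup.mul_star_mul s)
  simpa [mul_assoc] using h

theorem star_idem {e : S} (he : e * e = e) : star e = e := by
  have he' : star e * star e = star e := by rw [← star_mul, he]
  have hc := InvSemigroup.idem_comm e (star e) he he'
  have h1 : e = e * star e := by
    conv_lhs => rw [← InvSemigroup.mul_star_mul e]
    rw [mul_assoc, ← hc, ← mul_assoc, he]
  have h2 : star e = star e * e := by
    conv_lhs => rw [← star_mul_star e]
    rw [mul_assoc, hc, ← mul_assoc, he']
  rw [h2, ← hc, ← h1]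

theorem star_zero' : star (0 : S) = 0 := star_idem (by simp)

theorem mul_idem {e f : S} (he : e * e = e) (hf : f * f = f) : e * f * (e * f) = e * f := by
  rw [mul_assoc, ← mul_assoc f, InvSemigroup.idem_comm f e hf he, mul_assoc, hf, ← mul_assoc, he]

theorem conj_idem (s : S) {e : S} (he : e * e = e) :
    star s * e * s * (star s * e * s) = star s * e * s := by
  have h1 : (s * star s) * (s * star s) = s * star s := by
    rw [← mul_assoc, InvSemigroup.mul_star_mul]
  have h2 := InvSemigroup.idem_comm e (s * star s) he h1
  calc star s * e * s * (star s * e * s) = star s * (e * (s * star s)) * e * s := by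
        simp only [mul_assoc]
    _ = (star s * s * star s) * (e * e) * s := by rw [h2]; simp only [mul_assoc]
    _ = star s * e * s := by rw [star_mul_star, he]

variable (S) in
/-- The set `E` of idempotents. -/
@[ext] structure Idem where
  val : S
  idem : val * val = val

instance : Mul (Idem S) := ⟨fun e f => ⟨e.1 * f.1, mul_idem e.2 f.2⟩⟩

instance : Zero (Idem S) := ⟨⟨0, by simp⟩⟩

/-- The natural partial order `e ≤ f ↔ e = e f`. -/
instance : LE (Idem S) := ⟨fun e f => e = e * f⟩

/-- The idempotent `s* e s`. -/
def conj (s : S) (e : Idem S) : Idem S := ⟨star s * e.1 * s, conj_idem s e.2⟩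

/-- The idempotent `s* s`. -/
def dom (s : S) : Idem S :=
  ⟨star s * s, by rw [← mul_assoc, star_mul_star]⟩

/-- Filters in `E`. -/
structure IsFilter (ξ : Set (Idem S)) : Prop where
  nonempty : ξ.Nonempty
  zero_notMem : 0 ∉ ξ
  up : ∀ x y, x ∈ ξ → x ≤ y → y ∈ ξ
  directed : ∀ x y, x ∈ ξ → y ∈ ξ → ∃ z ∈ ξ, z ≤ x ∧ z ≤ y

/-- Ultra-filters in `E`: filters not properly contained in another one. -/
def IsUltra (ξ : Set (Idem S)) : Prop :=
  IsFilter ξ ∧ ∀ η, IsFilter η → ξ ⊆ η → ξ = η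

variable (S) in
/-- Characters on `E`: non-zero multiplicative maps to `{0, 1}` which take `0` to `0`. -/
@[ext] structure Character where
  toFun : Idem S → Bool
  ne_zero : ∃ e, toFun e = true
  map_zero : toFun 0 = false
  map_mul : ∀ e f, toFun (e * f) = (toFun e && toFun f)

/-- The topology of pointwise convergence. -/
instance : TopologicalSpace (Character S) :=
  TopologicalSpace.induced Character.toFun inferInstance

theorem continuous_eval (e : Idem S) : Continuous fun φ : Character S => φ.toFun e :=
  (continuous_apply e).comp continuous_induced_dom

/-- The set of idempotents on which a character is `1`. -/
def Character.toFilter (φ : Character S) : Set (Idem S) := {e | φ.toFun e = true}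

variable (S) in
/-- The tight spectrum: the closure of the set of characters coming from ultra-filters. -/
def tightSpectrum : Set (Character S) := closure {φ | IsUltra φ.toFilter}

theorem conj_dom_conj (s : S) (e f : Idem S) : conj s (e * f) = conj s e * conj s f := by
  apply Idem.ext
  change star s * (e.1 * f.1) * s = star s * e.1 * s * (star s * f.1 * s)
  have h1 : (s * star s) * (s * star s) = s * star s := by
    rw [← mul_assoc, InvSemigroup.mul_star_mul]
  have h2 := InvSemigroup.idem_comm e.1 (s * star s) e.2 h1
  calc star s * (e.1 * f.1) * s = (star s * s * star s) * e.1 * f.1 * s := by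
        rw [star_mul_star]; simp only [mul_assoc]
    _ = star s * ((s * star s) * e.1) * f.1 * s := by simp only [mul_assoc]
    _ = star s * (e.1 * (s * star s)) * f.1 * s := by rw [h2]
    _ = star s * e.1 * s * (star s * f.1 * s) := by simp only [mul_assoc]

theorem conj_conj (s t : S) (e : Idem S) : conj t (conj s e) = conj (s * t) e := by
  apply Idem.ext
  simp [conj, mul_assoc]

theorem conj_dom_star (s : S) : conj s (dom (star s)) = dom s := by
  apply Idem.ext
  change star s * (star (star s) * star s) * s = star s * s
  rw [star_star, ← mul_assoc (star s) s, star_mul_star]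

theorem Idem.le_iff (e f : Idem S) : e ≤ f ↔ e = e * f := Iff.rfl

theorem Idem.mul_comm' (e f : Idem S) : e * f = f * e :=
  Idem.ext (InvSemigroup.idem_comm e.1 f.1 e.2 f.2)

theorem Idem.mul_assoc' (e f g : Idem S) : e * f * g = e * (f * g) :=
  Idem.ext (mul_assoc e.1 f.1 g.1)

theorem Idem.mul_self (e : Idem S) : e * e = e := Idem.ext e.2

theorem Idem.mul_le_left (e f : Idem S) : e * f ≤ e := by
  rw [Idem.le_iff, Idem.mul_comm' (e * f) e, ← Idem.mul_assoc', Idem.mul_self]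

theorem Idem.mul_le_right (e f : Idem S) : e * f ≤ f := by
  rw [Idem.le_iff, Idem.mul_assoc', Idem.mul_self]

theorem IsFilter.mul_mem {ξ : Set (Idem S)} (h : IsFilter ξ) {e f : Idem S} (he : e ∈ ξ)
    (hf : f ∈ ξ) : e * f ∈ ξ := by
  obtain ⟨z, hz, h1, h2⟩ := h.directed e f he hf
  refine h.up z _ hz ?_
  rw [Idem.le_iff] at *
  rw [← Idem.mul_assoc', ← h1, ← h2]

/-- The intrinsic action on characters: `(θ_s φ)(e) = φ(s* e s)`, defined if `φ(s* s) = 1`. -/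
def charAct (s : S) (φ : Character S) (h : φ.toFun (dom s) = true) : Character S where
  toFun e := φ.toFun (conj s e)
  ne_zero := ⟨dom (star s), by rw [conj_dom_star]; exact h⟩
  map_zero := by
    have : conj s (0 : Idem S) = 0 := Idem.ext (by
      change star s * 0 * s = 0
      simp)
    rw [this]; exact φ.map_zero
  map_mul e f := by rw [conj_dom_conj]; exact φ.map_mul _ _

theorem charAct_ultra (s : S) (φ : Character S) (h : φ.toFun (dom s) = true)
    (hφ : IsUltra φ.toFilter) (hf : IsFilter (charAct s φ h).toFilter) :
    IsUltra (charAct s φ h).toFilter := by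
  refine ⟨hf, fun η hη hsub => ?_⟩
  have hdom : dom (star s) ∈ η := hsub (by
    change φ.toFun (conj s (dom (star s))) = true
    rw [conj_dom_star]; exact h)
  have key : IsFilter {e : Idem S | conj (star s) e ∈ η} := by
    refine ⟨⟨dom s, ?_⟩, ?_, ?_, ?_⟩
    · have := conj_dom_star (star s)
      rw [star_star] at this
      change conj (star s) (dom s) ∈ η
      rw [this]; exact hdom
    · have : conj (star s) (0 : Idem S) = 0 := Idem.ext (by
        change star (star s) * 0 * star s = 0
        simp)
      change conj (star s) (0 : Idem S) ∉ η
      rw [this]; exact hη.zero_notMem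
    · intro x y hx hxy
      refine hη.up _ _ hx ?_
      rw [Idem.le_iff] at *
      rw [← conj_dom_conj, ← hxy]
    · intro x y hx hy
      refine ⟨x * y, ?_, Idem.mul_le_left _ _, Idem.mul_le_right _ _⟩
      change conj (star s) (x * y) ∈ η
      rw [conj_dom_conj]
      exact hη.mul_mem hx hy
  have hsub' : φ.toFilter ⊆ {e : Idem S | conj (star s) e ∈ η} := by
    intro e he
    refine hsub ?_
    change φ.toFun (conj s (conj (star s) e)) = true
    rw [conj_conj]
    have : conj (star s * s) e = dom s * e * dom s := Idem.ext (by
      change star (star s * s) * e.1 * (star s * s) = star s * s * e.1 * (star s * s)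
      simp)
    have he' : φ.toFun e = true := he
    rw [this, φ.map_mul, φ.map_mul, h, he']; rfl
  have heq := hφ.2 _ key hsub'
  refine Subset.antisymm hsub fun f hf => ?_
  change conj s f ∈ φ.toFilter
  rw [heq]
  change conj (star s) (conj s f) ∈ η
  rw [conj_conj]
  have : conj (s * star s) f = dom (star s) * f * dom (star s) := Idem.ext (by
    change star (s * star s) * f.1 * (s * star s) =
      star (star s) * star s * f.1 * (star (star s) * star s)
    simp)
  rw [this]
  exact hη.mul_mem (hη.mul_mem hdom hf) hdom

theorem Character.isFilter (φ : Character S) : IsFilter φ.toFilter := by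
  refine ⟨φ.ne_zero, ?_, ?_, ?_⟩
  · change ¬ φ.toFun 0 = true
    rw [φ.map_zero]; simp
  · intro x y hx hxy
    rw [Idem.le_iff] at hxy
    change φ.toFun x = true at hx
    rw [hxy, φ.map_mul, Bool.and_eq_true] at hx
    exact hx.2
  · intro x y hx hy
    refine ⟨x * y, ?_, Idem.mul_le_left _ _, Idem.mul_le_right _ _⟩
    change φ.toFun (x * y) = true
    rw [φ.map_mul, Bool.and_eq_true]
    exact ⟨hx, hy⟩

theorem continuous_charAct (s : S) :
    Continuous fun φ : {φ : Character S // φ.toFun (dom s) = true} => charAct s φ.1 φ.2 :=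
  continuous_induced_rng.2 (continuous_pi fun e =>
    (continuous_eval (conj s e)).comp continuous_subtype_val)

/-- The intrinsic action preserves the tight spectrum. -/
theorem charAct_tight (s : S) (φ : Character S) (h : φ.toFun (dom s) = true)
    (hφ : φ ∈ tightSpectrum S) : charAct s φ h ∈ tightSpectrum S := by
  have hopen : IsOpen {φ : Character S | φ.toFun (dom s) = true} :=
    (isOpen_discrete {true}).preimage (continuous_eval (dom s))
  have hmem : (⟨φ, h⟩ : {φ : Character S // φ.toFun (dom s) = true}) ∈
      closure {ψ : {φ : Character S // φ.toFun (dom s) = true} | IsUltra ψ.1.toFilter} := by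
    rw [mem_closure_iff]
    intro o ho hmo
    obtain ⟨u, hu, rfl⟩ := isOpen_induced_iff.1 ho
    obtain ⟨ψ, ⟨hψu, hψd⟩, hψ⟩ := mem_closure_iff.1 hφ _ (hu.inter hopen) ⟨hmo, h⟩
    exact ⟨⟨ψ, hψd⟩, hψu, hψ⟩
  exact map_mem_closure (continuous_charAct s) hmem
    fun ψ hψ => charAct_ultra s ψ.1 ψ.2 hψ (Character.isFilter _)

/-- `θ_s` on the tight spectrum: defined on `D_{s* s}`, the set of tight `φ` with `φ(s* s) = 1`. -/
def tightAct (s : S) (φ : tightSpectrum S) (h : φ.1.toFun (dom s) = true) : tightSpectrum S :=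
  ⟨charAct s φ.1 h, charAct_tight s φ.1 h φ.2⟩

variable (S) in
/-- The pairs `(s, φ)` with `φ` in the domain of `θ_s`. -/
abbrev GermPair : Type _ := {q : S × tightSpectrum S // q.2.1.toFun (dom q.1) = true}

variable (S) in
/-- `(s, φ) ∼ (t, ψ)` if `φ = ψ` and `s e = t e` for some idempotent `e` with `φ(e) = 1`. -/
instance germSetoid : Setoid (GermPair S) where
  r a b := a.1.2 = b.1.2 ∧ ∃ e : Idem S, a.1.2.1.toFun e = true ∧ a.1.1 * e.1 = b.1.1 * e.1
  iseqv :=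
    { refl := fun a => ⟨rfl, dom a.1.1, a.2, rfl⟩
      symm := by
        rintro a b ⟨h, e, he, hab⟩
        exact ⟨h.symm, e, by rw [← h]; exact he, hab.symm⟩
      trans := by
        rintro a b c ⟨h, e, he, hab⟩ ⟨h', f, hf, hbc⟩
        refine ⟨h.trans h', e * f, ?_, ?_⟩
        · rw [a.1.2.1.map_mul, he, h, hf]; rfl
        · change a.1.1 * (e.1 * f.1) = c.1.1 * (e.1 * f.1)
          rw [← mul_assoc, hab, mul_assoc, InvSemigroup.idem_comm e.1 f.1 e.2 f.2, ← mul_assoc, hbc,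
            mul_assoc] }

variable (S) in
/-- The tight groupoid: the groupoid of germs of the intrinsic action on the tight spectrum. -/
def TightGroupoid : Type _ := Quotient (germSetoid S)

/-- The germ `[s, φ]`. -/
def germ (s : S) (φ : tightSpectrum S) (h : φ.1.toFun (dom s) = true) : TightGroupoid S :=
  Quotient.mk (germSetoid S) ⟨(s, φ), h⟩

theorem tightAct_dom (s : S) (φ : tightSpectrum S) (h : φ.1.toFun (dom s) = true) :
    (tightAct s φ h).1.toFun (dom (star s)) = true := by
  change φ.1.toFun (conj s (dom (star s))) = true
  rw [conj_dom_star]; exact h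

theorem germ_inv_aux (a b : GermPair S) (h : germSetoid S a b) :
    germ (star a.1.1) (tightAct a.1.1 a.1.2 a.2) (tightAct_dom _ _ _) =
      germ (star b.1.1) (tightAct b.1.1 b.1.2 b.2) (tightAct_dom _ _ _) := by
  obtain ⟨⟨s, φ⟩, ha⟩ := a
  obtain ⟨⟨t, ψ⟩, hb⟩ := b
  obtain ⟨h, e, he, hse⟩ := h
  dsimp only at *
  subst h
  have hse' : e.1 * star s = e.1 * star t := by
    have := congrArg star hse
    simpa [star_idem e.2] using this
  have hval : ∀ (r : S) (g : Idem S), φ.1.toFun (conj r g) = φ.1.toFun (conj (r * e.1) g) := by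
    intro r g
    have : conj (r * e.1) g = e * conj r g * e := Idem.ext (by
      change star (r * e.1) * g.1 * (r * e.1) = e.1 * (star r * g.1 * r) * e.1
      rw [star_mul, star_idem e.2]; simp only [mul_assoc])
    rw [this, φ.1.map_mul, φ.1.map_mul, he]; simp
  have hact : tightAct s φ ha = tightAct t φ hb := by
    apply Subtype.ext
    apply Character.ext
    funext g
    change φ.1.toFun (conj s g) = φ.1.toFun (conj t g)
    rw [hval s, hval t, hse]
  refine Quotient.sound ⟨hact, conj (star s) e, ?_, ?_⟩
  · change φ.1.toFun (conj s (conj (star s) e)) = true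
    rw [conj_conj]
    have : conj (star s * s) e = dom s * e * dom s := Idem.ext (by
      change star (star s * s) * e.1 * (star s * s) = star s * s * e.1 * (star s * s)
      simp)
    rw [this, φ.1.map_mul, φ.1.map_mul, he, ha]; rfl
  · change star s * (star (star s) * e.1 * star s) = star t * (star (star s) * e.1 * star s)
    have h3 : ∀ r : S, star r * r * e.1 = e.1 * (star r * r) := fun r =>
      InvSemigroup.idem_comm _ _ (dom r).2 e.2
    calc star s * (star (star s) * e.1 * star s) = star s * s * e.1 * star s := by
          rw [star_star]; simp only [mul_assoc]
      _ = e.1 * (star s * s * star s) := by rw [h3]; simp only [mul_assoc]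
      _ = e.1 * (star t * t * star t) := by rw [star_mul_star, star_mul_star, hse']
      _ = star t * t * (e.1 * star t) := by rw [← mul_assoc, ← h3]; simp only [mul_assoc]
      _ = star t * (t * e.1) * star s := by rw [← hse']; simp only [mul_assoc]
      _ = star t * (star (star s) * e.1 * star s) := by
          rw [← hse, star_star]; simp only [mul_assoc]

/-- The groupoid operations `[s, θ_t φ] [t, φ] = [s t, φ]` and `[s, φ]⁻¹ = [s*, θ_s φ]`. -/
instance : GroupoidOps (TightGroupoid S) where
  IsProd a b c := ∃ (s t : S) (φ : tightSpectrum S) (ht : φ.1.toFun (dom t) = true)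
    (hs : (tightAct t φ ht).1.toFun (dom s) = true) (hst : φ.1.toFun (dom (s * t)) = true),
    a = germ s (tightAct t φ ht) hs ∧ b = germ t φ ht ∧ c = germ (s * t) φ hst
  inv := Quotient.lift
    (fun a : GermPair S =>
      germ (star a.1.1) (tightAct a.1.1 a.1.2 a.2) (tightAct_dom _ _ _)) germ_inv_aux

/-- The basic open set `Θ(s, U) = {[s, φ] : φ ∈ U}`. -/
def germBasic (s : S) (U : Set (tightSpectrum S)) : Set (TightGroupoid S) :=
  {g | ∃ (φ : tightSpectrum S) (h : φ.1.toFun (dom s) = true), φ ∈ U ∧ g = germ s φ h}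

/-- The topology generated by the sets `Θ(s, U)`, for `U` open and contained in `D_{s* s}`. -/
instance : TopologicalSpace (TightGroupoid S) :=
  TopologicalSpace.generateFrom
    {V | ∃ (s : S) (U : Set (tightSpectrum S)), IsOpen U ∧
      U ⊆ {φ | φ.1.toFun (dom s) = true} ∧ V = germBasic s U}

end InvSemigroup

/-! ## Tilings -/

/-- Euclidean space. -/
abbrev E (n : ℕ) : Type := EuclideanSpace ℝ (Fin n)

/-- A finite set of (labelled) prototiles `p_i ⊆ ℝⁿ`, each homeomorphic to the closed unit ball and
with the origin in its interior. -/
structure Prototiles (n N : ℕ) where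
  shape : Fin N → Set (E n)
  homeo_ball : ∀ i, Nonempty (shape i ≃ₜ Metric.closedBall (0 : E n) 1)
  zero_mem_interior : ∀ i, (0 : E n) ∈ interior (shape i)

/-- A tile `p_i + x`, recorded by the label `i` of its prototile and its puncture `x`. -/
@[ext] structure Tile (n N : ℕ) where
  label : Fin N
  puncture : E n

section Tilings

variable {n N : ℕ}

/-- The subset `p_i + x` of `ℝⁿ` occupied by a tile. -/
def Tile.carrier (p : Prototiles n N) (t : Tile n N) : Set (E n) :=
  (fun y => y + t.puncture) '' p.shape t.label

/-- The translate `t + x` of a tile. -/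
def Tile.shift (x : E n) (t : Tile n N) : Tile n N := ⟨t.label, t.puncture + x⟩

/-- The translate `P + x` of a set of tiles. -/
def shift (x : E n) (P : Set (Tile n N)) : Set (Tile n N) := Tile.shift x '' P

/-- The support of a set of tiles. -/
def supp (p : Prototiles n N) (P : Set (Tile n N)) : Set (E n) := ⋃ t ∈ P, t.carrier p

/-- Partial tilings: the interiors of the tiles are pairwise disjoint. -/
def IsPartialTiling (p : Prototiles n N) (P : Set (Tile n N)) : Prop :=
  P.Pairwise fun s t => Disjoint (interior (s.carrier p)) (interior (t.carrier p))

/-- Patches: finite partial tilings. -/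
def IsPatch (p : Prototiles n N) (P : Set (Tile n N)) : Prop := P.Finite ∧ IsPartialTiling p P

/-- Tilings: partial tilings with support `ℝⁿ`. -/
def IsTiling (p : Prototiles n N) (T : Set (Tile n N)) : Prop :=
  IsPartialTiling p T ∧ supp p T = univ

/-- `T(U)`, the set of the tiles of `T` that intersect `U`. -/
def meeting (p : Prototiles n N) (T : Set (Tile n N)) (U : Set (E n)) : Set (Tile n N) :=
  {t ∈ T | (t.carrier p ∩ U).Nonempty}

/-- Tilings by translates of the prototiles. -/
structure Tiling (p : Prototiles n N) where
  tiles : Set (Tile n N)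
  isTiling : IsTiling p tiles

/-- The tiling metric: the infimum of `1` and all `ε > 0` such that there are `x`, `x'` of length
less than `ε` for which `T - x` and `T' - x'` agree on the ball `B(0, 1/ε)`. -/
def tilingDist (p : Prototiles n N) (T T' : Set (Tile n N)) : ℝ :=
  sInf ({1} ∪ {ε : ℝ | ∃ x x' : E n, ‖x‖ < ε ∧ ‖x'‖ < ε ∧
    meeting p (shift (-x) T) (Metric.ball 0 (1 / ε)) =
      meeting p (shift (-x') T') (Metric.ball 0 (1 / ε))})

variable {p : Prototiles n N}

/-- The continuous hull `Ω_T`: all tilings (by the same prototiles) that are limits, in the tiling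
metric, of translates of `T`. -/
def hull (T : Tiling p) : Set (Tiling p) :=
  {T' | ∀ ε > 0, ∃ x : E n, tilingDist p T'.tiles (shift x T.tiles) < ε}

/-- Finite local complexity: for every `r > 0` there are only finitely many patches `T(B(x, r))`
up to translation. -/
def FiniteLocalComplexity (T : Tiling p) : Prop :=
  ∀ r > 0, ∃ F : Set (Set (Tile n N)), F.Finite ∧
    ∀ x : E n, ∃ P ∈ F, ∃ y : E n, meeting p T.tiles (Metric.ball x r) = shift y P

/-- Repetitivity: for every patch `P ⊆ T` there is `R > 0` such that each `T(B(x, R))` contains a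
translate of `P`. -/
def Repetitive (T : Tiling p) : Prop :=
  ∀ P ⊆ T.tiles, IsPatch p P →
    ∃ R > 0, ∀ x : E n, ∃ y : E n, shift y P ⊆ meeting p T.tiles (Metric.ball x R)

/-- Strong aperiodicity: the hull contains no periodic tiling. -/
def StronglyAperiodic (T : Tiling p) : Prop :=
  ∀ T' ∈ hull T, ∀ x : E n, x ≠ 0 → shift x T'.tiles ≠ T'.tiles

/-- The punctured hull `Ω_punc`: the tilings in the hull with a puncture at the origin. -/
@[ext] structure PuncturedHull (T : Tiling p) where
  tiling : Tiling p
  mem_hull : tiling ∈ hull T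
  exists_puncture : ∃ t ∈ tiling.tiles, t.puncture = 0

/-- The topology of the tiling metric on the punctured hull. -/
instance (T : Tiling p) : TopologicalSpace (PuncturedHull T) where
  IsOpen U := ∀ T₁ ∈ U, ∃ ε > 0, ∀ T₂ : PuncturedHull T,
    tilingDist p T₁.tiling.tiles T₂.tiling.tiles < ε → T₂ ∈ U
  isOpen_univ := fun _ _ => ⟨1, one_pos, fun _ _ => mem_univ _⟩
  isOpen_inter := by
    rintro U V hU hV T₁ ⟨h1, h2⟩
    obtain ⟨ε, hε, h⟩ := hU T₁ h1
    obtain ⟨δ, hδ, h'⟩ := hV T₁ h2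
    exact ⟨min ε δ, lt_min hε hδ, fun T₂ hT => ⟨h T₂ (hT.trans_le (min_le_left _ _)),
      h' T₂ (hT.trans_le (min_le_right _ _))⟩⟩
  isOpen_sUnion := by
    rintro 𝒰 h T₁ ⟨U, hU, hT⟩
    obtain ⟨ε, hε, h'⟩ := h U hU T₁ hT
    exact ⟨ε, hε, fun T₂ hT₂ => ⟨U, hU, h' T₂ hT₂⟩⟩

/-! ### Elementary facts on translates -/

theorem shift_zero (P : Set (Tile n N)) : shift 0 P = P := by
  have : Tile.shift (0 : E n) = (id : Tile n N → Tile n N) := by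
    funext t; simp [Tile.shift]
  rw [shift, this, image_id]

theorem Tile.shift_shift (x y : E n) (t : Tile n N) : (t.shift x).shift y = t.shift (x + y) := by
  simp [Tile.shift, add_assoc]

theorem Tile.shift_zero (t : Tile n N) : t.shift 0 = t := by
  simp [Tile.shift]

theorem shift_shift (x y : E n) (P : Set (Tile n N)) : shift y (shift x P) = shift (x + y) P := by
  simp only [shift, image_image, Tile.shift_shift]

theorem Tile.shift_left_cancel {x y : E n} {t : Tile n N} (h : t.shift x = t.shift y) : x = y := by
  have := congrArg Tile.puncture h
  simpa [Tile.shift] using this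

theorem shift_union (x : E n) (P Q : Set (Tile n N)) :
    shift x (P ∪ Q) = shift x P ∪ shift x Q := image_union _ _ _

/-! ### The groupoid of translational equivalence on the punctured hull -/

/-- `R_punc`: the pairs `(T₁, T₂) = (T₁, T₁ + x)` of elements of the punctured hull. -/
structure RPunc (T : Tiling p) where
  fst : PuncturedHull T
  snd : PuncturedHull T
  exists_vec : ∃ x : E n, snd.tiling.tiles = shift x fst.tiling.tiles

/-- The vector `x` in `(T₁, T₁ + x)`; it is unique if `T` is strongly aperiodic. -/
def RPunc.vec {T : Tiling p} (r : RPunc T) : E n := Classical.choose r.exists_vec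

/-- The topology from `Ω_punc × ℝⁿ`, with `(T₁, T₁ + x)` identified with `(T₁, x)`. -/
instance (T : Tiling p) : TopologicalSpace (RPunc T) :=
  TopologicalSpace.induced (fun r : RPunc T => (r.fst, r.vec)) inferInstance

/-- The groupoid operations `(T₁, T₂) (T₂, T₃) = (T₁, T₃)` and `(T₁, T₂)⁻¹ = (T₂, T₁)`. -/
instance (T : Tiling p) : GroupoidOps (RPunc T) where
  IsProd a b c := a.snd = b.fst ∧ c.fst = a.fst ∧ c.snd = b.snd
  inv a := ⟨a.snd, a.fst, by
    obtain ⟨x, hx⟩ := a.exists_vec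
    exact ⟨-x, by rw [hx, shift_shift, add_neg_cancel, shift_zero]⟩⟩

/-! ### The inverse semigroup of doubly pointed pattern classes -/

/-- Triples `(t₁, P, t₂)` where `P` is a patch which appears in `T` (up to translation) and whose
support has connected interior, and `t₁`, `t₂` are tiles of `P`. -/
structure PointedPatch (T : Tiling p) where
  t₁ : Tile n N
  P : Set (Tile n N)
  t₂ : Tile n N
  isPatch : IsPatch p P
  appears : ∃ x : E n, shift x P ⊆ T.tiles
  connected : IsConnected (interior (supp p P))
  mem₁ : t₁ ∈ P
  mem₂ : t₂ ∈ P

variable {T : Tiling p}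

/-- Equivalence of triples up to a common translation. -/
instance patternSetoid (T : Tiling p) : Setoid (PointedPatch T) where
  r a b := ∃ x : E n, a.t₁.shift x = b.t₁ ∧ a.t₂.shift x = b.t₂ ∧ shift x a.P = b.P
  iseqv :=
    { refl := fun a => ⟨0, Tile.shift_zero _, Tile.shift_zero _, shift_zero _⟩
      symm := by
        rintro a b ⟨x, h1, h2, h3⟩
        refine ⟨-x, ?_, ?_, ?_⟩
        · rw [← h1, Tile.shift_shift, add_neg_cancel, Tile.shift_zero]
        · rw [← h2, Tile.shift_shift, add_neg_cancel, Tile.shift_zero]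
        · rw [← h3, shift_shift, add_neg_cancel, shift_zero]
      trans := by
        rintro a b c ⟨x, h1, h2, h3⟩ ⟨y, h1', h2', h3'⟩
        refine ⟨x + y, ?_, ?_, ?_⟩
        · rw [← Tile.shift_shift, h1, h1']
        · rw [← Tile.shift_shift, h2, h2']
        · rw [← shift_shift, h3, h3'] }

/-- The set `S` of doubly pointed pattern classes together with a zero element. -/
inductive PatternSemigroup (T : Tiling p) : Type
  | zero : PatternSemigroup T
  | of : Quotient (patternSetoid T) → PatternSemigroup T

/-- The class `[t₁, P, t₂]`. -/
def cls (a : PointedPatch T) : PatternSemigroup T :=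
  PatternSemigroup.of (Quotient.mk (patternSetoid T) a)

instance : Zero (PatternSemigroup T) := ⟨PatternSemigroup.zero⟩

theorem isClosed_supp {P : Set (Tile n N)} (hP : P.Finite) : IsClosed (supp p P) := by
  refine hP.isClosed_biUnion fun t _ => ?_
  have hc : IsCompact (p.shape t.label) := by
    obtain ⟨h⟩ := p.homeo_ball t.label
    have : CompactSpace (Metric.closedBall (0 : E n) 1) :=
      isCompact_iff_compactSpace.1 (isCompact_closedBall _ _)
    exact isCompact_iff_compactSpace.2 h.symm.compactSpace
  exact (hc.image (by fun_prop)).isClosed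

theorem interior_union_subset {A B : Set (E n)} (hA : IsClosed A)  :
    interior (A ∪ B) ⊆ closure (interior A ∪ interior B) := by
  intro x hx
  rw [mem_closure_iff]
  intro o ho hxo
  by_cases h : (o ∩ interior (A ∪ B)) ⊆ A
  · exact ⟨x, hxo, Or.inl (interior_maximal h (ho.inter isOpen_interior) ⟨hxo, hx⟩)⟩
  · obtain ⟨y, hy, hyA⟩ := not_subset.1 h
    have hsub : (o ∩ interior (A ∪ B)) \ A ⊆ B := fun z hz =>
      (interior_subset hz.1.2).resolve_left hz.2
    exact ⟨y, hy.1, Or.inr (interior_maximal hsub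
      ((ho.inter isOpen_interior).sdiff hA) ⟨hy, hyA⟩)⟩

theorem supp_mono {P Q : Set (Tile n N)} (h : P ⊆ Q) : supp p P ⊆ supp p Q :=
  biUnion_subset_biUnion_left h

theorem supp_union (P Q : Set (Tile n N)) : supp p (P ∪ Q) = supp p P ∪ supp p Q :=
  biUnion_union _ _ _

theorem puncture_mem_interior {P : Set (Tile n N)} {t : Tile n N} (ht : t ∈ P) :
    t.puncture ∈ interior (supp p P) := by
  have h1 : t.carrier p ⊆ supp p P := subset_biUnion_of_mem (u := fun t => Tile.carrier p t) ht
  refine interior_mono h1 ?_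
  have h2 := p.zero_mem_interior t.label
  have h3 : (Homeomorph.addRight t.puncture) '' interior (p.shape t.label) =
      interior ((Homeomorph.addRight t.puncture) '' p.shape t.label) :=
    (Homeomorph.addRight t.puncture).image_interior _
  have h4 : t.puncture ∈ (Homeomorph.addRight t.puncture) '' interior (p.shape t.label) :=
    ⟨0, h2, by simp⟩
  rw [h3] at h4
  exact h4

theorem connected_union {P Q : Set (Tile n N)} {t : Tile n N} (hP : P.Finite)
    (hPc : IsConnected (interior (supp p P))) (hQc : IsConnected (interior (supp p Q)))
    (htP : t ∈ P) (htQ : t ∈ Q) : IsConnected (interior (supp p (P ∪ Q))) := by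
  have h1 : IsConnected (interior (supp p P) ∪ interior (supp p Q)) :=
    hPc.union ⟨t.puncture, puncture_mem_interior htP, puncture_mem_interior htQ⟩ hQc
  refine h1.subset_closure ?_ ?_
  · exact union_subset (interior_mono (supp_mono subset_union_left))
      (interior_mono (supp_mono subset_union_right))
  · rw [supp_union]
    exact interior_union_subset (isClosed_supp hP)

/-- `(t₁, P ∪ P', t₂')`, for triples `(t₁, P, t₂)`, `(t₁', P', t₂')` with `P, P' ⊆ T` and
`t₂ = t₁'`. -/
def glue (a b : PointedPatch T) (ha : a.P ⊆ T.tiles) (hb : b.P ⊆ T.tiles)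
    (h : a.t₂ = b.t₁) : PointedPatch T where
  t₁ := a.t₁
  P := a.P ∪ b.P
  t₂ := b.t₂
  isPatch := ⟨a.isPatch.1.union b.isPatch.1, T.isTiling.1.mono (union_subset ha hb)⟩
  appears := ⟨0, by rw [shift_zero]; exact union_subset ha hb⟩
  connected := connected_union a.isPatch.1 a.connected b.connected a.mem₂
    (h ▸ b.mem₁)
  mem₁ := Or.inl a.mem₁
  mem₂ := Or.inr b.mem₂

/-- `c` is the product of the classes `s` and `t`: there are representatives
`s = [t₁, P, t₂]` and `t = [t₁', P', t₂']` with `P, P' ⊆ T` and `t₂ = t₁'`, and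
`c = [t₁, P ∪ P', t₂']`. -/
def IsGlue (s t c : PatternSemigroup T) : Prop :=
  ∃ (a b : PointedPatch T) (ha : a.P ⊆ T.tiles) (hb : b.P ⊆ T.tiles) (h : a.t₂ = b.t₁),
    s = cls a ∧ t = cls b ∧ c = cls (glue a b ha hb h)

open scoped Classical in
/-- The product: `[t₁, P, t₂] [t₁', P', t₂'] = [t₁, P ∪ P', t₂']` for representatives with
`P, P' ⊆ T` and `t₂ = t₁'` if such representatives exist, and zero otherwise. -/
instance : Mul (PatternSemigroup T) :=
  ⟨fun s t => if h : ∃ c, IsGlue s t c then Classical.choose h else 0⟩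

theorem cls_eq_iff {a b : PointedPatch T} : cls a = cls b ↔
    ∃ x : E n, a.t₁.shift x = b.t₁ ∧ a.t₂.shift x = b.t₂ ∧ shift x a.P = b.P := by
  constructor
  · intro h
    exact Quotient.exact (PatternSemigroup.of.inj h)
  · intro h
    exact congrArg PatternSemigroup.of (Quotient.sound h)

theorem cls_ne_zero (a : PointedPatch T) : cls a ≠ 0 := by
  intro h
  cases h

theorem IsGlue.unique {s t c c' : PatternSemigroup T} (h : IsGlue s t c) (h' : IsGlue s t c') :
    c = c' := by
  obtain ⟨a, b, ha, hb, hab, rfl, rfl, rfl⟩ := h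
  obtain ⟨a', b', ha', hb', hab', h1, h2, rfl⟩ := h'
  obtain ⟨x, hx1, hx2, hx3⟩ := cls_eq_iff.1 h1
  obtain ⟨y, hy1, hy2, hy3⟩ := cls_eq_iff.1 h2
  have hxy : x = y := by
    apply Tile.shift_left_cancel (t := a.t₂)
    rw [hx2, hab', ← hy1, hab]
  subst hxy
  refine cls_eq_iff.2 ⟨x, hx1, hy2, ?_⟩
  change shift x (a.P ∪ b.P) = a'.P ∪ b'.P
  rw [shift_union, hx3, hy3]

theorem IsGlue.mul_eq {s t c : PatternSemigroup T} (h : IsGlue s t c) : s * t = c := by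
  have hex : ∃ c, IsGlue s t c := ⟨c, h⟩
  have h1 : s * t = Classical.choose hex := dif_pos hex
  rw [h1]
  exact (Classical.choose_spec hex).unique h

theorem mul_eq_zero_of {s t : PatternSemigroup T} (h : ¬ ∃ c, IsGlue s t c) : s * t = 0 :=
  dif_neg h

theorem isGlue_of_mul_ne_zero {s t : PatternSemigroup T} (h : s * t ≠ 0) :
    IsGlue s t (s * t) := by
  by_cases hex : ∃ c, IsGlue s t c
  · obtain ⟨c, hc⟩ := hex
    rw [hc.mul_eq]; exact hc
  · exact absurd (mul_eq_zero_of hex) h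

theorem zero_mul' (s : PatternSemigroup T) : 0 * s = 0 := by
  apply mul_eq_zero_of
  rintro ⟨c, a, b, ha, hb, hab, h1, -⟩
  exact cls_ne_zero a h1.symm

theorem mul_zero' (s : PatternSemigroup T) : s * 0 = 0 := by
  apply mul_eq_zero_of
  rintro ⟨c, a, b, ha, hb, hab, -, h1, -⟩
  exact cls_ne_zero b h1.symm

/-- A translate of a triple. -/
def PointedPatch.translate (a : PointedPatch T) (x : E n) (h : shift x a.P ⊆ T.tiles) :
    PointedPatch T where
  t₁ := a.t₁.shift x
  P := shift x a.P
  t₂ := a.t₂.shift x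
  isPatch := ⟨a.isPatch.1.image _, T.isTiling.1.mono h⟩
  appears := ⟨0, by rw [shift_zero]; exact h⟩
  connected := by
    have h1 : supp p (shift x a.P) = (Homeomorph.addRight x) '' supp p a.P := by
      ext y
      simp only [supp, shift, Tile.shift, Tile.carrier, mem_iUnion, mem_image, exists_prop,
        Homeomorph.coe_addRight]
      constructor
      · rintro ⟨t, ⟨t', ht', rfl⟩, z, hz, rfl⟩
        exact ⟨z + t'.puncture, ⟨t', ht', z, hz, rfl⟩, by simp [add_assoc]⟩
      · rintro ⟨w, ⟨t', ht', z, hz, rfl⟩, rfl⟩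
        exact ⟨_, ⟨t', ht', rfl⟩, z, hz, by simp [add_assoc]⟩
    rw [h1, ← Homeomorph.image_interior]
    exact a.connected.image _ (Homeomorph.addRight x).continuous.continuousOn
  mem₁ := mem_image_of_mem _ a.mem₁
  mem₂ := mem_image_of_mem _ a.mem₂

theorem PointedPatch.cls_translate (a : PointedPatch T) (x : E n) (h : shift x a.P ⊆ T.tiles) :
    cls a = cls (a.translate x h) := cls_eq_iff.2 ⟨x, rfl, rfl, rfl⟩

theorem isGlue_left {s t r u v : PatternSemigroup T} (h : IsGlue s t u) (h' : IsGlue u r v) :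
    ∃ w, IsGlue t r w ∧ IsGlue s w v := by
  obtain ⟨a, b, ha, hb, hab, rfl, rfl, rfl⟩ := h
  obtain ⟨d, e, hd, he, hde, h1, rfl, rfl⟩ := h'
  obtain ⟨x, hx1, hx2, hx3⟩ := cls_eq_iff.1 h1
  change shift x (a.P ∪ b.P) = d.P at hx3
  rw [shift_union] at hx3
  have ha' : shift x a.P ⊆ T.tiles := (subset_union_left.trans hx3.subset).trans hd
  have hb' : shift x b.P ⊆ T.tiles := (subset_union_right.trans hx3.subset).trans hd
  have hbe : (b.translate x hb').t₂ = e.t₁ := hx2.trans hde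
  refine ⟨cls (glue (b.translate x hb') e hb' he hbe),
    ⟨b.translate x hb', e, hb', he, hbe, b.cls_translate x hb', rfl, rfl⟩,
    ⟨a.translate x ha', glue (b.translate x hb') e hb' he hbe, ha', union_subset hb' he, ?_,
      a.cls_translate x ha', rfl, ?_⟩⟩
  · change a.t₂.shift x = b.t₁.shift x
    rw [hab]
  · refine cls_eq_iff.2 ⟨0, ?_, Tile.shift_zero _, ?_⟩
    · rw [Tile.shift_zero]; exact hx1.symm
    · rw [shift_zero]
      change d.P ∪ e.P = shift x a.P ∪ (shift x b.P ∪ e.P)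
      rw [← hx3, union_assoc]

/-- `[t₁, P, t₂]* = [t₂, P, t₁]`, at the level of triples. -/
def PointedPatch.flip (a : PointedPatch T) : PointedPatch T :=
  ⟨a.t₂, a.P, a.t₁, a.isPatch, a.appears, a.connected, a.mem₂, a.mem₁⟩

/-- The involution `[t₁, P, t₂]* = [t₂, P, t₁]`, `0* = 0`. -/
instance : Star (PatternSemigroup T) where
  star
    | .zero => .zero
    | .of q => .of (Quotient.map PointedPatch.flip
        (by rintro _ _ ⟨x, h1, h2, h3⟩; exact ⟨x, h2, h1, h3⟩) q)

theorem star_cls (a : PointedPatch T) : star (cls a) = cls a.flip := rfl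

theorem star_zero_eq : star (0 : PatternSemigroup T) = 0 := rfl

theorem eq_zero_or_cls (s : PatternSemigroup T) : s = 0 ∨ ∃ a : PointedPatch T, s = cls a := by
  rcases s with _ | q
  · exact Or.inl rfl
  · obtain ⟨a, rfl⟩ := Quotient.exists_rep q
    exact Or.inr ⟨a, rfl⟩

/-- Each class has a representative contained in `T`. -/
theorem eq_zero_or_cls_sub (s : PatternSemigroup T) :
    s = 0 ∨ ∃ a : PointedPatch T, a.P ⊆ T.tiles ∧ s = cls a := by
  rcases eq_zero_or_cls s with h | ⟨a, rfl⟩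
  · exact Or.inl h
  · obtain ⟨x, hx⟩ := a.appears
    exact Or.inr ⟨a.translate x hx, hx, a.cls_translate x hx⟩

theorem star_star' (s : PatternSemigroup T) : star (star s) = s := by
  rcases eq_zero_or_cls s with rfl | ⟨a, rfl⟩ <;> rfl

theorem IsGlue.star {s t c : PatternSemigroup T} (h : IsGlue s t c) :
    IsGlue (star t) (star s) (star c) := by
  obtain ⟨a, b, ha, hb, hab, rfl, rfl, rfl⟩ := h
  refine ⟨b.flip, a.flip, hb, ha, hab.symm, rfl, rfl, ?_⟩
  rw [star_cls]
  refine cls_eq_iff.2 ⟨0, Tile.shift_zero _, Tile.shift_zero _, ?_⟩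
  rw [shift_zero]
  exact union_comm _ _

theorem star_mul' (s t : PatternSemigroup T) : star (s * t) = star t * star s := by
  by_cases h : s * t = 0
  · by_cases h' : star t * star s = 0
    · rw [h, h', star_zero_eq]
    · have := (isGlue_of_mul_ne_zero h').star
      rw [star_star', star_star'] at this
      rw [this.mul_eq, star_star']
  · exact (isGlue_of_mul_ne_zero h).star.mul_eq.symm

theorem mul_assoc_aux {s t r : PatternSemigroup T} (h : s * t * r ≠ 0) :
    s * t * r = s * (t * r) := by
  have h1 : s * t ≠ 0 := fun h0 => h (by rw [h0, zero_mul'])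
  obtain ⟨w, hw1, hw2⟩ := isGlue_left (isGlue_of_mul_ne_zero h1) (isGlue_of_mul_ne_zero h)
  rw [hw1.mul_eq, hw2.mul_eq]

theorem mul_assoc' (s t r : PatternSemigroup T) : s * t * r = s * (t * r) := by
  by_cases h : s * t * r = 0
  · by_cases h' : s * (t * r) = 0
    · rw [h, h']
    · have h1 : star r * star t * star s ≠ 0 := by
        intro h0
        apply h'
        have h2 : star (s * (t * r)) = star r * star t * star s := by rw [star_mul', star_mul']
        rw [← star_star' (s * (t * r)), h2, h0, star_zero_eq]
      have h2 := congrArg star (mul_assoc_aux h1)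
      simp only [star_mul', star_star'] at h2
      exact h2.symm
  · exact mul_assoc_aux h

theorem mul_star_mul' (s : PatternSemigroup T) : s * star s * s = s := by
  rcases eq_zero_or_cls_sub s with rfl | ⟨a, ha, rfl⟩
  · rw [mul_zero']
  · have h1 : IsGlue (cls a) (star (cls a)) (cls (glue a a.flip ha ha rfl)) :=
      ⟨a, a.flip, ha, ha, rfl, rfl, rfl, rfl⟩
    have h2 : IsGlue (cls (glue a a.flip ha ha rfl)) (cls a)
        (cls (glue (glue a a.flip ha ha rfl) a (union_subset ha ha) ha rfl)) :=
      ⟨_, a, union_subset ha ha, ha, rfl, rfl, rfl, rfl⟩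
    rw [h1.mul_eq, h2.mul_eq]
    refine cls_eq_iff.2 ⟨0, Tile.shift_zero _, Tile.shift_zero _, ?_⟩
    rw [shift_zero]
    change a.P ∪ a.P ∪ a.P = a.P
    simp

/-- The non-zero idempotents are the classes `[t, P, t]`. -/
theorem idem_form {s : PatternSemigroup T} (h : s * s = s) :
    s = 0 ∨ ∃ a : PointedPatch T, a.t₁ = a.t₂ ∧ s = cls a := by
  by_cases h0 : s = 0
  · exact Or.inl h0
  · have hg : IsGlue s s s := by
      have := isGlue_of_mul_ne_zero (s := s) (t := s) (by rw [h]; exact h0)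
      rwa [h] at this
    obtain ⟨a, b, ha, hb, hab, h1, h2, h3⟩ := hg
    refine Or.inr ⟨a, ?_, h1⟩
    obtain ⟨x, hx1, hx2, hx3⟩ := cls_eq_iff.1 (h1.symm.trans h2)
    obtain ⟨y, hy1, hy2, hy3⟩ := cls_eq_iff.1 (h1.symm.trans h3)
    have hy : y = 0 := by
      apply Tile.shift_left_cancel (t := a.t₁)
      rw [hy1, Tile.shift_zero]; rfl
    have hx : x = y := by
      apply Tile.shift_left_cancel (t := a.t₂)
      rw [hx2, hy2]; rfl
    rw [hx, hy, Tile.shift_zero] at hx1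
    rw [hx1, hab]

theorem isGlue_comm {s t c : PatternSemigroup T} (hs : s * s = s) (ht : t * t = t)
    (h : IsGlue s t c) : IsGlue t s c := by
  obtain ⟨a, b, ha, hb, hab, rfl, rfl, rfl⟩ := h
  have ha' : a.t₁ = a.t₂ := by
    rcases idem_form hs with h0 | ⟨d, hd, h1⟩
    · exact absurd h0 (cls_ne_zero a)
    · obtain ⟨x, hx1, hx2, -⟩ := cls_eq_iff.1 h1.symm
      rw [← hx1, ← hx2, hd]
  have hb' : b.t₁ = b.t₂ := by
    rcases idem_form ht with h0 | ⟨d, hd, h1⟩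
    · exact absurd h0 (cls_ne_zero b)
    · obtain ⟨x, hx1, hx2, -⟩ := cls_eq_iff.1 h1.symm
      rw [← hx1, ← hx2, hd]
  refine ⟨b, a, hb, ha, by rw [← hb', ← hab, ha'], rfl, rfl, ?_⟩
  refine cls_eq_iff.2 ⟨0, ?_, ?_, ?_⟩
  · rw [Tile.shift_zero]
    change a.t₁ = b.t₁
    rw [ha', hab]
  · rw [Tile.shift_zero]
    change b.t₂ = a.t₂
    rw [← hb', hab]
  · rw [shift_zero]
    exact union_comm _ _

theorem idem_comm' (s t : PatternSemigroup T) (hs : s * s = s) (ht : t * t = t) :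
    s * t = t * s := by
  by_cases h : s * t = 0
  · by_cases h' : t * s = 0
    · rw [h, h']
    · exact (isGlue_comm ht hs (isGlue_of_mul_ne_zero h')).mul_eq
  · exact (isGlue_comm hs ht (isGlue_of_mul_ne_zero h)).mul_eq.symm

/-- The doubly pointed pattern classes of a tiling form an inverse semigroup with zero. -/
instance : InvSemigroup (PatternSemigroup T) where
  mul_assoc := mul_assoc'
  zero_mul := zero_mul'
  mul_zero := mul_zero'
  star_involutive := star_star'
  star_mul := star_mul'
  mul_star_mul := mul_star_mul'
  idem_comm := idem_comm'

end Tilings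

end TilingTight

end

namespace TilingTight

/-! ## Invariance of domain for balls -/

section InvarianceOfDomain

open MeasureTheory Metric

variable {n : ℕ}

/-! A punctured tiling `X` defines a character of the idempotents: it is 1 on `[t, P, t]` when `P`,
moved so that the puncture of `t` is the origin, lies in `X`. Its filter is maximal, because a patch
compatible with every `X(B(0, R))` must itself lie in `X` (`PuncturedHull.isUltra_char`).
Conversely, finite local complexity makes the set of idempotents `[t, T(B(x(t), R)), t]` finite for
each `R`. Every ultra-filter contains one of them, and meeting a finite set is a closed condition,
so every tight filter contains one too. The patches of a tight character therefore fill out a tiling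
in the hull, and `puncturedHullHomeo` identifies the punctured hull with the tight spectrum.

Under this identification `[t₁, P, t₂]` acts on the tilings containing `P` with `t₂` at the origin,
by moving the puncture of `t₁` to the origin (`PuncturedHull.charAct_char`). The range of a germ is
thus a translate of its source. Strong aperiodicity recovers the translation vector, so a germ is
determined by source and range (`tightPrincipal`). A pair `(T₁, T₂)` goes to the germ at `T₂` of a
large patch pointed at the tile over the puncture of `T₁` and at the origin tile; algebraically this
is a bijection of principal groupoids. For the topologies, punctures are uniformly separated, so the
vector of a pair is locally constant (`RPunc.isOpen_vec_eq`), and on both sides a neighbourhood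
amounts to a fixed vector and an open set of tilings. The C*-algebras then agree because
representations can be transported along the isomorphism.

Tiles are only topological balls, so two facts need invariance of domain: a tile lies in the closure
of its interior, and that interior is connected. The first makes patches rigid
(`meeting_eq_of_subset`), and both together give ball patches a support with connected interior.
Invariance of domain is derived from the absence of a `C¹` retraction of a ball onto its sphere,
proved by integrating a Jacobian that is polynomial in the homotopy parameter. -/

/-! ### Absence of `C¹` retractions of a ball onto its sphere. -/

theorem exists_polynomial_det_one_add_smul (A : E n →L[ℝ] E n) :
    ∃ q : Polynomial ℝ, q.degree < (n + 1 : ℕ) ∧ ∀ t : ℝ, q.eval t = (1 + t • A).det := by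
  let b := (EuclideanSpace.basisFun (Fin n) ℝ).toBasis
  let M := LinearMap.toMatrix b b (A : E n →ₗ[ℝ] E n)
  refine ⟨((Polynomial.X : Polynomial ℝ) • M.map Polynomial.C +
    (1 : Matrix (Fin n) (Fin n) ℝ).map Polynomial.C).det, ?_, fun t => ?_⟩
  · refine lt_of_le_of_lt Polynomial.degree_le_natDegree ?_
    have := Polynomial.natDegree_det_X_add_C_le M (1 : Matrix (Fin n) (Fin n) ℝ)
    rw [Fintype.card_fin] at this
    exact_mod_cast Nat.lt_succ_of_le this
  · rw [ContinuousLinearMap.det, ← LinearMap.det_toMatrix b, ← Polynomial.coe_evalRingHom,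
      RingHom.map_det]
    congr 1
    have h1 : ((1 + t • A : E n →L[ℝ] E n) : E n →ₗ[ℝ] E n) = 1 + t • (A : E n →ₗ[ℝ] E n) := rfl
    rw [h1, map_add (LinearMap.toMatrix b b), map_smul (LinearMap.toMatrix b b),
      LinearMap.toMatrix_one]
    ext i j
    simp only [RingHom.mapMatrix_apply, Matrix.map_apply, Matrix.add_apply, Matrix.smul_apply,
      smul_eq_mul, map_add, Polynomial.coe_evalRingHom, Polynomial.eval_mul, Polynomial.eval_X,
      Polynomial.eval_C]
    exact add_comm _ _

theorem isUnit_one_add_smul {A : E n →L[ℝ] E n} {t : ℝ} (ht : ‖t • A‖ < 1) :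
    IsUnit (1 + t • A) := by
  have h : IsUnit (1 - -(t • A)) := isUnit_one_sub_of_norm_lt_one (by rwa [norm_neg])
  rwa [sub_neg_eq_add] at h

/-- Along the segment from 0 to `t` the operator stays invertible and the determinant starts at 1,
so the intermediate value theorem forbids a change of sign. This removes the absolute value from the
change of variables formula. -/
theorem det_one_add_smul_pos {A : E n →L[ℝ] E n} {t : ℝ} (ht0 : 0 ≤ t) (ht : ‖t • A‖ < 1) :
    0 < (1 + t • A).det := by
  have hne : ∀ s ∈ Icc 0 t, (1 + s • A).det ≠ 0 := by
    intro s hs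
    have h1 : ‖s • A‖ < 1 := by
      refine lt_of_le_of_lt ?_ ht
      rw [norm_smul, norm_smul, Real.norm_of_nonneg hs.1, Real.norm_of_nonneg ht0]
      exact mul_le_mul_of_nonneg_right hs.2 (norm_nonneg _)
    have h2 : IsUnit ((1 + s • A : E n →L[ℝ] E n) : E n →ₗ[ℝ] E n) :=
      (isUnit_one_add_smul h1).map (ContinuousLinearMap.toLinearMapRingHom : (E n →L[ℝ] E n) →+* (E n →ₗ[ℝ] E n))
    exact (h2.map LinearMap.det).ne_zero
  have hcont : Continuous fun s : ℝ => (1 + s • A).det :=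
    ContinuousLinearMap.continuous_det.comp (by fun_prop)
  by_contra hneg
  have h0 : (1 + (0 : ℝ) • A).det = 1 := by
    have : (1 + (0 : ℝ) • A) = 1 := by rw [zero_smul ℝ A, add_zero]
    rw [this]
    exact LinearMap.det_id
  obtain ⟨s, hs, hs0⟩ := intermediate_value_Icc' ht0 hcont.continuousOn
    (show (0 : ℝ) ∈ Icc _ _ from ⟨not_lt.1 hneg, by simp only [h0]; exact zero_le_one⟩)
  exact hne s hs hs0

theorem surjective_of_isUnit {A : E n →L[ℝ] E n} (h : IsUnit A) : Function.Surjective A := by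
  obtain ⟨u, rfl⟩ := h
  intro y
  refine ⟨(↑u⁻¹ : E n →L[ℝ] E n) y, ?_⟩
  rw [← mul_apply_eq_comp, Units.mul_inv]
  rfl

variable {R : ℝ} {f : E n → E n}

/-- For small `t`, the straight line homotopy from the identity to a `C¹` self-map of a ball which
fixes the sphere is a diffeomorphism of the open ball, so its Jacobian integrates to the volume. -/
theorem integral_det_homotopy (hf : ContDiff ℝ 1 f) (hR : 0 < R)
    (hball : ∀ x ∈ closedBall (0 : E n) R, ‖f x‖ ≤ R) (hfix : ∀ x ∈ sphere (0 : E n) R, f x = x) :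
    ∃ t₀ > (0 : ℝ), ∀ t ∈ Ioo 0 t₀,
      ∫ x in ball (0 : E n) R, (1 + t • (fderiv ℝ f x - 1)).det = volume.real (ball (0 : E n) R) := by
  have hg : ContDiff ℝ 1 fun x => f x - x := hf.sub contDiff_id
  have hfd : ∀ x, HasStrictFDerivAt f (fderiv ℝ f x) x := fun x =>
    hf.contDiffAt.hasStrictFDerivAt one_ne_zero
  have hgd : ∀ x, HasStrictFDerivAt (fun x => f x - x) (fderiv ℝ f x - 1) x := fun x =>
    (hfd x).sub (hasStrictFDerivAt_id x)
  have hcd : Continuous fun x => fderiv ℝ f x - 1 :=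
    (hf.continuous_fderiv one_ne_zero).sub continuous_const
  obtain ⟨C, hC⟩ := (isCompact_closedBall (0 : E n) R).exists_bound_of_continuousOn hcd.continuousOn
  have hC0 : 0 ≤ C := (norm_nonneg _).trans (hC 0 (mem_closedBall_self hR.le))
  have hlip : ∀ x ∈ closedBall (0 : E n) R, ∀ y ∈ closedBall (0 : E n) R,
      ‖(f y - y) - (f x - x)‖ ≤ C * ‖y - x‖ := by
    intro x hx y hy
    exact (convex_closedBall (0 : E n) R).norm_image_sub_le_of_norm_hasFDerivWithin_le
      (fun z _ => (hgd z).hasFDerivAt.hasFDerivWithinAt) hC hx hy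
  -- `t < 1` makes the homotopy a convex combination of `x` and `f x`; `t * C < 1` makes it
  -- injective with invertible derivative.
  refine ⟨min 1 (1 / (C + 1)), by positivity, ?_⟩
  rintro t ⟨ht0, ht⟩
  have ht1 : t < 1 := ht.trans_le (min_le_left _ _)
  have htC : t * C < 1 := by
    have h1 : t < 1 / (C + 1) := ht.trans_le (min_le_right _ _)
    rw [lt_div_iff₀ (by positivity)] at h1
    nlinarith
  let F : E n → E n := fun x => x + t • (f x - x)
  have hFd : ∀ x, HasStrictFDerivAt F (1 + t • (fderiv ℝ f x - 1)) x := fun x =>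
    (hasStrictFDerivAt_id x).add ((hgd x).const_smul t)
  have hFc : Continuous F := continuous_id.add (hg.continuous.const_smul t)
  have hnorm : ∀ x ∈ closedBall (0 : E n) R, ‖t • (fderiv ℝ f x - 1)‖ < 1 := by
    intro x hx
    rw [norm_smul, Real.norm_of_nonneg ht0.le]
    exact lt_of_le_of_lt (mul_le_mul_of_nonneg_left (hC x hx) ht0.le) htC
  have hinj : InjOn F (closedBall (0 : E n) R) := by
    intro x hx y hy hxy
    have h1 : y - x = - (t • ((f y - y) - (f x - x))) := by
      have : x + t • (f x - x) = y + t • (f y - y) := hxy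
      rw [smul_sub, neg_sub, sub_eq_sub_iff_add_eq_add, ← this, add_comm]
    have h2 : ‖y - x‖ ≤ t * (C * ‖y - x‖) := by
      conv_lhs => rw [h1, norm_neg, norm_smul, Real.norm_of_nonneg ht0.le]
      exact mul_le_mul_of_nonneg_left (hlip x hx y hy) ht0.le
    have h3 : ‖y - x‖ = 0 := by
      have := norm_nonneg (y - x)
      by_contra hne
      have hpos : 0 < ‖y - x‖ := lt_of_le_of_ne this (Ne.symm hne)
      nlinarith
    exact (sub_eq_zero.1 (norm_eq_zero.1 h3)).symm
  have hmaps : F '' ball (0 : E n) R ⊆ ball (0 : E n) R := by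
    rintro _ ⟨x, hx, rfl⟩
    have hx' := mem_ball_zero_iff.1 hx
    have h1 : F x = (1 - t) • x + t • f x := by
      simp only [F]; module
    rw [mem_ball_zero_iff, h1]
    calc ‖(1 - t) • x + t • f x‖ ≤ ‖(1 - t) • x‖ + ‖t • f x‖ := norm_add_le _ _
      _ = (1 - t) * ‖x‖ + t * ‖f x‖ := by
        rw [norm_smul, norm_smul, Real.norm_of_nonneg ht0.le, Real.norm_of_nonneg (by linarith)]
      _ < R := by
        have := hball x (ball_subset_closedBall hx)
        nlinarith
  -- Openness of the image is the local surjectivity of maps with surjective strict derivative.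
  have hopen : IsOpen (F '' ball (0 : E n) R) := by
    rw [isOpen_iff_mem_nhds]
    rintro _ ⟨x, hx, rfl⟩
    rw [← (hFd x).map_nhds_eq_of_surj (LinearMap.range_eq_top.2 (surjective_of_isUnit
      (isUnit_one_add_smul (hnorm x (ball_subset_closedBall hx)))))]
    exact Filter.image_mem_map (isOpen_ball.mem_nhds hx)
  have himage : F '' ball (0 : E n) R = ball (0 : E n) R := by
    refine hmaps.antisymm ?_
    -- The image is open and also relatively closed in the connected open ball: a limit point that
    -- is not an image of an interior point is the image of a point of the sphere, which is fixed
    -- and so lies outside the open ball.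
    refine (convex_ball (0 : E n) R).isPreconnected.subset_of_closure_inter_subset hopen ?_ ?_
    · have h0 : F 0 ∈ F '' ball (0 : E n) R := mem_image_of_mem _ (mem_ball_self hR)
      exact ⟨F 0, hmaps h0, h0⟩
    · rintro y ⟨hy, hyR⟩
      have hcl : closure (F '' ball (0 : E n) R) ⊆ F '' closedBall (0 : E n) R :=
        closure_minimal (image_mono ball_subset_closedBall)
          ((isCompact_closedBall _ _).image hFc).isClosed
      obtain ⟨x, hx, rfl⟩ := hcl hy
      rcases lt_or_eq_of_le (mem_closedBall_zero_iff.1 hx) with h | h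
      · exact mem_image_of_mem _ (mem_ball_zero_iff.2 h)
      · have h1 : F x = x := by
          simp only [F]
          rw [hfix x (mem_sphere_zero_iff_norm.2 h), sub_self, smul_zero, add_zero]
        rw [h1] at hyR
        exact absurd h (mem_ball_zero_iff.1 hyR).ne
  have hcv := integral_image_eq_integral_abs_det_fderiv_smul (μ := volume)
    (measurableSet_ball (x := (0 : E n)) (ε := R))
    (fun x _ => (hFd x).hasFDerivAt.hasFDerivWithinAt) (hinj.mono ball_subset_closedBall)
    (fun _ => (1 : ℝ))
  rw [himage] at hcv
  simp only [integral_const, smul_eq_mul, mul_one, MeasurableSet.univ, measureReal_restrict_apply,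
    univ_inter] at hcv
  rw [hcv]
  refine setIntegral_congr_fun measurableSet_ball fun x hx => ?_
  exact (abs_of_pos (det_one_add_smul_pos ht0.le (hnorm x (ball_subset_closedBall hx)))).symm

/-- Constancy of `‖f‖ ^ 2` makes the image of the derivative orthogonal to `f x`; an invertible
derivative would have `f x` itself in its image and force `f x = 0`. -/
theorem det_fderiv_eq_zero_of_norm_const (hf : ContDiff ℝ 1 f) (hR : 0 < R)
    (hnorm : ∀ x ∈ closedBall (0 : E n) R, ‖f x‖ = R) {x : E n} (hx : x ∈ ball (0 : E n) R) :
    (fderiv ℝ f x).det = 0 := by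
  by_contra hne
  have hsurj : Function.Surjective (fderiv ℝ f x) := by
    have h2 : IsUnit (fderiv ℝ f x : E n →ₗ[ℝ] E n) :=
      (LinearMap.isUnit_iff_isUnit_det _).2 (isUnit_iff_ne_zero.2 hne)
    exact ((Module.End.isUnit_iff _).1 h2).2
  obtain ⟨v, hv⟩ := hsurj (f x)
  have h1 : HasFDerivAt (fun y => ‖f y‖ ^ 2) _ x :=
    (hf.differentiable one_ne_zero x).hasFDerivAt.norm_sq
  have h2 : HasFDerivAt (fun y => ‖f y‖ ^ 2) (0 : E n →L[ℝ] ℝ) x := by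
    refine (hasFDerivAt_const (R ^ 2) x).congr_of_eventuallyEq ?_
    filter_upwards [isOpen_ball.mem_nhds hx] with y hy
    rw [hnorm y (ball_subset_closedBall hy)]
  have h3 := DFunLike.congr_fun (h1.unique h2) v
  simp [hv] at h3
  have h4 := hnorm x (ball_subset_closedBall hx)
  rw [h3, norm_zero] at h4
  exact hR.ne h4

/-- There is no `C¹` retraction of a ball onto its boundary sphere. -/
theorem no_contDiff_retraction (hf : ContDiff ℝ 1 f) (hR : 0 < R)
    (hnorm : ∀ x ∈ closedBall (0 : E n) R, ‖f x‖ = R) (hfix : ∀ x ∈ sphere (0 : E n) R, f x = x) :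
    False := by
  obtain ⟨t₀, ht₀, hint⟩ := integral_det_homotopy hf hR (fun x hx => (hnorm x hx).le) hfix
  -- For fixed `x` the Jacobian is a polynomial of degree at most `n` in `t`, so its value at `t =
  -- 1` is a fixed linear combination of its values at `n + 1` nodes. The shift by 2 keeps all nodes
  -- strictly inside `(0, t₀)`.
  let s := Finset.range (n + 1)
  let v : ℕ → ℝ := fun i => t₀ / (i + 2)
  have hv : ∀ i, v i ∈ Ioo 0 t₀ := fun i => by
    refine ⟨by positivity, div_lt_self ht₀ ?_⟩
    have : (0 : ℝ) ≤ i := Nat.cast_nonneg i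
    linarith
  have hvinj : Set.InjOn v s := by
    intro i _ j _ hij
    have h := hij
    simp only [v] at h
    rw [div_eq_div_iff (by positivity) (by positivity)] at h
    have := mul_left_cancel₀ ht₀.ne' h
    exact_mod_cast (add_right_cancel this).symm
  have hinterp : ∀ q : Polynomial ℝ, q.degree < (n + 1 : ℕ) →
      q.eval 1 = ∑ i ∈ s, q.eval (v i) * (Lagrange.basis s v i).eval 1 := by
    intro q hq
    have h := Lagrange.eq_interpolate hvinj (f := q) (by rwa [Finset.card_range])
    conv_lhs => rw [h]
    simp [Lagrange.interpolate_apply, Polynomial.eval_finsetSum]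
  have hpt : ∀ x ∈ ball (0 : E n) R, ∑ i ∈ s, (1 + v i • (fderiv ℝ f x - 1)).det *
      (Lagrange.basis s v i).eval 1 = 0 := by
    intro x hx
    obtain ⟨q, hq, hq'⟩ := exists_polynomial_det_one_add_smul (fderiv ℝ f x - 1)
    have h := hinterp q hq
    simp only [hq'] at h
    rw [← h, one_smul, add_sub_cancel]
    exact det_fderiv_eq_zero_of_norm_const hf hR hnorm hx
  have hsum := setIntegral_congr_fun (μ := volume) measurableSet_ball hpt
  have hintble : ∀ i ∈ s, Integrable (fun x => (1 + v i • (fderiv ℝ f x - 1)).det *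
      (Lagrange.basis s v i).eval 1) (volume.restrict (ball (0 : E n) R)) := by
    intro i _
    have hc : Continuous fun x => (1 + v i • (fderiv ℝ f x - 1)).det :=
      ContinuousLinearMap.continuous_det.comp (continuous_const.add
        (((hf.continuous_fderiv one_ne_zero).sub continuous_const).fun_const_smul _))
    exact ((hc.continuousOn.integrableOn_compact (isCompact_closedBall 0 R)).mono_set
      ball_subset_closedBall).mul_const _
  rw [integral_finsetSum _ hintble, integral_zero] at hsum
  have h1 : ∑ i ∈ s, volume.real (ball (0 : E n) R) * (Lagrange.basis s v i).eval 1 = 0 := by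
    rw [← hsum]
    refine Finset.sum_congr rfl fun i _ => ?_
    rw [integral_mul_const, hint (v i) (hv i)]
  -- Interpolating the constant 1 shows that the weights sum to 1. The weighted sum of integrals is
  -- then the volume of the ball, whereas its integrand, the Jacobian of `f`, vanishes.
  have h2 := hinterp 1 (by rw [Polynomial.degree_one]; exact_mod_cast Nat.succ_pos n)
  simp only [Polynomial.eval_one, one_mul] at h2
  rw [← Finset.mul_sum, ← h2, mul_one] at h1
  exact (ENNReal.toReal_pos (measure_ball_pos volume (0 : E n) hR).ne' measure_ball_lt_top.ne).ne' h1

/-! ### Zeros of maps close to the identity, and invariance of domain. -/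

/-- A map without zeros has a `C¹` approximation without zeros that is still the identity where `2 *
r ≤ ‖x‖`. Rescaling its values to norm `2 * r` would give a retraction of the ball of that radius
onto its sphere. -/
theorem exists_zero_of_eq_id_off_ball {F : E n → E n} (hF : Continuous F) {r : ℝ} (hr : 0 < r)
    (hid : ∀ x, r ≤ ‖x‖ → F x = x) : ∃ x, F x = 0 := by
  by_contra! hne
  have hS : IsClosed {x : E n | 2 * r ≤ ‖x‖} := isClosed_le continuous_const continuous_norm
  have hU : IsOpen {x : E n | r < ‖x‖} := isOpen_lt continuous_const continuous_norm
  -- An error strictly below `‖F x‖` keeps the approximation away from zero.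
  obtain ⟨g, hg, hgF, hgS, -⟩ := hF.exists_contDiff_approx_and_eqOn 1 (ε := fun x => ‖F x‖)
    hF.norm (fun x => norm_pos_iff.2 (hne x)) hS
    (hU.mem_nhdsSet.2 fun x (hx : 2 * r ≤ ‖x‖) => show r < ‖x‖ by linarith)
    (contDiffOn_id.congr fun x (hx : r < ‖x‖) => hid x hx.le)
  have hg0 : ∀ x, g x ≠ 0 := by
    intro x hx
    have h := hgF x
    rw [hx, dist_zero_left] at h
    exact lt_irrefl _ h
  have hg1 : ContDiff ℝ 1 fun x => (2 * r / ‖g x‖) • g x :=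
    (contDiff_const.div (hg.norm ℝ hg0) fun x => norm_ne_zero_iff.2 (hg0 x)).smul hg
  refine no_contDiff_retraction hg1 (mul_pos two_pos hr) (fun x _ => ?_) fun x hx => ?_
  · rw [norm_smul, Real.norm_of_nonneg (by positivity),
      div_mul_cancel₀ _ (norm_ne_zero_iff.2 (hg0 x))]
  · have hx' := mem_sphere_zero_iff_norm.1 hx
    have h1 : g x = x := by
      rw [hgS hx'.ge]
      exact hid x (by linarith)
    simp only [h1, hx']
    rw [div_self (by positivity), one_smul]

/-- The displacement is extended to the whole space through the radial projection `π` and cut off by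
`η`, which is 1 on the unit ball and 0 beyond radius `3 / 2`. As the displacement never exceeds `1 /
2`, the extended map has no zero outside the unit ball. -/
theorem exists_zero_of_near_id {F : E n → E n} (hF : ContinuousOn F (closedBall 0 1))
    (hnear : ∀ x ∈ closedBall (0 : E n) 1, ‖F x - x‖ ≤ 1 / 2) :
    ∃ x ∈ closedBall (0 : E n) 1, F x = 0 := by
  let π : E n → E n := fun x => (max 1 ‖x‖)⁻¹ • x
  let η : E n → ℝ := fun x => max 0 (min 1 (3 - 2 * ‖x‖))
  have hm : ∀ x : E n, 0 < max 1 ‖x‖ := fun x => lt_max_of_lt_left one_pos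
  have hπ : Continuous π :=
    ((continuous_const.max continuous_norm).inv₀ fun x => (hm x).ne').smul continuous_id
  have hη : Continuous η := by fun_prop
  have hπb : ∀ x, π x ∈ closedBall (0 : E n) 1 := by
    intro x
    rw [mem_closedBall_zero_iff, norm_smul, norm_inv, Real.norm_of_nonneg (hm x).le,
      inv_mul_le_iff₀ (hm x), mul_one]
    exact le_max_right _ _
  have hη01 : ∀ x, 0 ≤ η x ∧ η x ≤ 1 := fun x =>
    ⟨le_max_left _ _, max_le zero_le_one (min_le_left _ _)⟩
  have hc : Continuous fun x => x + η x • (F (π x) - π x) :=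
    continuous_id.add (hη.smul ((hF.comp_continuous hπ hπb).sub hπ))
  obtain ⟨x, hx⟩ := exists_zero_of_eq_id_off_ball hc (r := 3 / 2) (by norm_num) (by
    intro x hx
    have : η x = 0 := max_eq_left ((min_le_right _ _).trans (by linarith))
    rw [this, zero_smul, add_zero])
  rcases le_or_gt ‖x‖ 1 with h | h
  · refine ⟨x, mem_closedBall_zero_iff.2 h, ?_⟩
    have h1 : π x = x := by simp only [π]; rw [max_eq_left h, inv_one, one_smul]
    have h2 : η x = 1 := by
      simp only [η]
      rw [min_eq_left (by linarith), max_eq_right zero_le_one]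
    rwa [h1, h2, one_smul, add_sub_cancel] at hx
  · exfalso
    have h1 : ‖x‖ = ‖η x • (F (π x) - π x)‖ := by
      rw [← norm_neg x, neg_eq_of_add_eq_zero_right hx]
    rw [norm_smul, Real.norm_of_nonneg (hη01 x).1] at h1
    have h2 := hnear _ (hπb x)
    have h3 := hη01 x
    have h4 := norm_nonneg (F (π x) - π x)
    nlinarith

/-- Invariance of domain at the centre of a ball. -/
theorem map_zero_mem_interior_image {f : E n → E n} (hf : ContinuousOn f (closedBall 0 1))
    (hinj : InjOn f (closedBall 0 1)) : f 0 ∈ interior (f '' closedBall 0 1) := by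
  have hK : IsCompact (f '' closedBall 0 1) := (isCompact_closedBall _ _).image_of_continuousOn hf
  -- The inverse of `f` on its compact image, extended to the whole space by the Tietze theorem.
  obtain ⟨G, hG⟩ : ∃ G : C(E n, E n), ∀ x ∈ closedBall (0 : E n) 1, G (f x) = x := by
    have : CompactSpace (closedBall (0 : E n) 1) :=
      isCompact_iff_compactSpace.1 (isCompact_closedBall _ _)
    have he : IsClosedEmbedding (fun x : closedBall (0 : E n) 1 => f x) :=
      (continuousOn_iff_continuous_domRestrict.1 hf).isClosedEmbedding
        fun x y hxy => Subtype.ext (hinj x.2 y.2 hxy)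
    obtain ⟨G, hG⟩ := ContinuousMap.exists_extension he
      (⟨Subtype.val, continuous_subtype_val⟩ : C(closedBall (0 : E n) 1, E n))
    exact ⟨G, fun x hx => DFunLike.congr_fun hG ⟨x, hx⟩⟩
  -- If `f 0` is not interior, there is a point `c` off the image close to `f 0`. The image can be
  -- pushed away from `c`, and `G` perturbed to have no zero on the pushed image. Composing with `f`
  -- gives a map near the identity without zeros.
  by_contra hnot
  have h0 : (0 : E n) ∈ closedBall (0 : E n) 1 := mem_closedBall_self zero_le_one
  have hG0 : G (f 0) = 0 := hG 0 h0
  obtain ⟨ε, hε, hGε⟩ : ∃ ε > 0, ∀ y, dist y (f 0) < 2 * ε → ‖G y‖ < 1 / 10 := by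
    obtain ⟨ε, hε, h⟩ := Metric.continuous_iff.1 G.continuous (f 0) (1 / 10) (by norm_num)
    refine ⟨ε / 2, by positivity, fun y hy => ?_⟩
    have := h y (by linarith)
    rwa [hG0, dist_zero_right] at this
  obtain ⟨c, hcK, hc⟩ : ∃ c ∈ (f '' closedBall 0 1)ᶜ, dist (f 0) c < ε := by
    rw [← mem_compl_iff, ← closure_compl] at hnot
    exact Metric.mem_closure_iff.1 hnot ε hε
  have hfc : ∀ x ∈ closedBall (0 : E n) 1, 0 < ‖f x - c‖ := fun x hx =>
    norm_pos_iff.2 (sub_ne_zero.2 fun h => hcK ⟨x, hx, h⟩)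
  -- On the image `G` vanishes only at `f 0`, which is nearer than `ε` to `c`; compactness bounds
  -- `G` away from zero on the rest.
  obtain ⟨δ, hδ, hδ1, hGδ⟩ : ∃ δ > 0, δ ≤ 1 / 10 ∧
      ∀ y ∈ f '' closedBall 0 1 ∩ {y | ε ≤ ‖y - c‖}, δ ≤ ‖G y‖ := by
    have hcl : IsClosed {y : E n | ε ≤ ‖y - c‖} :=
      isClosed_le continuous_const (continuous_id.sub continuous_const).norm
    obtain ⟨δ, hδ, h⟩ := (hK.inter_right hcl).exists_forall_le' (a := 0)
      G.continuous.norm.continuousOn (by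
        rintro _ ⟨⟨x, hx, rfl⟩, hy⟩
        refine norm_pos_iff.2 fun hx0 => ?_
        rw [hG x hx] at hx0
        rw [hx0] at hy
        exact absurd (show ε ≤ ‖f 0 - c‖ from hy) (not_le.2 (by rwa [← dist_eq_norm])))
    exact ⟨min δ (1 / 10), lt_min hδ (by norm_num), min_le_right _ _,
      fun y hy => (min_le_left _ _).trans (h y hy)⟩
  obtain ⟨P, hP, hPG, -⟩ := G.continuous.exists_contDiff_approx 1 (ε := fun _ => δ / 2)
    continuous_const fun _ => by positivity
  -- The `C¹` map `P` sends the sphere to a null set, so subtracting a small vector outside that set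
  -- removes all zeros on the sphere and costs at most `δ / 2`.
  obtain ⟨v, hv, hvP⟩ : ∃ v ∈ ball (0 : E n) (δ / 2), v ∉ P '' sphere c ε := by
    have hnull : volume (P '' sphere c ε) = 0 :=
      addHaar_image_eq_zero_of_differentiableOn_of_addHaar_eq_zero volume
        (hP.differentiable one_ne_zero).differentiableOn
        (Measure.addHaar_sphere_of_ne_zero volume c hε.ne')
    by_contra! h
    exact (measure_ball_pos volume (0 : E n) (half_pos hδ)).ne' (measure_mono_null h hnull)
  have hQG : ∀ y, ‖P y - v - G y‖ < δ := by
    intro y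
    have h1 := hPG y
    rw [dist_eq_norm] at h1
    have h2 := mem_ball_zero_iff.1 hv
    have h3 : P y - v - G y = (P y - G y) - v := by abel
    rw [h3]
    linarith [norm_sub_le (P y - G y) v]
  -- `Φ` pushes points within `ε` of `c` radially onto the sphere about `c` and fixes the others. It
  -- is applied only to points of the image, which never equal `c`.
  let Φ : E n → E n := fun y => c + max (ε / ‖y - c‖) 1 • (y - c)
  have hΦ1 : ∀ y, 0 < ‖y - c‖ → ε ≤ ‖y - c‖ → Φ y = y := by
    intro y hy h
    simp only [Φ]
    rw [max_eq_right ((div_le_one hy).2 h), one_smul, add_sub_cancel]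
  have hΦ2 : ∀ y, 0 < ‖y - c‖ → ‖y - c‖ < ε → Φ y ∈ sphere c ε := by
    intro y hy h
    simp only [Φ]
    rw [max_eq_left ((one_le_div hy).2 h.le), mem_sphere_iff_norm, add_sub_cancel_left,
      norm_smul, Real.norm_of_nonneg (by positivity), div_mul_cancel₀ _ hy.ne']
  have hsub : ContinuousOn (fun x => f x - c) (closedBall 0 1) := hf.sub continuousOn_const
  have hH : ContinuousOn (fun x => P (Φ (f x)) - v) (closedBall 0 1) := by
    refine ContinuousOn.sub (hP.continuous.comp_continuousOn ?_) continuousOn_const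
    have hd : ContinuousOn (fun x => ε / ‖f x - c‖) (closedBall 0 1) :=
      continuousOn_const.div hsub.norm fun x hx => (hfc x hx).ne'
    exact continuousOn_const.add ((hd.sup continuousOn_const).smul hsub)
  -- Where `Φ` is the identity the error is below `δ ≤ 1 / 10`. Elsewhere `f x` and `Φ (f x)` are
  -- both within `2 * ε` of `f 0`, so the error is below `δ + 1 / 10 + 1 / 10`.
  obtain ⟨x, hx, hx0⟩ := exists_zero_of_near_id hH (by
    intro x hx
    rcases le_or_gt ε ‖f x - c‖ with h | h
    · have h1 := hQG (f x)
      rw [hG x hx] at h1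
      rw [hΦ1 _ (hfc x hx) h]
      linarith
    · have h1 := hΦ2 _ (hfc x hx) h
      have h2 := hQG (Φ (f x))
      have h3 : ‖G (Φ (f x))‖ < 1 / 10 := by
        refine hGε _ ?_
        have := dist_triangle (Φ (f x)) c (f 0)
        rw [mem_sphere.1 h1, dist_comm c] at this
        linarith
      have h4 : ‖x‖ < 1 / 10 := by
        rw [← hG x hx]
        refine hGε _ ?_
        have := dist_triangle (f x) c (f 0)
        rw [dist_eq_norm (f x) c, dist_comm c] at this
        linarith
      have h5 : P (Φ (f x)) - v - x = (P (Φ (f x)) - v - G (Φ (f x))) + (G (Φ (f x)) - x) := by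
        abel
      rw [h5]
      linarith [norm_add_le (P (Φ (f x)) - v - G (Φ (f x))) (G (Φ (f x)) - x),
        norm_sub_le (G (Φ (f x))) x])
  -- A zero is impossible in either case: away from `c` by the lower bound `δ` on `G`, and near `c`
  -- by the choice of `v`.
  rcases le_or_gt ε ‖f x - c‖ with h | h
  · have h1 := hQG (f x)
    simp only [hΦ1 _ (hfc x hx) h] at hx0
    rw [hx0, zero_sub, norm_neg] at h1
    exact (not_lt.2 (hGδ (f x) ⟨mem_image_of_mem _ hx, h⟩)) h1
  · exact hvP ⟨Φ (f x), hΦ2 _ (hfc x hx) h, sub_eq_zero.1 hx0⟩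

/-- The case of the centre applies to the ball of radius `1 - ‖x‖` about `x`, rescaled to the unit
ball. -/
theorem map_mem_interior_image {f : E n → E n} (hf : ContinuousOn f (closedBall 0 1))
    (hinj : InjOn f (closedBall 0 1)) {x : E n} (hx : x ∈ ball (0 : E n) 1) :
    f x ∈ interior (f '' closedBall 0 1) := by
  have hx' := mem_ball_zero_iff.1 hx
  have hr : 0 < 1 - ‖x‖ := by linarith
  let a : E n → E n := fun y => x + (1 - ‖x‖) • y
  have ha : Continuous a := by fun_prop
  have hmaps : MapsTo a (closedBall 0 1) (closedBall 0 1) := by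
    intro y hy
    have hy' := mem_closedBall_zero_iff.1 hy
    rw [mem_closedBall_zero_iff]
    have h1 := norm_add_le x ((1 - ‖x‖) • y)
    rw [norm_smul, Real.norm_of_nonneg hr.le] at h1
    have : (1 - ‖x‖) * ‖y‖ ≤ (1 - ‖x‖) * 1 := mul_le_mul_of_nonneg_left hy' hr.le
    simp only [a]
    linarith
  have hainj : Function.Injective a := fun y z hyz =>
    smul_right_injective (E n) hr.ne' (add_left_cancel hyz)
  have h := map_zero_mem_interior_image (hf.comp ha.continuousOn hmaps)
    (hinj.comp hainj.injOn hmaps)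
  have h0 : (f ∘ a) 0 = f x := by simp [a]
  rw [h0, image_comp] at h
  exact interior_mono (image_mono hmaps.image_subset) h

/-! ### Topological balls in Euclidean space. -/

variable {S : Set (E n)}

/-- The image of the open ball serves: invariance of domain puts it in the interior, and it inherits
connectedness and density from the open ball. -/
theorem exists_connected_dense_in_interior (h : S ≃ₜ closedBall (0 : E n) 1) :
    ∃ A : Set (E n), IsConnected A ∧ A ⊆ interior S ∧ S ⊆ closure A := by
  classical
  let f : E n → E n := fun x => if hx : x ∈ closedBall (0 : E n) 1 then h.symm ⟨x, hx⟩ else 0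
  have hfval : ∀ x : closedBall (0 : E n) 1, f x = h.symm x := fun x => dif_pos x.2
  have hf : ContinuousOn f (closedBall 0 1) := by
    rw [continuousOn_iff_continuous_domRestrict]
    exact (continuous_subtype_val.comp h.symm.continuous).congr fun x => (hfval x).symm
  have hinj : InjOn f (closedBall 0 1) := by
    intro x hx y hy hxy
    have h1 : (h.symm ⟨x, hx⟩ : E n) = h.symm ⟨y, hy⟩ := by
      rw [← hfval ⟨x, hx⟩, ← hfval ⟨y, hy⟩]
      exact hxy
    exact congrArg Subtype.val (h.symm.injective (Subtype.ext h1))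
  have himage : f '' closedBall 0 1 = S := by
    ext y
    constructor
    · rintro ⟨x, hx, rfl⟩
      rw [hfval ⟨x, hx⟩]
      exact (h.symm ⟨x, hx⟩).2
    · intro hy
      refine ⟨h ⟨y, hy⟩, (h ⟨y, hy⟩).2, ?_⟩
      rw [hfval, h.symm_apply_apply]
  refine ⟨f '' ball 0 1, ?_, ?_, ?_⟩
  · exact ((convex_ball (0 : E n) 1).isConnected ⟨0, mem_ball_self one_pos⟩).image f
      (hf.mono ball_subset_closedBall)
  · rintro _ ⟨x, hx, rfl⟩
    have := map_mem_interior_image hf hinj hx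
    rwa [himage] at this
  · have hcl : closure (ball (0 : E n) 1) = closedBall 0 1 := closure_ball 0 one_ne_zero
    rw [← hcl] at hf himage
    rw [← himage]
    exact hf.image_closure

theorem subset_closure_interior_of_homeo (h : S ≃ₜ closedBall (0 : E n) 1) :
    S ⊆ closure (interior S) := by
  obtain ⟨A, -, hAS, hSA⟩ := exists_connected_dense_in_interior h
  exact hSA.trans (closure_mono hAS)

theorem isConnected_interior_of_homeo (h : S ≃ₜ closedBall (0 : E n) 1) :
    IsConnected (interior S) := by
  obtain ⟨A, hA, hAS, hSA⟩ := exists_connected_dense_in_interior h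
  exact hA.subset_closure hAS (interior_subset.trans hSA)

end InvarianceOfDomain

/-! ## Tiles, patches and the punctured hull -/

section TileGeometry

open Metric

variable {n N : ℕ} {p : Prototiles n N}

theorem Tile.mem_carrier_iff {t : Tile n N} {y : E n} :
    y ∈ t.carrier p ↔ y - t.puncture ∈ p.shape t.label := by
  constructor
  · rintro ⟨z, hz, rfl⟩
    simpa using hz
  · intro h
    exact ⟨_, h, sub_add_cancel _ _⟩

theorem Tile.interior_carrier (t : Tile n N) :
    interior (t.carrier p) = Homeomorph.addRight t.puncture '' interior (p.shape t.label) :=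
  ((Homeomorph.addRight t.puncture).image_interior _).symm

theorem Tile.carrier_subset_closure_interior (t : Tile n N) :
    t.carrier p ⊆ closure (interior (t.carrier p)) := by
  obtain ⟨h⟩ := p.homeo_ball t.label
  rw [t.interior_carrier, ← (Homeomorph.addRight t.puncture).image_closure]
  exact image_mono (subset_closure_interior_of_homeo h)

theorem Tile.isConnected_interior (t : Tile n N) : IsConnected (interior (t.carrier p)) := by
  obtain ⟨h⟩ := p.homeo_ball t.label
  rw [t.interior_carrier]
  exact (isConnected_interior_of_homeo h).image _ (Homeomorph.continuous _).continuousOn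

theorem Tile.puncture_mem_interior (t : Tile n N) : t.puncture ∈ interior (t.carrier p) := by
  rw [t.interior_carrier]
  exact ⟨0, p.zero_mem_interior _, by simp⟩

theorem Tile.mem_carrier_shift {t : Tile n N} {x y : E n} :
    y ∈ (t.shift x).carrier p ↔ y - x ∈ t.carrier p := by
  rw [Tile.mem_carrier_iff, Tile.mem_carrier_iff]
  simp only [Tile.shift, sub_sub, add_comm]

theorem Tile.carrier_shift (t : Tile n N) (x : E n) :
    (t.shift x).carrier p = Homeomorph.addRight x '' t.carrier p := by
  ext y
  rw [Tile.mem_carrier_shift, Homeomorph.image_eq_preimage_symm, mem_preimage,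
    Homeomorph.addRight_symm, Homeomorph.coe_addRight, sub_eq_add_neg]

theorem mem_shift_iff {P : Set (Tile n N)} {x : E n} {t : Tile n N} :
    t ∈ shift x P ↔ t.shift (-x) ∈ P := by
  constructor
  · rintro ⟨s, hs, rfl⟩
    rwa [Tile.shift_shift, add_neg_cancel, Tile.shift_zero]
  · intro h
    exact ⟨_, h, by rw [Tile.shift_shift, neg_add_cancel, Tile.shift_zero]⟩

theorem shift_mono {P Q : Set (Tile n N)} (h : P ⊆ Q) (x : E n) : shift x P ⊆ shift x Q :=
  image_mono h

theorem shift_subset_iff {P Q : Set (Tile n N)} {x : E n} : shift x P ⊆ Q ↔ P ⊆ shift (-x) Q := by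
  constructor
  · intro h
    have := shift_mono h (-x)
    rwa [shift_shift, add_neg_cancel, shift_zero] at this
  · intro h
    have := shift_mono h x
    rwa [shift_shift, neg_add_cancel, shift_zero] at this

theorem IsPartialTiling.shift {X : Set (Tile n N)} (hX : IsPartialTiling p X) (x : E n) :
    IsPartialTiling p (shift x X) := by
  rintro _ ⟨s, hs, rfl⟩ _ ⟨t, ht, rfl⟩ hst
  have h := hX hs ht fun h => hst (by rw [h])
  rw [Tile.carrier_shift, Tile.carrier_shift, ← Homeomorph.image_interior,
    ← Homeomorph.image_interior]
  exact (disjoint_image_iff (Homeomorph.injective _)).2 h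

theorem IsTiling.shift {X : Set (Tile n N)} (hX : IsTiling p X) (x : E n) :
    IsTiling p (shift x X) := by
  refine ⟨hX.1.shift x, eq_univ_of_forall fun y => ?_⟩
  have h : y - x ∈ supp p X := hX.2 ▸ mem_univ _
  obtain ⟨t, ht, hy⟩ := mem_iUnion₂.1 h
  exact mem_iUnion₂.2 ⟨t.shift x, mem_image_of_mem _ ht, Tile.mem_carrier_shift.2 hy⟩

theorem IsTiling.exists_mem_carrier {X : Set (Tile n N)} (hX : IsTiling p X) (y : E n) :
    ∃ t ∈ X, y ∈ t.carrier p := by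
  have h : y ∈ supp p X := hX.2 ▸ mem_univ _
  obtain ⟨t, ht, hy⟩ := mem_iUnion₂.1 h
  exact ⟨t, ht, hy⟩

theorem meeting_subset (X : Set (Tile n N)) (U : Set (E n)) : meeting p X U ⊆ X :=
  fun _ h => h.1

theorem meeting_shift (X : Set (Tile n N)) (x c : E n) (R : ℝ) :
    meeting p (shift x X) (ball c R) = shift x (meeting p X (ball (c - x) R)) := by
  ext t
  rw [mem_shift_iff]
  constructor
  · rintro ⟨h1, y, hy, hyb⟩
    refine ⟨mem_shift_iff.1 h1, y - x, ?_, ?_⟩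
    · rw [Tile.mem_carrier_shift, sub_neg_eq_add, sub_add_cancel]
      exact hy
    · rwa [mem_ball, dist_sub_right]
  · rintro ⟨h1, y, hy, hyb⟩
    rw [Tile.mem_carrier_shift, sub_neg_eq_add] at hy
    refine ⟨mem_shift_iff.2 h1, y + x, hy, ?_⟩
    have : y + x - x ∈ ball (c - x) R := by rwa [add_sub_cancel_right]
    rwa [mem_ball, dist_sub_right] at this

/-- Each tile lies in the closure of its interior, so an open set meeting the tile also meets its
interior. Disjointness of interiors therefore already separates the interior of one tile from the
whole of another. -/
theorem IsPartialTiling.eq_of_inter {X : Set (Tile n N)} (hX : IsPartialTiling p X) {s t : Tile n N}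
    (hs : s ∈ X) (ht : t ∈ X) (h : (interior (s.carrier p) ∩ t.carrier p).Nonempty) : s = t := by
  by_contra hne
  obtain ⟨y, hys, hyt⟩ := h
  obtain ⟨z, hzs, hzt⟩ := mem_closure_iff.1 (t.carrier_subset_closure_interior hyt) _
    isOpen_interior hys
  exact disjoint_left.1 (hX hs ht hne) hzs hzt

/-! ### Uniform radii, separation of punctures and local finiteness. -/

variable (p) in
theorem exists_inner_radius : ∃ ρ > 0, ∀ i, ball (0 : E n) ρ ⊆ interior (p.shape i) := by
  have h : ∀ i, ∃ ρ > 0, ball (0 : E n) ρ ⊆ interior (p.shape i) := fun i =>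
    Metric.isOpen_iff.1 isOpen_interior _ (p.zero_mem_interior i)
  choose r hr hrb using h
  obtain ⟨ρ, hρ, h⟩ : ∃ ρ > 0, ∀ i, ρ ≤ r i := by
    rcases isEmpty_or_nonempty (Fin N) with h | h
    · exact ⟨1, one_pos, fun i => (IsEmpty.false i).elim⟩
    · obtain ⟨i, hi⟩ := Finite.exists_min r
      exact ⟨r i, hr i, hi⟩
  exact ⟨ρ, hρ, fun i => (ball_subset_ball (h i)).trans (hrb i)⟩

variable (p) in
theorem exists_outer_radius : ∃ D > 0, ∀ t : Tile n N, t.carrier p ⊆ closedBall t.puncture D := by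
  have h : ∀ i, ∃ D, p.shape i ⊆ closedBall 0 D := fun i => by
    obtain ⟨h⟩ := p.homeo_ball i
    have : CompactSpace (closedBall (0 : E n) 1) :=
      isCompact_iff_compactSpace.1 (isCompact_closedBall _ _)
    exact (isCompact_iff_compactSpace.2 h.symm.compactSpace).isBounded.subset_closedBall 0
  choose r hr using h
  refine ⟨1 + ∑ i, |r i|, by positivity, fun t y hy => ?_⟩
  have h1 := hr _ (Tile.mem_carrier_iff.1 hy)
  have h2 : |r t.label| ≤ ∑ i, |r i| :=
    Finset.single_le_sum (fun i _ => abs_nonneg (r i)) (Finset.mem_univ _)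
  rw [mem_closedBall_zero_iff] at h1
  rw [mem_closedBall_iff_norm]
  linarith [le_abs_self (r t.label)]

variable (p) in
-- With `ρ` an inner radius common to all prototiles, a puncture closer than `ρ` to that of `s` lies
-- in the interior of `s`. The constant depends on the prototiles alone.
theorem exists_separation : ∃ ρ > 0, ∀ X : Set (Tile n N), IsPartialTiling p X →
    ∀ s ∈ X, ∀ t ∈ X, dist s.puncture t.puncture < ρ → s = t := by
  obtain ⟨ρ, hρ, h⟩ := exists_inner_radius p
  refine ⟨ρ, hρ, fun X hX s hs t ht hst => hX.eq_of_inter hs ht ⟨t.puncture, ?_, ?_⟩⟩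
  · rw [s.interior_carrier]
    refine ⟨t.puncture - s.puncture, h _ ?_, by simp⟩
    rwa [mem_ball_zero_iff, ← dist_eq_norm, dist_comm]
  · exact interior_subset t.puncture_mem_interior

theorem IsPartialTiling.eq_of_puncture {X : Set (Tile n N)} (hX : IsPartialTiling p X)
    {s t : Tile n N} (hs : s ∈ X) (ht : t ∈ X) (h : s.puncture = t.puncture) : s = t :=
  hX.eq_of_inter hs ht ⟨s.puncture, s.puncture_mem_interior,
    h ▸ interior_subset t.puncture_mem_interior⟩

/-- The relevant punctures lie in a compact ball, which is covered by finitely many balls of radius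
`ρ / 2`, each holding at most one puncture. -/
theorem IsPartialTiling.finite_meeting {X : Set (Tile n N)} (hX : IsPartialTiling p X) (x : E n)
    (R : ℝ) : (meeting p X (ball x R)).Finite := by
  obtain ⟨ρ, hρ, hsep⟩ := exists_separation p
  obtain ⟨D, -, hD⟩ := exists_outer_radius p
  obtain ⟨C, -, hC, hcov⟩ := (isCompact_closedBall x (R + D)).finite_cover_balls (half_pos hρ)
  have hmem : ∀ t ∈ meeting p X (ball x R), ∃ c ∈ C, t.puncture ∈ ball c (ρ / 2) := by
    rintro t ⟨-, y, hy, hyx⟩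
    have h1 := mem_closedBall.1 (hD t hy)
    have h2 : t.puncture ∈ closedBall x (R + D) := by
      rw [mem_closedBall]
      linarith [dist_triangle_left t.puncture x y, mem_ball.1 hyx]
    obtain ⟨c, hc, h⟩ := mem_iUnion₂.1 (hcov h2)
    exact ⟨c, hc, h⟩
  choose! c hcC hc using hmem
  refine Set.Finite.of_injOn (f := c) hcC ?_ hC
  intro s hs t ht hst
  refine hsep X hX s hs.1 t ht.1 ?_
  have h1 := mem_ball.1 (hc s hs)
  have h2 := mem_ball.1 (hc t ht)
  rw [hst] at h1
  linarith [dist_triangle_right s.puncture t.puncture (c t)]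

/-! ### Patches cut out by balls. -/

theorem ball_subset_supp_meeting {X : Set (Tile n N)} (hX : IsTiling p X) (x : E n) (R : ℝ) :
    ball x R ⊆ supp p (meeting p X (ball x R)) := by
  intro y hy
  obtain ⟨t, ht, hyt⟩ := hX.exists_mem_carrier y
  exact mem_iUnion₂.2 ⟨t, ⟨ht, y, hyt, hy⟩, hyt⟩

/-- The ball together with the interiors of the tiles meeting it is connected, since each of these
interiors is connected and meets the ball. The interior of the support lies between this set and its
closure. -/
theorem isConnected_interior_supp_meeting {X : Set (Tile n N)} (hX : IsTiling p X) (x : E n) {R : ℝ}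
    (hR : 0 < R) : IsConnected (interior (supp p (meeting p X (ball x R)))) := by
  let A := ball x R ∪ ⋃ t ∈ meeting p X (ball x R), interior (t.carrier p)
  have hx : x ∈ A := Or.inl (mem_ball_self hR)
  have hball : IsPreconnected (ball x R) := (convex_ball x R).isPreconnected
  have hA : IsConnected A := by
    refine ⟨⟨x, hx⟩, isPreconnected_of_forall x fun y hy => ?_⟩
    rcases hy with hy | hy
    · exact ⟨ball x R, subset_union_left, mem_ball_self hR, hy, hball⟩
    · obtain ⟨t, ht, hyt⟩ := mem_iUnion₂.1 hy
      refine ⟨ball x R ∪ interior (t.carrier p), ?_, Or.inl (mem_ball_self hR), Or.inr hyt, ?_⟩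
      · exact union_subset_union_right _
          (subset_biUnion_of_mem (u := fun t : Tile n N => interior (t.carrier p)) ht)
      · obtain ⟨z, hzt, hzb⟩ := ht.2
        obtain ⟨w, hwb, hwt⟩ := mem_closure_iff.1 (t.carrier_subset_closure_interior hzt) _
          isOpen_ball hzb
        exact hball.union w hwb hwt t.isConnected_interior.isPreconnected
  refine hA.subset_closure ?_ ?_
  · refine union_subset (interior_maximal (ball_subset_supp_meeting hX x R) isOpen_ball) ?_
    exact iUnion₂_subset fun t ht =>
      interior_mono (subset_biUnion_of_mem (u := fun t : Tile n N => t.carrier p) ht)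
  · refine interior_subset.trans (iUnion₂_subset fun t ht => ?_)
    refine t.carrier_subset_closure_interior.trans (closure_mono ?_)
    exact (subset_biUnion_of_mem (u := fun t : Tile n N => interior (t.carrier p)) ht).trans
      subset_union_right

/-- A partial tiling containing the patch `X(B)` of a tiling `X` has no further tiles meeting the
ball `B`. -/
theorem meeting_eq_of_subset {X Y : Set (Tile n N)} (hX : IsTiling p X) (hY : IsPartialTiling p Y)
    {x : E n} {R : ℝ} (h : meeting p X (ball x R) ⊆ Y) :
    meeting p Y (ball x R) = meeting p X (ball x R) := by
  refine Subset.antisymm ?_ fun t ht => ⟨h ht, ht.2⟩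
  rintro t ⟨htY, z, hzt, hzb⟩
  -- Some interior point of `t` lies in the ball, where it is covered by a tile of `X(B)`. That tile
  -- belongs to `Y` as well, so it is `t`.
  obtain ⟨y, hyb, hyt⟩ := mem_closure_iff.1 (t.carrier_subset_closure_interior hzt) _ isOpen_ball hzb
  obtain ⟨q, hqX, hyq⟩ := hX.exists_mem_carrier y
  have hq : q ∈ meeting p X (ball x R) := ⟨hqX, y, hyq, hyb⟩
  rw [hY.eq_of_inter htY (h hq) ⟨y, hyt, hyq⟩]
  exact hq

variable (p) in
theorem exists_radius_of_finite {P : Set (Tile n N)} (hP : P.Finite) :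
    ∃ R > 0, ∀ t ∈ P, t.carrier p ⊆ ball 0 R := by
  obtain ⟨D, hD, hDt⟩ := exists_outer_radius p
  obtain ⟨r, hr⟩ := (hP.image Tile.puncture).isBounded.subset_closedBall 0
  refine ⟨|r| + D + 1, by positivity, fun t ht y hy => ?_⟩
  have h1 := mem_closedBall.1 (hr (mem_image_of_mem _ ht))
  have h2 := mem_closedBall.1 (hDt t hy)
  rw [mem_ball]
  linarith [dist_triangle y t.puncture 0, le_abs_self r]

theorem subset_meeting {P X : Set (Tile n N)} {U : Set (E n)} (h : P ⊆ X)
    (hU : ∀ t ∈ P, t.carrier p ⊆ U) : P ⊆ meeting p X U := fun t ht =>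
  ⟨h ht, t.puncture, interior_subset t.puncture_mem_interior,
    hU t ht (interior_subset t.puncture_mem_interior)⟩

/-! ### The tiling metric -/

theorem tilingDist_le {X Y : Set (Tile n N)} {ε : ℝ} (hε : 0 < ε)
    (h : meeting p X (ball 0 (1 / ε)) = meeting p Y (ball 0 (1 / ε))) : tilingDist p X Y ≤ ε := by
  refine csInf_le ⟨0, ?_⟩ (Or.inr ⟨0, 0, ?_, ?_, ?_⟩)
  · rintro δ (rfl | ⟨x, -, hx, -⟩)
    · exact zero_le_one
    · exact (norm_nonneg x).trans hx.le
  · rwa [norm_zero]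
  · rwa [norm_zero]
  · rwa [neg_zero, shift_zero, shift_zero]

theorem exists_of_tilingDist_lt {X Y : Set (Tile n N)} {ε : ℝ} (hε : ε ≤ 1)
    (h : tilingDist p X Y < ε) : ∃ δ > 0, δ < ε ∧ ∃ x y : E n, ‖x‖ < δ ∧ ‖y‖ < δ ∧
      meeting p (shift (-x) X) (ball 0 (1 / δ)) = meeting p (shift (-y) Y) (ball 0 (1 / δ)) := by
  obtain ⟨δ, hδ, hδε⟩ := exists_lt_of_csInf_lt (singleton_nonempty (1 : ℝ)).inl h
  -- The default member 1 is excluded by `ε ≤ 1`. Any other member exceeds a norm and is positive,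
  -- although the definition does not demand it.
  rcases hδ with rfl | ⟨x, y, hx, hy, h⟩
  · exact absurd hδε (not_lt.2 hε)
  · exact ⟨δ, (norm_nonneg x).trans_lt hx, hδε, x, y, hx, hy, h⟩

/-- A tile meeting `B(0, R)` still meets the ball of agreement after the translation by `-x`, since
this moves points by less than `δ`. Undoing the translation on the other side gives the net vector
`y - x`. -/
theorem shift_meeting_subset_of_agree {X Y : Set (Tile n N)} {x y : E n} {R δ : ℝ}
    (hx : ‖x‖ < δ) (hR : R + δ ≤ 1 / δ)
    (h : meeting p (shift (-x) X) (ball 0 (1 / δ)) = meeting p (shift (-y) Y) (ball 0 (1 / δ))) :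
    shift (y - x) (meeting p X (ball 0 R)) ⊆ Y := by
  rintro _ ⟨t, ⟨htX, z, hzt, hzR⟩, rfl⟩
  have h1 : t.shift (-x) ∈ meeting p (shift (-x) X) (ball 0 (1 / δ)) := by
    refine ⟨mem_image_of_mem _ htX, z - x, ?_, ?_⟩
    · rwa [Tile.mem_carrier_shift, sub_neg_eq_add, sub_add_cancel]
    · rw [mem_ball_zero_iff] at *
      linarith [norm_sub_le z x]
  rw [h] at h1
  have h2 := mem_shift_iff.1 h1.1
  rwa [Tile.shift_shift, neg_neg, neg_add_eq_sub] at h2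

variable {T : Tiling p}

theorem mem_hull_of_forall {X : Tiling p}
    (h : ∀ R > 0, ∃ x, meeting p X.tiles (ball 0 R) = meeting p (shift x T.tiles) (ball 0 R)) :
    X ∈ hull T := by
  intro ε hε
  obtain ⟨x, hx⟩ := h (1 / (ε / 2)) (by positivity)
  exact ⟨x, (tilingDist_le (half_pos hε) hx).trans_lt (half_lt_self hε)⟩

/-- Finite subsets of tilings in the hull appear in the given tiling. -/
theorem exists_shift_subset_of_mem_hull {X : Tiling p} (hX : X ∈ hull T) {P : Set (Tile n N)}
    (hP : P.Finite) (hPX : P ⊆ X.tiles) : ∃ x, shift x P ⊆ T.tiles := by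
  obtain ⟨R, hR, hRt⟩ := exists_radius_of_finite p hP
  obtain ⟨z, hz⟩ := hX (1 / (R + 1)) (by positivity)
  obtain ⟨δ, hδ, hδε, x, y, hx, -, h⟩ := exists_of_tilingDist_lt
    ((div_le_one (by positivity)).2 (by linarith)) hz
  have hδ1 : R + δ ≤ 1 / δ := by
    have h1 : R + 1 < 1 / δ := by
      rw [lt_div_iff₀ (by positivity)] at hδε ⊢
      linarith
    have h2 : δ < 1 := hδε.trans_le ((div_le_one (by positivity)).2 (by linarith))
    linarith
  have h2 := shift_meeting_subset_of_agree hx hδ1 h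
  refine ⟨y - x - z, ?_⟩
  have h3 := shift_mono ((shift_mono (subset_meeting hPX hRt) _).trans h2) (-z)
  rwa [shift_shift, shift_shift, add_neg_cancel, shift_zero, ← sub_eq_add_neg] at h3

/-! ### The punctured hull -/

/-- The tiles of an element of the punctured hull. -/
abbrev PuncturedHull.tiles (X : PuncturedHull T) : Set (Tile n N) := X.tiling.tiles

theorem PuncturedHull.isPartial (X : PuncturedHull T) : IsPartialTiling p X.tiles :=
  X.tiling.isTiling.1

theorem PuncturedHull.ext_tiles {X Y : PuncturedHull T} (h : X.tiles = Y.tiles) : X = Y := by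
  apply PuncturedHull.ext
  rcases X with ⟨⟨X, hX⟩, _, _⟩
  rcases Y with ⟨⟨Y, hY⟩, _, _⟩
  cases h
  rfl

/-- The tile of a punctured tiling with puncture at the origin. -/
noncomputable def PuncturedHull.origin (X : PuncturedHull T) : Tile n N := X.exists_puncture.choose

theorem PuncturedHull.origin_mem (X : PuncturedHull T) : X.origin ∈ X.tiles :=
  X.exists_puncture.choose_spec.1

theorem PuncturedHull.puncture_origin (X : PuncturedHull T) : X.origin.puncture = 0 :=
  X.exists_puncture.choose_spec.2

theorem PuncturedHull.origin_mem_meeting (X : PuncturedHull T) {R : ℝ} (hR : 0 < R) :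
    X.origin ∈ meeting p X.tiles (ball 0 R) := by
  refine ⟨X.origin_mem, 0, ?_, mem_ball_self hR⟩
  have h := interior_subset (X.origin.puncture_mem_interior (p := p))
  rwa [X.puncture_origin] at h

/-- Between punctured tilings the small translations allowed by the metric cancel: the origin tile
of `X`, moved by `y - x`, is a tile of `Y` too close to the origin tile of `Y` to differ from it, so
`x = y`. Metric closeness thus means literal agreement on a large ball. -/
theorem exists_radius_tilingDist (R : ℝ) : ∃ ε > 0, ∀ X Y : PuncturedHull T,
    tilingDist p X.tiles Y.tiles < ε → meeting p X.tiles (ball 0 R) ⊆ Y.tiles := by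
  obtain ⟨ρ, hρ, hsep⟩ := exists_separation p
  -- The first bound gives `|R| + 1 + δ ≤ 1 / δ`, the second `‖y - x‖ < ρ`. The radius `|R| + 1` is
  -- positive for every real `R`, so its ball contains the origin.
  refine ⟨min (1 / (|R| + 2)) (ρ / 2), by positivity, fun X Y hXY => ?_⟩
  have hle : 1 / (|R| + 2) ≤ 1 := (div_le_one (by positivity)).2 (by linarith [abs_nonneg R])
  obtain ⟨δ, hδ, hδε, x, y, hx, hy, h⟩ := exists_of_tilingDist_lt ((min_le_left _ _).trans hle) hXY
  have hδ1 : |R| + 1 + δ ≤ 1 / δ := by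
    have h0 := hδε.trans_le (min_le_left _ _)
    have h1 : |R| + 2 < 1 / δ := by
      rw [lt_div_iff₀ (by positivity)] at h0 ⊢
      linarith
    linarith
  have hsub := shift_meeting_subset_of_agree hx hδ1 h
  have hO := hsub (mem_image_of_mem _ (X.origin_mem_meeting (by positivity : 0 < |R| + 1)))
  have hxy : X.origin.shift (y - x) = Y.origin := by
    refine hsep Y.tiles Y.isPartial _ hO _ Y.origin_mem ?_
    rw [Y.puncture_origin]
    simp only [Tile.shift, X.puncture_origin, zero_add, dist_zero_right]
    linarith [norm_sub_le y x, min_le_right (1 / (|R| + 2)) (ρ / 2)]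
  have h0 : y - x = 0 := by
    have := congrArg Tile.puncture hxy
    rw [Y.puncture_origin] at this
    simpa [Tile.shift, X.puncture_origin] using this
  rw [h0, shift_zero] at hsub
  rintro t ⟨ht, z, hz, hzR⟩
  exact hsub ⟨ht, z, hz, ball_subset_ball (by linarith [le_abs_self R]) hzR⟩

/-- The sets of the tilings which contain the patch `X(B(0, R))` form a neighbourhood basis of `X`
in the punctured hull. -/
theorem PuncturedHull.isOpen_iff {U : Set (PuncturedHull T)} : IsOpen U ↔
    ∀ X ∈ U, ∃ R > 0, ∀ Y : PuncturedHull T, meeting p X.tiles (ball 0 R) ⊆ Y.tiles → Y ∈ U := by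
  constructor
  · intro hU X hX
    obtain ⟨ε, hε, h⟩ := hU X hX
    refine ⟨1 / (ε / 2), by positivity, fun Y hY => h Y ?_⟩
    exact (tilingDist_le (half_pos hε)
      (meeting_eq_of_subset X.tiling.isTiling Y.isPartial hY).symm).trans_lt (half_lt_self hε)
  · intro h X hX
    obtain ⟨R, -, hR⟩ := h X hX
    obtain ⟨ε, hε, h'⟩ := exists_radius_tilingDist (T := T) R
    exact ⟨ε, hε, fun Y hY => hR Y (h' X Y hY)⟩

theorem PuncturedHull.isOpen_contains {P : Set (Tile n N)} (hP : P.Finite) :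
    IsOpen {X : PuncturedHull T | P ⊆ X.tiles} := by
  rw [PuncturedHull.isOpen_iff]
  intro X hX
  obtain ⟨R, hR, hRt⟩ := exists_radius_of_finite p hP
  exact ⟨R, hR, fun Y hY => (subset_meeting hX hRt).trans hY⟩

/-- A tiling agreeing with `X` on a ball around the tiles of `P` contains `P` only if `X` does.
Together with openness this makes the cylinder sets clopen. -/
theorem PuncturedHull.isClosed_contains {P : Set (Tile n N)} (hP : P.Finite) :
    IsClosed {X : PuncturedHull T | P ⊆ X.tiles} := by
  rw [← isOpen_compl_iff, PuncturedHull.isOpen_iff]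
  intro X hX
  obtain ⟨R, hR, hRt⟩ := exists_radius_of_finite p hP
  refine ⟨R, hR, fun Y hY hPY => hX ?_⟩
  have h := meeting_eq_of_subset X.tiling.isTiling Y.isPartial hY
  exact ((subset_meeting hPY hRt).trans h.subset).trans (meeting_subset _ _)

end TileGeometry

/-! ## Ultra-filters of idempotents -/

section Ultra

variable {S : Type*} [InvSemigroup S]

theorem Idem.mul_zero_eq (e : Idem S) : e * 0 = 0 := Idem.ext (mul_zero e.1)

theorem Idem.le_trans' {e f g : Idem S} (h : e ≤ f) (h' : f ≤ g) : e ≤ g := by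
  rw [Idem.le_iff] at *
  conv_rhs => rw [h, Idem.mul_assoc', ← h', ← h]

/-- If no such product vanished, the elements above the products `f * e` with `f ∈ ξ` would form a
filter containing both `ξ` and `e`, against maximality. -/
theorem IsUltra.exists_mul_eq_zero {ξ : Set (Idem S)} (hξ : IsUltra ξ) {e : Idem S} (he : e ∉ ξ) :
    ∃ f ∈ ξ, f * e = 0 := by
  by_contra! hne
  have hη : IsFilter {g : Idem S | ∃ f ∈ ξ, f * e ≤ g} := by
    refine ⟨?_, ?_, ?_, ?_⟩
    · obtain ⟨f, hf⟩ := hξ.1.nonempty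
      exact ⟨e, f, hf, Idem.mul_le_right f e⟩
    · rintro ⟨f, hf, h⟩
      rw [Idem.le_iff, Idem.mul_zero_eq] at h
      exact hne f hf h
    · rintro x y ⟨f, hf, h⟩ hxy
      exact ⟨f, hf, Idem.le_trans' h hxy⟩
    · rintro x y ⟨f, hf, hx⟩ ⟨g, hg, hy⟩
      refine ⟨f * g * e, ⟨f * g, hξ.1.mul_mem hf hg, (f * g * e).mul_self.symm⟩, ?_, ?_⟩
      · refine Idem.le_trans' ?_ hx
        rw [Idem.mul_comm' f g, Idem.mul_assoc']
        exact Idem.mul_le_right _ _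
      · refine Idem.le_trans' ?_ hy
        rw [Idem.mul_assoc']
        exact Idem.mul_le_right _ _
  have h := hξ.2 _ hη fun f hf => ⟨f, hf, Idem.mul_le_left f e⟩
  obtain ⟨f, hf⟩ := hξ.1.nonempty
  exact he (h ▸ ⟨f, hf, Idem.mul_le_right f e⟩)

theorem IsUltra.exists_forall_mul_eq_zero {ξ : Set (Idem S)} (hξ : IsUltra ξ) {F : Set (Idem S)}
    (hF : F.Finite) (h : ∀ e ∈ F, e ∉ ξ) : ∃ f ∈ ξ, ∀ e ∈ F, f * e = 0 := by
  induction F, hF using Set.Finite.induction_on with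
  | empty => exact ⟨_, hξ.1.nonempty.some_mem, fun e he => absurd he (notMem_empty e)⟩
  | @insert a F _ _ ih =>
    obtain ⟨f, hf, hfF⟩ := ih fun e he => h e (mem_insert_of_mem _ he)
    obtain ⟨g, hg, hga⟩ := hξ.exists_mul_eq_zero (h a (mem_insert _ _))
    refine ⟨f * g, hξ.1.mul_mem hf hg, ?_⟩
    rintro e (rfl | he)
    · rw [Idem.mul_assoc', hga, Idem.mul_zero_eq]
    · rw [Idem.mul_comm' f g, Idem.mul_assoc', hfF e he, Idem.mul_zero_eq]

/-- If every ultra-filter meets a finite set of idempotents, so does every tight filter. -/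
theorem exists_mem_of_mem_tightSpectrum {F : Set (Idem S)} (hF : F.Finite)
    (h : ∀ ξ : Set (Idem S), IsUltra ξ → ∃ e ∈ F, e ∈ ξ) {φ : Character S}
    (hφ : φ ∈ tightSpectrum S) : ∃ e ∈ F, φ.toFun e = true := by
  have hcl : IsClosed (⋃ e ∈ F, {φ : Character S | φ.toFun e = true}) :=
    hF.isClosed_biUnion fun e _ => (isClosed_discrete {true}).preimage (continuous_eval e)
  have hsub : tightSpectrum S ⊆ ⋃ e ∈ F, {φ : Character S | φ.toFun e = true} := by
    refine closure_minimal (fun ψ hψ => ?_) hcl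
    obtain ⟨e, heF, he⟩ := h _ hψ
    exact mem_iUnion₂.2 ⟨e, heF, he⟩
  obtain ⟨e, heF, he⟩ := mem_iUnion₂.1 (hsub hφ)
  exact ⟨e, heF, he⟩

end Ultra

/-! ## Pointed patches -/

section Characters

open Metric

variable {n N : ℕ} {p : Prototiles n N} {T : Tiling p}

theorem supp_shift (P : Set (Tile n N)) (x : E n) :
    supp p (shift x P) = Homeomorph.addRight x '' supp p P := by
  simp only [supp, image_iUnion₂, shift, biUnion_image, Tile.carrier_shift]

/-- The translate of a triple, without any condition on its position. -/
def PointedPatch.move (a : PointedPatch T) (x : E n) : PointedPatch T where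
  t₁ := a.t₁.shift x
  P := shift x a.P
  t₂ := a.t₂.shift x
  isPatch := ⟨a.isPatch.1.image _, a.isPatch.2.shift x⟩
  appears := by
    obtain ⟨y, hy⟩ := a.appears
    exact ⟨-x + y, by rwa [shift_shift, add_neg_cancel_left]⟩
  connected := by
    rw [supp_shift, ← Homeomorph.image_interior]
    exact a.connected.image _ (Homeomorph.continuous _).continuousOn
  mem₁ := mem_image_of_mem _ a.mem₁
  mem₂ := mem_image_of_mem _ a.mem₂

theorem PointedPatch.cls_move (a : PointedPatch T) (x : E n) : cls (a.move x) = cls a :=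
  (cls_eq_iff.2 ⟨x, rfl, rfl, rfl⟩).symm

/-- The triple translated such that the puncture of its second tile is the origin. -/
def PointedPatch.centre (a : PointedPatch T) : PointedPatch T := a.move (-a.t₂.puncture)

theorem PointedPatch.cls_centre (a : PointedPatch T) : cls a.centre = cls a := a.cls_move _

theorem PointedPatch.puncture_centre (a : PointedPatch T) : a.centre.t₂.puncture = 0 :=
  add_neg_cancel _

theorem exists_centred {s : PatternSemigroup T} (hs : s ≠ 0) :
    ∃ a : PointedPatch T, s = cls a ∧ a.t₂.puncture = 0 := by
  obtain ⟨a, rfl⟩ := (eq_zero_or_cls s).resolve_left hs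
  exact ⟨a.centre, a.cls_centre.symm, a.puncture_centre⟩

/-- The translation relating two representatives is visible on the puncture of `t₂`. Hence a class
has only one centred representative, and classes can be handled as actual patches around the origin.
-/
theorem eq_of_cls_eq {a b : PointedPatch T} (h : cls a = cls b)
    (h' : a.t₂.puncture = b.t₂.puncture) : a = b := by
  obtain ⟨x, h1, h2, h3⟩ := cls_eq_iff.1 h
  have hx : x = 0 := by
    rw [← h2] at h'
    simpa [Tile.shift] using h'
  subst hx
  rw [Tile.shift_zero] at h1 h2
  rw [shift_zero] at h3
  rcases a with ⟨⟩
  rcases b with ⟨⟩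
  cases h1
  cases h2
  cases h3
  rfl

/-- The triple `(t₁, P ∪ P', t₂')` for `t₂ = t₁'`, if `P ∪ P'` appears in `T`. -/
def PointedPatch.join (a b : PointedPatch T) (h : a.t₂ = b.t₁)
    (hab : ∃ x, shift x (a.P ∪ b.P) ⊆ T.tiles) : PointedPatch T where
  t₁ := a.t₁
  P := a.P ∪ b.P
  t₂ := b.t₂
  isPatch := by
    obtain ⟨x, hx⟩ := hab
    exact ⟨a.isPatch.1.union b.isPatch.1,
      Set.Pairwise.mono (shift_subset_iff.1 hx) (T.isTiling.1.shift (-x))⟩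
  appears := hab
  connected := connected_union a.isPatch.1 a.connected b.connected a.mem₂ (h ▸ b.mem₁)
  mem₁ := Or.inl a.mem₁
  mem₂ := Or.inr b.mem₂

/-- A common translation brings both triples into `T`, so the product can be computed wherever the
union sits, in particular inside any tiling of the hull. -/
theorem cls_mul_cls {a b : PointedPatch T} (h : a.t₂ = b.t₁)
    (hab : ∃ x, shift x (a.P ∪ b.P) ⊆ T.tiles) : cls a * cls b = cls (a.join b h hab) := by
  obtain ⟨x, hx⟩ := id hab
  rw [shift_union] at hx
  have hg : IsGlue (cls a) (cls b) (cls (glue (a.move x) (b.move x)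
      (subset_union_left.trans hx) (subset_union_right.trans hx) (congrArg (Tile.shift x) h))) :=
    ⟨a.move x, b.move x, subset_union_left.trans hx, subset_union_right.trans hx,
      congrArg (Tile.shift x) h, (a.cls_move x).symm, (b.cls_move x).symm, rfl⟩
  rw [hg.mul_eq]
  exact (cls_eq_iff.2 ⟨x, rfl, rfl, shift_union _ _ _⟩).symm

theorem cls_mul_self {a : PointedPatch T} (h : a.t₁ = a.t₂) : cls a * cls a = cls a := by
  have hap : ∃ x, shift x (a.P ∪ a.P) ⊆ T.tiles := by
    rw [union_self]
    exact a.appears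
  rw [cls_mul_cls h.symm hap]
  exact cls_eq_iff.2 ⟨0, Tile.shift_zero _, Tile.shift_zero _,
    (shift_zero _).trans (union_self _)⟩

theorem t₁_eq_t₂_of_mul_self {a : PointedPatch T} (h : cls a * cls a = cls a) : a.t₁ = a.t₂ := by
  rcases idem_form h with h0 | ⟨d, hd, h1⟩
  · exact absurd h0 (cls_ne_zero a)
  · obtain ⟨x, hx1, hx2, -⟩ := cls_eq_iff.1 h1.symm
    rw [← hx1, ← hx2, hd]

theorem Idem.t₁_eq_t₂ {e : Idem (PatternSemigroup T)} {a : PointedPatch T} (h : e.val = cls a) :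
    a.t₁ = a.t₂ :=
  t₁_eq_t₂_of_mul_self (h ▸ e.idem)

/-- The idempotent `[t, P, t]`. -/
def PointedPatch.idem (a : PointedPatch T) (h : a.t₁ = a.t₂) : Idem (PatternSemigroup T) :=
  ⟨cls a, cls_mul_self h⟩

theorem Idem.val_ne_zero {e : Idem (PatternSemigroup T)} (h : e ≠ 0) : e.val ≠ 0 :=
  fun h0 => h (Idem.ext h0)

/-- An idempotent has equal marked tiles, so one translation centres both factors and their product,
and multiplication becomes union of centred patches. -/
theorem exists_centred_of_mul_ne_zero {e f : Idem (PatternSemigroup T)} (h : e * f ≠ 0) :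
    ∃ a b c : PointedPatch T, e.val = cls a ∧ f.val = cls b ∧ (e * f).val = cls c ∧
      a.t₂.puncture = 0 ∧ b.t₂.puncture = 0 ∧ c.t₂.puncture = 0 ∧ c.P = a.P ∪ b.P := by
  obtain ⟨a, b, ha, hb, hab, h1, h2, h3⟩ := isGlue_of_mul_ne_zero (Idem.val_ne_zero h)
  have hb' := f.t₁_eq_t₂ h2
  refine ⟨a.centre, b.centre, (glue a b ha hb hab).centre, h1.trans a.cls_centre.symm,
    h2.trans b.cls_centre.symm, h3.trans (glue a b ha hb hab).cls_centre.symm,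
    a.puncture_centre, b.puncture_centre, PointedPatch.puncture_centre _, ?_⟩
  change shift (-b.t₂.puncture) (a.P ∪ b.P) =
    shift (-a.t₂.puncture) a.P ∪ shift (-b.t₂.puncture) b.P
  rw [shift_union, hab, hb']

theorem mem_hull_self (T : Tiling p) : T ∈ hull T :=
  mem_hull_of_forall fun _ _ => ⟨0, by rw [shift_zero]⟩

/-- The triple consisting of the patch `X(B(c, R))` of a tiling `X` in the hull and two of its
tiles. -/
def ballPatch {X : Tiling p} (hX : X ∈ hull T) {c : E n} {R : ℝ} (hR : 0 < R) {s t : Tile n N}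
    (hs : s ∈ meeting p X.tiles (ball c R)) (ht : t ∈ meeting p X.tiles (ball c R)) :
    PointedPatch T where
  t₁ := s
  P := meeting p X.tiles (ball c R)
  t₂ := t
  isPatch := ⟨X.isTiling.1.finite_meeting c R, X.isTiling.1.mono (meeting_subset _ _)⟩
  appears := exists_shift_subset_of_mem_hull hX (X.isTiling.1.finite_meeting c R)
    (meeting_subset _ _)
  connected := isConnected_interior_supp_meeting X.isTiling c hR
  mem₁ := hs
  mem₂ := ht

/-! ### Characters of punctured tilings. -/

/-- The class `s` has its centred representative inside `X`. -/
def Occurs (X : Set (Tile n N)) (s : PatternSemigroup T) : Prop :=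
  ∃ a : PointedPatch T, s = cls a ∧ a.t₂.puncture = 0 ∧ a.P ⊆ X

theorem occurs_cls_iff {X : Set (Tile n N)} {a : PointedPatch T} (ha : a.t₂.puncture = 0) :
    Occurs X (cls a) ↔ a.P ⊆ X := by
  constructor
  · rintro ⟨b, hab, hb, hbX⟩
    rwa [eq_of_cls_eq hab (ha.trans hb.symm)]
  · exact fun h => ⟨a, rfl, ha, h⟩

theorem not_occurs_zero (X : Set (Tile n N)) : ¬ Occurs X (0 : PatternSemigroup T) := by
  rintro ⟨a, h, -⟩
  exact cls_ne_zero a h.symm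

/-- Centred patches inside `X` share the tile of `X` at the origin and so can be joined; their union
appears in `T` because `X` is in the hull. -/
theorem occurs_mul_iff (X : PuncturedHull T) (e f : Idem (PatternSemigroup T)) :
    Occurs X.tiles (e * f).val ↔ Occurs X.tiles e.val ∧ Occurs X.tiles f.val := by
  constructor
  · intro h
    have hne : e * f ≠ 0 := fun h0 => not_occurs_zero (T := T) X.tiles (by rwa [h0] at h)
    obtain ⟨a, b, c, h1, h2, h3, ha, hb, hc, hP⟩ := exists_centred_of_mul_ne_zero hne
    rw [h3, occurs_cls_iff hc, hP, union_subset_iff] at h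
    rwa [h1, h2, occurs_cls_iff ha, occurs_cls_iff hb]
  · rintro ⟨⟨a, h1, ha, haX⟩, ⟨b, h2, hb, hbX⟩⟩
    have hab : a.t₂ = b.t₁ := by
      rw [f.t₁_eq_t₂ h2]
      exact X.isPartial.eq_of_puncture (haX a.mem₂) (hbX b.mem₂) (ha.trans hb.symm)
    have hap := exists_shift_subset_of_mem_hull X.mem_hull (a.isPatch.1.union b.isPatch.1)
      (union_subset haX hbX)
    change Occurs X.tiles (e.val * f.val)
    rw [h1, h2, cls_mul_cls hab hap]
    exact ⟨_, rfl, hb, union_subset haX hbX⟩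

/-- The triple of the patch `X(B(0, R))` and the tile at the origin. -/
noncomputable def PuncturedHull.ballPatch (X : PuncturedHull T) {R : ℝ} (hR : 0 < R) :
    PointedPatch T :=
  TilingTight.ballPatch X.mem_hull hR (X.origin_mem_meeting hR) (X.origin_mem_meeting hR)

open scoped Classical in
/-- The character of a punctured tiling: it is `1` on `[t, P, t]` if `P`, translated such that the
puncture of `t` is the origin, is contained in the tiling. -/
noncomputable def PuncturedHull.char (X : PuncturedHull T) : Character (PatternSemigroup T) where
  toFun e := decide (Occurs X.tiles e.val)
  ne_zero := ⟨(X.ballPatch one_pos).idem rfl,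
    decide_eq_true ⟨_, rfl, X.puncture_origin, meeting_subset _ _⟩⟩
  map_zero := decide_eq_false (not_occurs_zero _)
  map_mul e f := by
    rw [← Bool.decide_and]
    exact decide_eq_decide.2 (occurs_mul_iff X e f)

open scoped Classical in
theorem PuncturedHull.char_iff {X : PuncturedHull T} {e : Idem (PatternSemigroup T)} :
    X.char.toFun e = true ↔ Occurs X.tiles e.val :=
  decide_eq_true_iff

theorem PuncturedHull.char_ballPatch (X : PuncturedHull T) {R : ℝ} (hR : 0 < R) :
    X.char.toFun ((X.ballPatch hR).idem rfl) = true :=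
  PuncturedHull.char_iff.2 ⟨_, rfl, X.puncture_origin, meeting_subset _ _⟩

/-- In a larger filter every `e` has a non-zero product with the idempotent of each patch `X(B(0,
R))`. For `R` large enough that the ball covers the patch of `e`, both lie in a common patch, which
has no tiles in the ball other than those of `X`. -/
theorem PuncturedHull.isUltra_char (X : PuncturedHull T) : IsUltra X.char.toFilter := by
  refine ⟨X.char.isFilter, fun η hη hsub => hsub.antisymm fun e he => ?_⟩
  have he0 : e ≠ 0 := fun h => hη.zero_notMem (h ▸ he)
  obtain ⟨b, hb, hb0⟩ := exists_centred (Idem.val_ne_zero he0)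
  obtain ⟨R, hR, hRt⟩ := exists_radius_of_finite p b.isPatch.1
  have hmul := hη.mul_mem he (hsub (X.char_ballPatch hR))
  have hne : e * (X.ballPatch hR).idem rfl ≠ 0 := fun h => hη.zero_notMem (h ▸ hmul)
  obtain ⟨b', d, c, h1, h2, -, hb', hd, -, hP⟩ := exists_centred_of_mul_ne_zero hne
  have hbb : b' = b := eq_of_cls_eq (h1.symm.trans hb) (hb'.trans hb0.symm)
  have hdX : d = X.ballPatch hR := eq_of_cls_eq h2.symm (hd.trans X.puncture_origin.symm)
  have hc : meeting p X.tiles (ball 0 R) ⊆ c.P := by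
    rw [hP, hdX]
    exact subset_union_right
  have hbc : b.P ⊆ c.P := by
    rw [hP, hbb]
    exact subset_union_left
  have := meeting_eq_of_subset X.tiling.isTiling c.isPatch.2 hc
  exact PuncturedHull.char_iff.2 ⟨b, hb, hb0,
    ((subset_meeting hbc hRt).trans this.subset).trans (meeting_subset _ _)⟩

theorem PuncturedHull.char_injective :
    Function.Injective (PuncturedHull.char : PuncturedHull T → Character (PatternSemigroup T)) := by
  have key : ∀ X Y : PuncturedHull T, X.char = Y.char → X.tiles ⊆ Y.tiles := by
    intro X Y h t ht
    obtain ⟨R, hR, hRt⟩ := exists_radius_of_finite p (finite_singleton t)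
    have h1 := X.char_ballPatch hR
    rw [h, PuncturedHull.char_iff] at h1
    exact (occurs_cls_iff X.puncture_origin).1 h1
      (subset_meeting (singleton_subset_iff.2 ht) hRt rfl)
  exact fun X Y h => PuncturedHull.ext_tiles ((key X Y h).antisymm (key Y X h.symm))

/-! ### Tight characters come from punctured tilings -/

theorem Tile.mem_meeting_puncture {X : Set (Tile n N)} {t : Tile n N} (ht : t ∈ X) {R : ℝ}
    (hR : 0 < R) : t ∈ meeting p X (ball t.puncture R) :=
  ⟨ht, t.puncture, interior_subset t.puncture_mem_interior, mem_ball_self hR⟩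

/-- The idempotent `[t, T(B(x(t), R)), t]`. -/
def tileIdem {R : ℝ} (hR : 0 < R) (t : T.tiles) : Idem (PatternSemigroup T) :=
  (ballPatch (mem_hull_self T) hR (Tile.mem_meeting_puncture t.2 hR)
    (Tile.mem_meeting_puncture t.2 hR)).idem rfl

/-- Finite local complexity leaves finitely many models for the patches. A class is determined by
the model and the position of `t` in it, and a finite model offers finitely many positions. -/
theorem finite_range_tileIdem (hflc : FiniteLocalComplexity T) {R : ℝ} (hR : 0 < R) :
    (range (tileIdem (T := T) hR)).Finite := by
  classical
  obtain ⟨F, hF, h⟩ := hflc R hR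
  choose P hPF y hy using fun t : T.tiles => h t.1.puncture
  have hfin : ∀ t, (P t).Finite := by
    intro t
    have h1 := T.isTiling.1.finite_meeting t.1.puncture R
    rw [hy t] at h1
    exact h1.of_finite_image fun a _ b _ hab => by
      have := congrArg (Tile.shift (-y t)) hab
      simpa [Tile.shift_shift, Tile.shift_zero] using this
  let κ : T.tiles → Set (Tile n N) × Tile n N := fun t => (P t, t.1.shift (-y t))
  have hκ : (range κ).Finite := by
    -- The family `F` may have infinite members; these are never used as models and are discarded.
    refine ((hF.subset (inter_subset_left (t := {Q | Q.Finite}))).biUnion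
      (t := fun Q => (fun s => (Q, s)) '' Q) fun Q hQ => hQ.2.image _).subset ?_
    rintro _ ⟨t, rfl⟩
    refine mem_iUnion₂.2 ⟨P t, ⟨hPF t, hfin t⟩, t.1.shift (-y t), ?_, rfl⟩
    rw [← mem_shift_iff, ← hy t]
    exact Tile.mem_meeting_puncture t.2 hR
  have hfac : ∀ s t, κ s = κ t → tileIdem hR s = tileIdem hR t := by
    intro s t hst
    obtain ⟨h1, h2⟩ := Prod.mk.inj hst
    refine Idem.ext (cls_eq_iff.2 ⟨-y s + y t, ?_, ?_, ?_⟩)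
    · change s.1.shift _ = t.1
      rw [← Tile.shift_shift, h2, Tile.shift_shift, neg_add_cancel, Tile.shift_zero]
    · change s.1.shift _ = t.1
      rw [← Tile.shift_shift, h2, Tile.shift_shift, neg_add_cancel, Tile.shift_zero]
    · change shift _ (meeting p T.tiles (ball s.1.puncture R)) =
        meeting p T.tiles (ball t.1.puncture R)
      rw [hy s, hy t, shift_shift, add_neg_cancel_left, h1]
  -- The class is a function of `κ t`; the value 0 outside the range of `κ` plays no role.
  refine (hκ.image fun k => if h : ∃ t, κ t = k then tileIdem hR h.choose else 0).subset ?_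
  rintro _ ⟨t, rfl⟩
  have hex : ∃ s, κ s = κ t := ⟨t, rfl⟩
  exact ⟨κ t, mem_range_self t, (dif_pos hex).trans (hfac _ _ hex.choose_spec)⟩

/-- Otherwise some member of `ξ` annihilates all these idempotents. But it has a representative in
`T`, and its product with the idempotent of its own marked tile is non-zero, since both patches lie
in `T`. -/
theorem exists_tileIdem_mem_of_isUltra (hflc : FiniteLocalComplexity T) {R : ℝ} (hR : 0 < R)
    {ξ : Set (Idem (PatternSemigroup T))} (hξ : IsUltra ξ) :
    ∃ e ∈ range (tileIdem (T := T) hR), e ∈ ξ := by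
  by_contra! hne
  obtain ⟨f, hf, hfF⟩ := hξ.exists_forall_mul_eq_zero (finite_range_tileIdem hflc hR) hne
  have hf0 : f ≠ 0 := fun h => hξ.1.zero_notMem (h ▸ hf)
  obtain ⟨a, ha, h⟩ := (eq_zero_or_cls_sub f.val).resolve_left (Idem.val_ne_zero hf0)
  have h1 := congrArg Idem.val (hfF _ ⟨⟨a.t₂, ha a.mem₂⟩, rfl⟩)
  change f.val * cls _ = 0 at h1
  rw [h, cls_mul_cls rfl ⟨0, ?_⟩] at h1
  · exact cls_ne_zero _ h1
  · rw [shift_zero]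
    exact union_subset ha (meeting_subset _ _)

/-- The tiles of the centred patches on which a character is `1`. -/
def Character.tiles (φ : Character (PatternSemigroup T)) : Set (Tile n N) :=
  {t | ∃ e, φ.toFun e = true ∧ ∃ a : PointedPatch T, e.val = cls a ∧ a.t₂.puncture = 0 ∧ t ∈ a.P}

theorem Character.ne_zero_of_eq_true {φ : Character (PatternSemigroup T)}
    {e : Idem (PatternSemigroup T)} (h : φ.toFun e = true) : e ≠ 0 := by
  rintro rfl
  rw [φ.map_zero] at h
  exact Bool.false_ne_true h

/-- The idempotents with value 1 are closed under products, and the centred patch of a product is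
the union of the centred patches. -/
theorem Character.exists_patch_of_finite (φ : Character (PatternSemigroup T))
    {P : Set (Tile n N)} (hP : P.Finite) (h : P ⊆ φ.tiles) :
    ∃ e, φ.toFun e = true ∧ ∃ a : PointedPatch T, e.val = cls a ∧ a.t₂.puncture = 0 ∧ P ⊆ a.P := by
  induction P, hP using Set.Finite.induction_on with
  | empty =>
    obtain ⟨e, he⟩ := φ.ne_zero
    obtain ⟨a, ha, ha0⟩ := exists_centred (Idem.val_ne_zero (Character.ne_zero_of_eq_true he))
    exact ⟨e, he, a, ha, ha0, empty_subset _⟩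
  | @insert t P _ _ ih =>
    obtain ⟨e, he, a, ha, ha0, haP⟩ := ih ((subset_insert _ _).trans h)
    obtain ⟨f, hf, b, hb, hb0, htb⟩ := h (mem_insert t P)
    have hef : φ.toFun (e * f) = true := by rw [φ.map_mul, he, hf]; rfl
    obtain ⟨a', b', c, h1, h2, h3, ha', hb', hc, hcP⟩ :=
      exists_centred_of_mul_ne_zero (Character.ne_zero_of_eq_true hef)
    have haa : a' = a := eq_of_cls_eq (h1.symm.trans ha) (ha'.trans ha0.symm)
    have hbb : b' = b := eq_of_cls_eq (h2.symm.trans hb) (hb'.trans hb0.symm)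
    refine ⟨e * f, hef, c, h3, hc, ?_⟩
    rw [hcP, haa, hbb, insert_subset_iff]
    exact ⟨Or.inr htb, haP.trans subset_union_left⟩

theorem Character.isPartialTiling_tiles (φ : Character (PatternSemigroup T)) :
    IsPartialTiling p φ.tiles := by
  intro s hs t ht hst
  obtain ⟨e, -, a, -, -, h⟩ := φ.exists_patch_of_finite (toFinite {s, t})
    (insert_subset_iff.2 ⟨hs, singleton_subset_iff.2 ht⟩)
  exact a.isPatch.2 (h (mem_insert _ _)) (h (mem_insert_of_mem _ rfl)) hst

/-- Tightness enters here: the property of containing a ball idempotent of radius `R` passes from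
ultra-filters to their limits. It makes `φ.tiles` cover the space and places it in the hull. -/
theorem exists_meeting_shift_subset_tiles (hflc : FiniteLocalComplexity T)
    {φ : Character (PatternSemigroup T)} (hφ : φ ∈ tightSpectrum (PatternSemigroup T)) {R : ℝ}
    (hR : 0 < R) : ∃ x, meeting p (shift x T.tiles) (ball 0 R) ⊆ φ.tiles := by
  obtain ⟨_, ⟨t, rfl⟩, ht⟩ := exists_mem_of_mem_tightSpectrum (finite_range_tileIdem hflc hR)
    (fun ξ hξ => exists_tileIdem_mem_of_isUltra hflc hR hξ) hφ
  refine ⟨-t.1.puncture, fun s hs => ⟨_, ht, _, (PointedPatch.cls_centre _).symm,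
    PointedPatch.puncture_centre _, ?_⟩⟩
  rw [meeting_shift, sub_neg_eq_add, zero_add] at hs
  exact hs

/-- The tiling of a tight character. -/
def Character.tiling (hflc : FiniteLocalComplexity T) {φ : Character (PatternSemigroup T)}
    (hφ : φ ∈ tightSpectrum (PatternSemigroup T)) : Tiling p where
  tiles := φ.tiles
  isTiling := by
    refine ⟨φ.isPartialTiling_tiles, eq_univ_of_forall fun y => ?_⟩
    obtain ⟨x, hx⟩ := exists_meeting_shift_subset_tiles hflc hφ (R := ‖y‖ + 1) (by positivity)
    refine supp_mono hx (ball_subset_supp_meeting (T.isTiling.shift x) 0 _ ?_)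
    rw [mem_ball_zero_iff]
    exact lt_add_one _

/-- The punctured tiling of a tight character. -/
def Character.puncturedTiling (hflc : FiniteLocalComplexity T)
    {φ : Character (PatternSemigroup T)} (hφ : φ ∈ tightSpectrum (PatternSemigroup T)) :
    PuncturedHull T where
  tiling := Character.tiling hflc hφ
  mem_hull := by
    refine mem_hull_of_forall fun R hR => ?_
    obtain ⟨x, hx⟩ := exists_meeting_shift_subset_tiles hflc hφ hR
    exact ⟨x, meeting_eq_of_subset (T.isTiling.shift x) φ.isPartialTiling_tiles hx⟩
  exists_puncture := by
    obtain ⟨e, he⟩ := φ.ne_zero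
    obtain ⟨a, ha, ha0⟩ := exists_centred (Idem.val_ne_zero (Character.ne_zero_of_eq_true he))
    exact ⟨a.t₂, ⟨e, he, a, ha, ha0, a.mem₂⟩, ha0⟩

/-- A centred patch contained in `φ.tiles` lies inside a single patch on which `φ` is 1. The
idempotent of the larger patch is the smaller one in the order, and filters are closed upwards. -/
theorem Character.char_puncturedTiling (hflc : FiniteLocalComplexity T)
    {φ : Character (PatternSemigroup T)} (hφ : φ ∈ tightSpectrum (PatternSemigroup T)) :
    (Character.puncturedTiling hflc hφ).char = φ := by
  apply Character.ext
  funext e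
  rw [Bool.eq_iff_iff, PuncturedHull.char_iff]
  constructor
  · rintro ⟨a, ha, ha0, haX⟩
    obtain ⟨f, hf, b, hb, hb0, hab⟩ := φ.exists_patch_of_finite a.isPatch.1 haX
    refine φ.isFilter.up f e hf (Idem.ext ?_)
    have hba : b.t₂ = a.t₁ := by
      rw [e.t₁_eq_t₂ ha]
      exact b.isPatch.2.eq_of_puncture b.mem₂ (hab a.mem₂) (hb0.trans ha0.symm)
    have hu : b.P ∪ a.P = b.P := union_eq_left.2 hab
    have hap : ∃ x, shift x (b.P ∪ a.P) ⊆ T.tiles := hu.symm ▸ b.appears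
    change f.val = f.val * e.val
    rw [ha, hb, cls_mul_cls hba hap]
    refine cls_eq_iff.2 ⟨0, Tile.shift_zero _, ?_, (shift_zero _).trans hu.symm⟩
    rw [Tile.shift_zero, hba]
    exact e.t₁_eq_t₂ ha
  · intro he
    obtain ⟨a, ha, ha0⟩ := exists_centred (Idem.val_ne_zero (Character.ne_zero_of_eq_true he))
    exact ⟨a, ha, ha0, fun t ht => ⟨e, he, a, ha, ha0, ht⟩⟩

theorem PuncturedHull.continuous_char :
    Continuous (PuncturedHull.char : PuncturedHull T → Character (PatternSemigroup T)) := by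
  refine continuous_induced_rng.2 (continuous_pi fun e => ?_)
  have hset : IsClopen {X : PuncturedHull T | Occurs X.tiles e.val} := by
    by_cases he : e = 0
    · subst he
      convert! isClopen_empty
      exact eq_empty_of_forall_notMem fun X => not_occurs_zero _
    · obtain ⟨a, ha, ha0⟩ := exists_centred (Idem.val_ne_zero he)
      simp only [ha, occurs_cls_iff ha0]
      exact ⟨PuncturedHull.isClosed_contains a.isPatch.1, PuncturedHull.isOpen_contains a.isPatch.1⟩
  refine (IsLocallyConstant.iff_continuous _).1 ((IsLocallyConstant.iff_exists_open _).2 fun X => ?_)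
  by_cases hX : Occurs X.tiles e.val
  · exact ⟨_, hset.isOpen, hX, fun Y hY =>
      (PuncturedHull.char_iff.2 hY).trans (PuncturedHull.char_iff.2 hX).symm⟩
  · refine ⟨_, hset.compl.isOpen, hX, fun Y hY => Bool.eq_iff_iff.2 ?_⟩
    exact PuncturedHull.char_iff.trans
      ((iff_of_false hY hX).trans PuncturedHull.char_iff.symm)

/-- The punctured hull is homeomorphic to the tight spectrum. -/
noncomputable def puncturedHullHomeo (hflc : FiniteLocalComplexity T) :
    PuncturedHull T ≃ₜ tightSpectrum (PatternSemigroup T) where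
  toFun X := ⟨X.char, subset_closure X.isUltra_char⟩
  invFun φ := Character.puncturedTiling hflc φ.2
  left_inv X := PuncturedHull.char_injective (Character.char_puncturedTiling hflc _)
  right_inv φ := Subtype.ext (Character.char_puncturedTiling hflc φ.2)
  continuous_toFun := PuncturedHull.continuous_char.subtype_mk _
  continuous_invFun := by
    refine continuous_def.2 fun U hU => isOpen_iff_forall_mem_open.2 fun φ hφ => ?_
    obtain ⟨R, hR, h⟩ := PuncturedHull.isOpen_iff.1 hU _ hφ
    let X := Character.puncturedTiling hflc φ.2
    let e := (X.ballPatch hR).idem rfl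
    -- The characters that are 1 on the ball patch of radius `R` are exactly those of the tilings
    -- containing it.
    refine ⟨{ψ | ψ.1.toFun e = true}, fun ψ hψ => h _ ?_, ?_, ?_⟩
    · change ψ.1.toFun e = true at hψ
      rw [← Character.char_puncturedTiling hflc ψ.2, PuncturedHull.char_iff] at hψ
      exact (occurs_cls_iff X.puncture_origin).1 hψ
    · exact (isOpen_discrete {true}).preimage ((continuous_eval e).comp continuous_subtype_val)
    · have := X.char_ballPatch hR
      rwa [Character.char_puncturedTiling hflc φ.2] at this

end Characters

/-! ## Source and range in the tight groupoid -/

section SourceRange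

open GroupoidOps

variable {S : Type*} [InvSemigroup S]

/-- The source `φ` of a germ `[s, φ]`. -/
def germSource : TightGroupoid S → tightSpectrum S :=
  Quotient.lift (fun a : GermPair S => a.1.2) fun _ _ h => h.1

/-- The range `θ_s φ` of a germ `[s, φ]`. -/
def germRange (g : TightGroupoid S) : tightSpectrum S := germSource (inv g)

theorem exists_eq_germ (g : TightGroupoid S) :
    ∃ s φ, ∃ h : φ.1.toFun (dom s) = true, g = germ s φ h := by
  obtain ⟨⟨⟨s, φ⟩, h⟩, rfl⟩ := Quotient.exists_rep g
  exact ⟨s, φ, h, rfl⟩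

theorem germRange_inv (g : TightGroupoid S) : germRange (inv g) = germSource g := by
  obtain ⟨s, φ, h, rfl⟩ := exists_eq_germ g
  apply Subtype.ext
  apply Character.ext
  funext e
  change φ.1.toFun (conj s (conj (star s) e)) = φ.1.toFun e
  have : conj (star s * s) e = dom s * e * dom s := Idem.ext (by
    change star (star s * s) * e.1 * (star s * s) = star s * s * e.1 * (star s * s)
    simp)
  rw [conj_conj, this, φ.1.map_mul, φ.1.map_mul, h]
  simp

theorem conj_dom (s t : S) : conj t (dom s) = dom (s * t) := by
  apply Idem.ext
  change star t * (star s * s) * t = star (s * t) * (s * t)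
  rw [star_mul]
  simp only [mul_assoc]

theorem tightAct_mul (s t : S) (φ : tightSpectrum S) (ht : φ.1.toFun (dom t) = true)
    (hs : (tightAct t φ ht).1.toFun (dom s) = true) (hst : φ.1.toFun (dom (s * t)) = true) :
    tightAct (s * t) φ hst = tightAct s (tightAct t φ ht) hs := by
  apply Subtype.ext
  apply Character.ext
  funext e
  change φ.1.toFun (conj (s * t) e) = φ.1.toFun (conj t (conj s e))
  rw [conj_conj]

variable (S) in
/-- The tight groupoid is principal: a germ is determined by its source and range. -/
def TightPrincipal : Prop :=
  ∀ g g' : TightGroupoid S, germSource g = germSource g' → germRange g = germRange g' → g = g'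

/-- With germs determined by their endpoints, the product is composition of pairs and its definition
through representatives can be forgotten. -/
theorem TightPrincipal.isProd_iff (hS : TightPrincipal S) {a b c : TightGroupoid S} :
    IsProd a b c ↔
      germSource a = germRange b ∧ germRange c = germRange a ∧ germSource c = germSource b := by
  constructor
  · rintro ⟨s, t, φ, ht, hs, hst, rfl, rfl, rfl⟩
    exact ⟨rfl, tightAct_mul s t φ ht hs hst, rfl⟩
  · rintro ⟨h1, h2, h3⟩
    obtain ⟨s, ψ, hs, rfl⟩ := exists_eq_germ a
    obtain ⟨t, φ, ht, rfl⟩ := exists_eq_germ b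
    obtain rfl : ψ = tightAct t φ ht := h1
    have hst : φ.1.toFun (dom (s * t)) = true := by
      rw [← conj_dom]
      exact hs
    refine ⟨s, t, φ, ht, hs, hst, rfl, rfl, hS _ _ h3 ?_⟩
    rw [h2]
    exact (tightAct_mul s t φ ht hs hst).symm

end SourceRange

/-! ## The isomorphism of groupoids -/

section GroupoidIso

open Metric GroupoidOps

variable {n N : ℕ} {p : Prototiles n N} {T : Tiling p}

/-! ### The action on characters of punctured tilings, and principality. -/

/-- Converse to `exists_shift_subset_of_mem_hull`. Membership in the hull depends only on finite
patches up to translation, so translates stay in the hull. -/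
theorem mem_hull_of_finite {X : Tiling p}
    (h : ∀ P : Set (Tile n N), P.Finite → P ⊆ X.tiles → ∃ x, shift x P ⊆ T.tiles) : X ∈ hull T := by
  refine mem_hull_of_forall fun R _ => ?_
  obtain ⟨x, hx⟩ := h _ (X.isTiling.1.finite_meeting 0 R) (meeting_subset _ _)
  exact ⟨-x, (meeting_eq_of_subset X.isTiling (T.isTiling.1.shift (-x))
    (shift_subset_iff.1 hx)).symm⟩

/-- The translate of a punctured tiling which moves the puncture of a given tile to the origin. -/
def PuncturedHull.recentre (X : PuncturedHull T) {t : Tile n N} (ht : t ∈ X.tiles) :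
    PuncturedHull T where
  tiling := ⟨shift (-t.puncture) X.tiles, X.tiling.isTiling.shift _⟩
  mem_hull := by
    refine mem_hull_of_finite fun P hP hPX => ?_
    have h1 : shift t.puncture P ⊆ X.tiles := by
      rwa [shift_subset_iff]
    obtain ⟨x, hx⟩ := exists_shift_subset_of_mem_hull X.mem_hull (hP.image _) h1
    exact ⟨t.puncture + x, by rwa [← shift_shift]⟩
  exists_puncture := ⟨_, mem_image_of_mem _ ht, add_neg_cancel _⟩

theorem dom_cls (a : PointedPatch T) :
    ∃ b : PointedPatch T, (dom (cls a)).val = cls b ∧ b.t₂ = a.t₂ ∧ b.P = a.P := by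
  have hap : ∃ x, shift x (a.flip.P ∪ a.P) ⊆ T.tiles := by
    have h : a.flip.P ∪ a.P = a.P := union_self _
    rw [h]
    exact a.appears
  exact ⟨a.flip.join a rfl hap, cls_mul_cls (a := a.flip) rfl hap, rfl, union_self _⟩

theorem PuncturedHull.char_dom_iff {X : PuncturedHull T} {a : PointedPatch T}
    (ha : a.t₂.puncture = 0) : X.char.toFun (dom (cls a)) = true ↔ a.P ⊆ X.tiles := by
  obtain ⟨b, hb, h2, hP⟩ := dom_cls a
  rw [PuncturedHull.char_iff, hb, occurs_cls_iff (by rw [h2, ha]), hP]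

/-- Conjugation by `[t₁, P, t₂]` glues the patch of `e`, based at `t₁`, to `P` and reads off the
result at `t₂`. One inclusion of filters suffices, since the filter of the recentred tiling is
maximal. -/
theorem PuncturedHull.charAct_char {X : PuncturedHull T} {a : PointedPatch T}
    (ha : a.t₂.puncture = 0) (haX : a.P ⊆ X.tiles) (h : X.char.toFun (dom (cls a)) = true) :
    charAct (cls a) X.char h = (X.recentre (haX a.mem₁)).char := by
  have hsub : (X.recentre (haX a.mem₁)).char.toFilter ⊆ (charAct (cls a) X.char h).toFilter := by
    intro e he
    obtain ⟨b, hb, hb0, hbX⟩ := PuncturedHull.char_iff.1 he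
    let b' := b.move a.t₁.puncture
    have hb'X : b'.P ⊆ X.tiles := shift_subset_iff.2 hbX
    have hb' : e.val = cls b' := hb.trans (b.cls_move _).symm
    have h2 : b'.t₂ = a.t₁ := X.isPartial.eq_of_puncture (hb'X b'.mem₂) (haX a.mem₁) (by
      change b.t₂.puncture + a.t₁.puncture = _
      rw [hb0, zero_add])
    have h1 : b'.t₁ = a.t₁ := (e.t₁_eq_t₂ hb').trans h2
    have hap : ∀ P : Set (Tile n N), P.Finite → P ⊆ X.tiles → ∃ x, shift x P ⊆ T.tiles :=
      fun P => exists_shift_subset_of_mem_hull X.mem_hull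
    have hap1 := hap (a.flip.P ∪ b'.P) (a.isPatch.1.union b'.isPatch.1) (union_subset haX hb'X)
    have hap2 := hap ((a.flip.join b' h1.symm hap1).P ∪ a.P)
      ((a.isPatch.1.union b'.isPatch.1).union a.isPatch.1)
      (union_subset (union_subset haX hb'X) haX)
    have hval : (conj (cls a) e).val = cls ((a.flip.join b' h1.symm hap1).join a h2 hap2) := by
      have m1 := cls_mul_cls (a := a.flip) (b := b') h1.symm hap1
      have m2 := cls_mul_cls (a := a.flip.join b' h1.symm hap1) (b := a) h2 hap2
      rw [← m2, ← m1, ← hb']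
      rfl
    refine PuncturedHull.char_iff.2 ⟨_, hval, ha, ?_⟩
    exact union_subset (union_subset haX hb'X) haX
  have heq := (PuncturedHull.isUltra_char _).2 _ (Character.isFilter _) hsub
  apply Character.ext
  funext e
  rw [Bool.eq_iff_iff]
  exact (Set.ext_iff.1 heq e).symm

theorem cls_ne_zero_of_dom {φ : Character (PatternSemigroup T)} {s : PatternSemigroup T}
    (h : φ.toFun (dom s) = true) : s ≠ 0 := by
  rintro rfl
  have h0 : dom (0 : PatternSemigroup T) = 0 := Idem.ext (mul_zero _)
  rw [h0, φ.map_zero] at h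
  exact Bool.false_ne_true h

theorem StronglyAperiodic.eq_of_shift_eq (haper : StronglyAperiodic T) {X : PuncturedHull T}
    {x y : E n} (h : shift x X.tiles = shift y X.tiles) : x = y := by
  by_contra hne
  refine haper X.tiling X.mem_hull (x - y) (sub_ne_zero.2 hne) ?_
  have := congrArg (shift (-y)) h
  rwa [shift_shift, shift_shift, add_neg_cancel, shift_zero, ← sub_eq_add_neg] at this

/-- For germs of `a` and `b` at `X` with equal ranges, aperiodicity gives equal punctures of `a.t₁`
and `b.t₁`, hence equal tiles of `X`. Both triples then have the same product with the idempotent of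
the union of their patches. -/
theorem tightPrincipal (hflc : FiniteLocalComplexity T) (haper : StronglyAperiodic T) :
    TightPrincipal (PatternSemigroup T) := by
  intro g g' hs hr
  obtain ⟨s, φ, h, rfl⟩ := exists_eq_germ g
  obtain ⟨t, ψ, h', rfl⟩ := exists_eq_germ g'
  obtain rfl : φ = ψ := hs
  obtain ⟨X, rfl⟩ := (puncturedHullHomeo hflc).surjective φ
  obtain ⟨a, rfl, ha⟩ := exists_centred (cls_ne_zero_of_dom h)
  obtain ⟨b, rfl, hb⟩ := exists_centred (cls_ne_zero_of_dom h')
  have haX := (PuncturedHull.char_dom_iff ha).1 h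
  have hbX := (PuncturedHull.char_dom_iff hb).1 h'
  have hr' := congrArg Subtype.val hr
  replace hr' := (PuncturedHull.charAct_char ha haX h).symm.trans
    (hr'.trans (PuncturedHull.charAct_char hb hbX h'))
  have htiles : shift (-a.t₁.puncture) X.tiles = shift (-b.t₁.puncture) X.tiles :=
    congrArg PuncturedHull.tiles (PuncturedHull.char_injective hr')
  have h1 : a.t₁ = b.t₁ := X.isPartial.eq_of_puncture (haX a.mem₁) (hbX b.mem₁)
    (neg_injective (haper.eq_of_shift_eq htiles))
  have h2 : a.t₂ = b.t₂ := X.isPartial.eq_of_puncture (haX a.mem₂) (hbX b.mem₂) (ha.trans hb.symm)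
  have habX : a.P ∪ b.P ⊆ X.tiles := union_subset haX hbX
  have hap := exists_shift_subset_of_mem_hull X.mem_hull (a.isPatch.1.union b.isPatch.1) habX
  let c := a.flip.join b h1 hap
  have hap1 : ∃ x, shift x (a.P ∪ c.P) ⊆ T.tiles :=
    exists_shift_subset_of_mem_hull X.mem_hull (a.isPatch.1.union c.isPatch.1)
      (union_subset haX habX)
  have hap2 : ∃ x, shift x (b.P ∪ c.P) ⊆ T.tiles :=
    exists_shift_subset_of_mem_hull X.mem_hull (b.isPatch.1.union c.isPatch.1)
      (union_subset hbX habX)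
  refine Quotient.sound ⟨rfl, c.idem h2, ?_, ?_⟩
  · exact PuncturedHull.char_iff.2 ⟨c, rfl, hb, habX⟩
  · change cls a * cls c = cls b * cls c
    rw [cls_mul_cls (b := c) rfl hap1, cls_mul_cls (b := c) h2.symm hap2]
    refine cls_eq_iff.2 ⟨0, (Tile.shift_zero _).trans h1, Tile.shift_zero _,
      (shift_zero _).trans ?_⟩
    change a.P ∪ (a.P ∪ b.P) = b.P ∪ (a.P ∪ b.P)
    rw [← union_assoc, union_self, union_left_comm, union_self]

/-! ### The groupoid of translational equivalence -/

theorem RPunc.ext' {r r' : RPunc T} (h1 : r.fst = r'.fst) (h2 : r.snd = r'.snd) : r = r' := by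
  rcases r with ⟨_, _, _⟩
  rcases r' with ⟨_, _, _⟩
  cases h1
  cases h2
  rfl

theorem RPunc.snd_eq (r : RPunc T) : r.snd.tiles = shift r.vec r.fst.tiles := r.exists_vec.choose_spec

theorem RPunc.fst_eq (r : RPunc T) : r.fst.tiles = shift (-r.vec) r.snd.tiles := by
  rw [r.snd_eq, shift_shift, add_neg_cancel, shift_zero]

theorem RPunc.vec_eq (haper : StronglyAperiodic T) {r : RPunc T} {x : E n}
    (h : r.snd.tiles = shift x r.fst.tiles) : r.vec = x :=
  haper.eq_of_shift_eq (r.snd_eq.symm.trans h)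

theorem RPunc.vec_inv (haper : StronglyAperiodic T) (r : RPunc T) : (inv r).vec = -r.vec :=
  RPunc.vec_eq haper r.fst_eq

theorem RPunc.vec_mul (haper : StronglyAperiodic T) {a b c : RPunc T} (h : IsProd a b c) :
    c.vec = a.vec + b.vec := by
  obtain ⟨h1, h2, h3⟩ := h
  refine RPunc.vec_eq haper ?_
  rw [h3, h2, b.snd_eq, ← h1, a.snd_eq, shift_shift]

theorem RPunc.continuous_fst_vec : Continuous fun r : RPunc T => (r.fst, r.vec) :=
  continuous_induced_dom

theorem RPunc.continuous_fst : Continuous (RPunc.fst : RPunc T → PuncturedHull T) :=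
  _root_.continuous_fst.comp RPunc.continuous_fst_vec

/-- Translation by a fixed vector is continuous where it stays in the punctured hull: a patch lies
in the translate exactly when its back-translate lies in the original. -/
theorem exists_open_translate {X Y : PuncturedHull T} {v : E n} (h : Y.tiles = shift v X.tiles)
    {U : Set (PuncturedHull T)} (hU : IsOpen U) (hY : Y ∈ U) :
    ∃ V : Set (PuncturedHull T), IsOpen V ∧ X ∈ V ∧
      ∀ X' ∈ V, ∀ Y' : PuncturedHull T, Y'.tiles = shift v X'.tiles → Y' ∈ U := by
  obtain ⟨R, -, hR⟩ := PuncturedHull.isOpen_iff.1 hU Y hY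
  refine ⟨{X' | shift (-v) (meeting p Y.tiles (ball 0 R)) ⊆ X'.tiles},
    PuncturedHull.isOpen_contains ((Y.isPartial.finite_meeting 0 R).image _), ?_, ?_⟩
  · rw [mem_ofPred_eq, shift_subset_iff, neg_neg, ← h]
    exact meeting_subset _ _
  · intro X' hX' Y' hY'
    refine hR Y' ?_
    rw [mem_ofPred_eq, shift_subset_iff, neg_neg, ← hY'] at hX'
    exact hX'

/-- The first tiling of a pair has a tile with puncture `-vec`, namely the origin tile of the second
moved back. A nearby pair has this same tile in its first tiling, and its own such tile is too close
to be different. -/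
theorem RPunc.isOpen_vec_eq (v : E n) : IsOpen {r : RPunc T | r.vec = v} := by
  obtain ⟨ρ, hρ, hsep⟩ := exists_separation p
  refine isOpen_iff_forall_mem_open.2 ?_
  rintro r rfl
  have hmem : ∀ q : RPunc T, q.snd.origin.shift (-q.vec) ∈ q.fst.tiles := fun q => by
    rw [q.fst_eq]
    exact mem_image_of_mem _ q.snd.origin_mem
  refine ⟨(fun r : RPunc T => (r.fst, r.vec)) ⁻¹'
    ({X | {r.snd.origin.shift (-r.vec)} ⊆ X.tiles} ×ˢ ball r.vec ρ), ?_, ?_, ?_⟩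
  · rintro q ⟨hq1, hq2⟩
    have h := hsep _ q.fst.isPartial _ (singleton_subset_iff.1 hq1) _ (hmem q) (by
      simp only [Tile.shift, PuncturedHull.puncture_origin, zero_add, dist_neg_neg]
      rw [dist_comm]
      exact hq2)
    have := congrArg Tile.puncture h
    simp only [Tile.shift, PuncturedHull.puncture_origin, zero_add, neg_inj] at this
    exact this.symm
  · exact ((PuncturedHull.isOpen_contains (finite_singleton _)).prod isOpen_ball).preimage
      RPunc.continuous_fst_vec
  · exact ⟨singleton_subset_iff.2 (hmem r), mem_ball_self hρ⟩

theorem RPunc.continuous_snd : Continuous (RPunc.snd : RPunc T → PuncturedHull T) := by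
  refine continuous_def.2 fun U hU => isOpen_iff_forall_mem_open.2 fun r hr => ?_
  obtain ⟨V, hV, hrV, h⟩ := exists_open_translate r.snd_eq hU hr
  refine ⟨{q | q.vec = r.vec} ∩ RPunc.fst ⁻¹' V, ?_, ?_, rfl, hrV⟩
  · rintro q ⟨hq, hqV⟩
    refine h q.fst hqV q.snd ?_
    rw [q.snd_eq, hq]
  · exact (RPunc.isOpen_vec_eq _).inter (hV.preimage RPunc.continuous_fst)

/-- The topology is defined through `fst`, whereas germs are topologised by their source, which
corresponds to `snd`; for a fixed vector the two are related by a translation. -/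
theorem RPunc.exists_open_snd {W : Set (RPunc T)} (hW : IsOpen W) {r : RPunc T} (hr : r ∈ W) :
    ∃ U : Set (PuncturedHull T), IsOpen U ∧ r.snd ∈ U ∧
      ∀ q : RPunc T, q.vec = r.vec → q.snd ∈ U → q ∈ W := by
  obtain ⟨O, hO, rfl⟩ := isOpen_induced_iff.1 hW
  have hO1 : IsOpen {X : PuncturedHull T | (X, r.vec) ∈ O} :=
    hO.preimage (continuous_id.prodMk continuous_const)
  obtain ⟨U, hU, hrU, h⟩ := exists_open_translate r.fst_eq hO1 hr
  refine ⟨U, hU, hrU, fun q hq hqU => ?_⟩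
  have := h q.snd hqU q.fst (by rw [q.fst_eq, hq])
  rw [mem_ofPred_eq, ← hq] at this
  exact this

theorem RPunc.isTopologicalGroupoid (haper : StronglyAperiodic T) :
    IsTopologicalGroupoid (RPunc T) where
  prod_unique := by
    rintro a b c c' ⟨-, h1, h2⟩ ⟨-, h1', h2'⟩
    exact RPunc.ext' (h1.trans h1'.symm) (h2.trans h2'.symm)
  inv_inv _ := rfl
  assoc := by
    rintro a b c ab bc ⟨h1, h2, h3⟩ ⟨h4, h5, h6⟩
    refine ⟨⟨a.fst, c.snd, ⟨a.vec + b.vec + c.vec, ?_⟩⟩, ⟨h3.trans h4, h2.symm, rfl⟩,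
      ⟨h1.trans h5.symm, rfl, h6.symm⟩⟩
    rw [← shift_shift, ← shift_shift, ← a.snd_eq, h1, ← b.snd_eq, h4]
    exact c.snd_eq
  inv_left a := ⟨⟨a.snd, a.snd, ⟨0, (shift_zero _).symm⟩⟩, rfl, rfl, rfl⟩
  cancel_left := by
    rintro a b c ⟨h1, h2, h3⟩
    exact ⟨h2.symm, h1.symm, h3.symm⟩
  cancel_right := by
    rintro a b c ⟨h1, h2, h3⟩
    exact ⟨h3, h2.symm, h1⟩
  continuous_inv := by
    refine continuous_def.2 fun W hW => isOpen_iff_forall_mem_open.2 fun r hr => ?_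
    obtain ⟨U, hU, hrU, h⟩ := RPunc.exists_open_snd hW hr
    refine ⟨{q | q.vec = r.vec} ∩ RPunc.fst ⁻¹' U, ?_, ?_, rfl, hrU⟩
    · rintro q ⟨hq, hqU⟩
      refine h _ ?_ hqU
      rw [RPunc.vec_inv haper, RPunc.vec_inv haper, hq]
    · exact (RPunc.isOpen_vec_eq _).inter (hU.preimage RPunc.continuous_fst)
  continuous_mul := by
    have hg : ∀ q : ComposablePairs (RPunc T), IsProd q.1.1 q.1.2 (gmul q) := fun q =>
      Classical.choose_spec q.2
    refine continuous_def.2 fun W hW => isOpen_iff_forall_mem_open.2 fun r hr => ?_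
    obtain ⟨U, hU, hrU, h⟩ := RPunc.exists_open_snd hW hr
    rw [(hg r).2.2] at hrU
    refine ⟨(fun q => q.1.1) ⁻¹' {q | q.vec = r.1.1.vec} ∩ ((fun q => q.1.2) ⁻¹'
      ({q | q.vec = r.1.2.vec} ∩ RPunc.snd ⁻¹' U)), ?_, ?_, rfl, rfl, hrU⟩
    · rintro q ⟨hq1, hq2, hqU⟩
      refine h _ ?_ ?_
      · rw [RPunc.vec_mul haper (hg q), RPunc.vec_mul haper (hg r)]
        exact congrArg₂ _ hq1 hq2
      · rw [(hg q).2.2]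
        exact hqU
    · exact ((RPunc.isOpen_vec_eq _).preimage (by fun_prop)).inter
        (((RPunc.isOpen_vec_eq _).inter (hU.preimage RPunc.continuous_snd)).preimage (by fun_prop))

/-! ### The isomorphism -/

theorem RPunc.origin_shift_mem (r : RPunc T) : r.fst.origin.shift r.vec ∈ r.snd.tiles := by
  rw [r.snd_eq]
  exact mem_image_of_mem _ r.fst.origin_mem

/-- A doubly pointed patch of `T₂` whose tiles are the tile of `T₂` at the puncture of `T₁` and the
tile at the origin. -/
noncomputable def RPunc.patch (r : RPunc T) : PointedPatch T :=
  ballPatch r.snd.mem_hull (c := 0) (R := ‖r.vec‖ + 1) (by positivity)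
    (s := r.fst.origin.shift r.vec) (t := r.snd.origin)
    ⟨r.origin_shift_mem, _, interior_subset (Tile.puncture_mem_interior _), by
      simp only [Tile.shift, PuncturedHull.puncture_origin, zero_add, mem_ball_zero_iff]
      exact lt_add_one _⟩
    (r.snd.origin_mem_meeting (by positivity))

theorem RPunc.patch_subset (r : RPunc T) : r.patch.P ⊆ r.snd.tiles := meeting_subset _ _

theorem RPunc.puncture_patch (r : RPunc T) : r.patch.t₁.puncture = r.vec := by
  change r.fst.origin.puncture + r.vec = r.vec
  rw [r.fst.puncture_origin, zero_add]

/-- The germ of a pair of translationally equivalent tilings. -/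
noncomputable def RPunc.toGerm (hflc : FiniteLocalComplexity T) (r : RPunc T) :
    TightGroupoid (PatternSemigroup T) :=
  germ (cls r.patch) (puncturedHullHomeo hflc r.snd)
    ((PuncturedHull.char_dom_iff r.snd.puncture_origin).2 r.patch_subset)

theorem RPunc.tightAct_eq (hflc : FiniteLocalComplexity T) {r : RPunc T} {a : PointedPatch T}
    (ha : a.t₂.puncture = 0) (hv : r.vec = a.t₁.puncture)
    (h : (puncturedHullHomeo hflc r.snd).1.toFun (dom (cls a)) = true) :
    tightAct (cls a) (puncturedHullHomeo hflc r.snd) h = puncturedHullHomeo hflc r.fst := by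
  apply Subtype.ext
  have haX := (PuncturedHull.char_dom_iff ha).1 h
  refine (PuncturedHull.charAct_char ha haX h).trans (congrArg _ (PuncturedHull.ext_tiles ?_))
  rw [r.fst_eq, hv]
  rfl

theorem RPunc.germSource_toGerm (hflc : FiniteLocalComplexity T) (r : RPunc T) :
    germSource (r.toGerm hflc) = puncturedHullHomeo hflc r.snd := rfl

theorem RPunc.germRange_toGerm (hflc : FiniteLocalComplexity T) (r : RPunc T) :
    germRange (r.toGerm hflc) = puncturedHullHomeo hflc r.fst :=
  RPunc.tightAct_eq hflc r.snd.puncture_origin r.puncture_patch.symm _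

/-- By principality only the puncture of `t₁` matters, so the patch chosen in `RPunc.patch` can be
replaced by any other suitable one. -/
theorem RPunc.toGerm_eq_germ (hflc : FiniteLocalComplexity T) (haper : StronglyAperiodic T)
    {r : RPunc T} {a : PointedPatch T} (ha : a.t₂.puncture = 0) (hv : r.vec = a.t₁.puncture)
    (h : (puncturedHullHomeo hflc r.snd).1.toFun (dom (cls a)) = true) :
    r.toGerm hflc = germ (cls a) (puncturedHullHomeo hflc r.snd) h :=
  tightPrincipal hflc haper _ _ rfl
    ((r.germRange_toGerm hflc).trans (RPunc.tightAct_eq hflc ha hv h).symm)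

theorem RPunc.exists_of_germ (hflc : FiniteLocalComplexity T) (haper : StronglyAperiodic T)
    {a : PointedPatch T} (ha : a.t₂.puncture = 0) (X : PuncturedHull T)
    (h : (puncturedHullHomeo hflc X).1.toFun (dom (cls a)) = true) :
    ∃ r : RPunc T, r.snd = X ∧ r.vec = a.t₁.puncture ∧
      r.toGerm hflc = germ (cls a) (puncturedHullHomeo hflc X) h := by
  have haX := (PuncturedHull.char_dom_iff ha).1 h
  have hvec : X.tiles = shift a.t₁.puncture (X.recentre (haX a.mem₁)).tiles := by
    change X.tiles = shift a.t₁.puncture (shift (-a.t₁.puncture) X.tiles)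
    rw [shift_shift, neg_add_cancel, shift_zero]
  let r : RPunc T := ⟨X.recentre (haX a.mem₁), X, ⟨_, hvec⟩⟩
  have hv : r.vec = a.t₁.puncture := RPunc.vec_eq haper hvec
  exact ⟨r, rfl, hv, RPunc.toGerm_eq_germ hflc haper ha hv h⟩

theorem RPunc.toGerm_bijective (hflc : FiniteLocalComplexity T) (haper : StronglyAperiodic T) :
    Function.Bijective (RPunc.toGerm (T := T) hflc) := by
  constructor
  · intro r r' h
    refine RPunc.ext' ((puncturedHullHomeo hflc).injective ?_)
      ((puncturedHullHomeo hflc).injective (congrArg germSource h))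
    rw [← r.germRange_toGerm hflc, h, r'.germRange_toGerm hflc]
  · intro g
    obtain ⟨s, φ, h, rfl⟩ := exists_eq_germ g
    obtain ⟨X, rfl⟩ := (puncturedHullHomeo hflc).surjective φ
    obtain ⟨a, rfl, ha⟩ := exists_centred (cls_ne_zero_of_dom h)
    obtain ⟨r, -, -, hr⟩ := RPunc.exists_of_germ hflc haper ha X h
    exact ⟨r, hr⟩

/-- Near `r` the vector is constant, so the triple representing the germ of `r` also represents the
germs of all nearby pairs. -/
theorem RPunc.continuous_toGerm (hflc : FiniteLocalComplexity T) (haper : StronglyAperiodic T) :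
    Continuous (RPunc.toGerm (T := T) hflc) := by
  refine continuous_generateFrom_iff.2 ?_
  rintro _ ⟨s, U, hU, hUs, rfl⟩
  refine isOpen_iff_forall_mem_open.2 fun r hr => ?_
  obtain ⟨φ, h, hφU, hrφ⟩ := hr
  obtain rfl : puncturedHullHomeo hflc r.snd = φ := congrArg germSource hrφ
  obtain ⟨a, rfl, ha⟩ := exists_centred (cls_ne_zero_of_dom h)
  obtain ⟨r', h1, h2, h3⟩ := RPunc.exists_of_germ hflc haper ha r.snd h
  obtain rfl : r = r' := (RPunc.toGerm_bijective hflc haper).1 (hrφ.trans h3.symm)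
  refine ⟨{q | q.vec = r.vec} ∩ RPunc.snd ⁻¹' (puncturedHullHomeo hflc ⁻¹' U), ?_, ?_, rfl, hφU⟩
  · rintro q ⟨hq, hqU⟩
    exact ⟨_, hUs hqU, hqU, RPunc.toGerm_eq_germ hflc haper ha (hq.trans h2) _⟩
  · exact (RPunc.isOpen_vec_eq _).inter
      ((hU.preimage (puncturedHullHomeo hflc).continuous).preimage RPunc.continuous_snd)

theorem RPunc.isOpenMap_toGerm (hflc : FiniteLocalComplexity T) (haper : StronglyAperiodic T) :
    IsOpenMap (RPunc.toGerm (T := T) hflc) := by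
  intro W hW
  refine isOpen_iff_forall_mem_open.2 ?_
  rintro _ ⟨r, hr, rfl⟩
  obtain ⟨U, hU, hrU, h⟩ := RPunc.exists_open_snd hW hr
  have hdom : IsOpen {φ : tightSpectrum (PatternSemigroup T) |
      φ.1.toFun (dom (cls r.patch)) = true} :=
    (isOpen_discrete {true}).preimage ((continuous_eval _).comp continuous_subtype_val)
  -- Every germ in this basic set comes from a pair with the same vector as `r`, because the vector
  -- is read off from `t₁`.
  refine ⟨germBasic (cls r.patch) ((puncturedHullHomeo hflc).symm ⁻¹' U ∩
    {φ | φ.1.toFun (dom (cls r.patch)) = true}), ?_, ?_, ?_⟩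
  · rintro _ ⟨φ, hφ, ⟨hφU, -⟩, rfl⟩
    obtain ⟨X, rfl⟩ := (puncturedHullHomeo hflc).surjective φ
    rw [mem_preimage, Homeomorph.symm_apply_apply] at hφU
    obtain ⟨q, h1, h2, h3⟩ := RPunc.exists_of_germ hflc haper r.snd.puncture_origin X hφ
    exact ⟨q, h q (h2.trans r.puncture_patch) (h1 ▸ hφU), h3⟩
  · exact TopologicalSpace.isOpen_generateFrom_of_mem
      ⟨_, _, (hU.preimage (puncturedHullHomeo hflc).symm.continuous).inter hdom,
        inter_subset_right, rfl⟩
  · refine ⟨_, _, ⟨?_, (PuncturedHull.char_dom_iff r.snd.puncture_origin).2 r.patch_subset⟩, rfl⟩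
    rwa [mem_preimage, Homeomorph.symm_apply_apply]

/-- The isomorphism between the groupoid of translational equivalence on the punctured hull and the
tight groupoid. -/
noncomputable def RPunc.tightIso (hflc : FiniteLocalComplexity T) (haper : StronglyAperiodic T) :
    TopGroupoidIso (RPunc T) (TightGroupoid (PatternSemigroup T)) where
  toHomeomorph := (Equiv.ofBijective _
    (RPunc.toGerm_bijective hflc haper)).toHomeomorphOfContinuousOpen
      (RPunc.continuous_toGerm hflc haper) (RPunc.isOpenMap_toGerm hflc haper)
  map_prod a b c := by
    change _ ↔ IsProd (a.toGerm hflc) (b.toGerm hflc) (c.toGerm hflc)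
    rw [(tightPrincipal hflc haper).isProd_iff]
    simp only [RPunc.germSource_toGerm, RPunc.germRange_toGerm, EmbeddingLike.apply_eq_iff_eq]
    rfl
  map_inv a := by
    refine tightPrincipal hflc haper _ _ ?_ ?_
    · exact (a.germRange_toGerm hflc).symm
    · exact ((inv a).germRange_toGerm hflc).trans (germRange_inv (a.toGerm hflc)).symm

theorem TopGroupoidIso.isTopologicalGroupoid {G H : Type*} [TopologicalSpace G] [GroupoidOps G]
    [TopologicalSpace H] [GroupoidOps H] (e : TopGroupoidIso G H) (hG : IsTopologicalGroupoid G) :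
    IsTopologicalGroupoid H := by
  let f := e.toHomeomorph
  have hprod : ∀ a b c : G, IsProd a b c ↔ IsProd (f a) (f b) (f c) := e.map_prod
  have hinv : ∀ a : G, f (inv a) = inv (f a) := e.map_inv
  have hinv' : ∀ x : H, f (inv (f.symm x)) = inv x := fun x => by rw [hinv, f.apply_symm_apply]
  refine ⟨?_, ?_, ?_, ?_, ?_, ?_, ?_, ?_⟩
  · simp only [f.surjective.forall, ← hprod]
    exact fun a b c c' h h' => congrArg f (hG.prod_unique a b c c' h h')
  · simp only [f.surjective.forall, ← hinv]
    exact fun a => congrArg f (hG.inv_inv a)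
  · simp only [f.surjective.forall, f.surjective.exists, ← hprod]
    exact hG.assoc
  · simp only [f.surjective.forall, f.surjective.exists, ← hinv, ← hprod]
    exact hG.inv_left
  · simp only [f.surjective.forall, ← hinv, ← hprod]
    exact hG.cancel_left
  · simp only [f.surjective.forall, ← hinv, ← hprod]
    exact hG.cancel_right
  · exact (f.continuous.comp (hG.continuous_inv.comp f.symm.continuous)).congr hinv'
  · have hq : ∀ q : ComposablePairs H, (f.symm q.1.1, f.symm q.1.2) ∈ ComposablePairs G := by
      rintro ⟨⟨a, b⟩, c, hc⟩
      refine ⟨f.symm c, (hprod _ _ _).2 ?_⟩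
      simpa only [f.apply_symm_apply] using hc
    have hcont : Continuous fun q : ComposablePairs H => f (gmul ⟨_, hq q⟩) := by
      refine f.continuous.comp (hG.continuous_mul.comp (Continuous.subtype_mk ?_ _))
      exact (f.symm.continuous.comp (continuous_fst.comp continuous_subtype_val)).prodMk
        (f.symm.continuous.comp (continuous_snd.comp continuous_subtype_val))
    refine hcont.congr fun q => ?_
    have h1 : IsProd (f.symm q.1.1) (f.symm q.1.2) (gmul ⟨_, hq q⟩) :=
      Classical.choose_spec (hq q)
    have h2 : IsProd q.1.1 q.1.2 (gmul q) := Classical.choose_spec q.2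
    rw [← f.eq_symm_apply]
    refine hG.prod_unique _ _ _ _ h1 ((hprod _ _ _).2 ?_)
    simpa only [f.apply_symm_apply] using h2

end GroupoidIso

/-! ## Isomorphic groupoids have isomorphic C*-algebras -/

section CStar

open GroupoidOps

variable {G H : Type u} [TopologicalSpace G] [GroupoidOps G] [TopologicalSpace H] [GroupoidOps H]

/-- The inverse isomorphism. -/
def TopGroupoidIso.symm (e : TopGroupoidIso G H) : TopGroupoidIso H G where
  toHomeomorph := e.toHomeomorph.symm
  map_prod a b c := by
    have h := e.map_prod (e.toHomeomorph.symm a) (e.toHomeomorph.symm b) (e.toHomeomorph.symm c)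
    have hs : ∀ x, e.toFun (e.toHomeomorph.symm x) = x := e.toHomeomorph.apply_symm_apply
    rw [hs, hs, hs] at h
    exact h.symm
  map_inv a := by
    have h := e.map_inv (e.toHomeomorph.symm a)
    have hs : ∀ x, e.toFun (e.toHomeomorph.symm x) = x := e.toHomeomorph.apply_symm_apply
    rw [hs] at h
    change e.toHomeomorph.symm (inv a) = inv (e.toHomeomorph.symm a)
    rw [← h]
    exact e.toHomeomorph.symm_apply_apply _

theorem TopGroupoidIso.isConvolution_comp (e : TopGroupoidIso G H) {f g h : H → ℂ}
    (hc : IsConvolution f g h) :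
    IsConvolution (f ∘ e.toHomeomorph) (g ∘ e.toHomeomorph) (h ∘ e.toHomeomorph) := by
  intro γ
  let E : {q : G × G // IsProd q.1 q.2 γ} ≃ {q : H × H // IsProd q.1 q.2 (e.toHomeomorph γ)} :=
    (e.toEquiv.prodCongr e.toEquiv).subtypeEquiv fun q => e.map_prod q.1 q.2 γ
  exact (hc _).trans (finsum_comp_equiv E).symm

theorem TopGroupoidIso.isInvolution_comp (e : TopGroupoidIso G H) {f g : H → ℂ}
    (h : IsInvolution f g) : IsInvolution (f ∘ e.toHomeomorph) (g ∘ e.toHomeomorph) := by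
  intro γ
  have h1 : e.toHomeomorph (inv γ) = inv (e.toHomeomorph γ) := e.map_inv γ
  rw [Function.comp_apply, Function.comp_apply, h1]
  exact h _

/-- The *-representation of `C_c(H)` which corresponds to one of `C_c(G)`. -/
noncomputable def StarRep.transport (e : TopGroupoidIso G H) (π : StarRep G) : StarRep H where
  H := π.H
  rep := π.rep ∘ₗ CompactlySupportedContinuousMap.compLinearMap e.toHomeomorph.toCocompactMap
  map_conv _ _ _ h := π.map_conv _ _ _ (e.isConvolution_comp h)
  map_star _ _ h := π.map_star _ _ (e.isInvolution_comp h)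

/-- Equality rather than equivalence of representations is needed, because operator families are
indexed by them. It holds because transport keeps the Hilbert space and only precomposes the
representation. -/
theorem StarRep.transport_symm_transport (e : TopGroupoidIso G H) (π : StarRep G) :
    (π.transport e).transport e.symm = π := by
  have hrep : ((π.transport e).transport e.symm).rep = π.rep := by
    refine LinearMap.ext fun f => congrArg π.rep ?_
    exact CompactlySupportedContinuousMap.ext fun x =>
      congrArg f (e.toHomeomorph.symm_apply_apply x)
  rcases π with ⟨K, rep, _, _⟩
  unfold StarRep.transport at hrep ⊢
  congr 1

theorem memℓp_transport (e : TopGroupoidIso G H) (a : RepProduct G) :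
    Memℓp (E := fun π : StarRep H => π.H →L[ℂ] π.H) (fun π => a (π.transport e.symm)) ∞ := by
  refine memℓp_infty ⟨‖a‖, ?_⟩
  rintro _ ⟨π, rfl⟩
  exact lp.norm_apply_le_norm ENNReal.top_ne_zero a (π.transport e.symm)

/-- The relabelling of families of operators along an isomorphism of groupoids. -/
noncomputable def repProductMap (e : TopGroupoidIso G H) : RepProduct G →⋆ₙₐ[ℂ] RepProduct H where
  toFun a := ⟨fun π => a (π.transport e.symm), memℓp_transport e a⟩
  map_smul' _ _ := rfl
  map_zero' := rfl
  map_add' _ _ := rfl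
  map_mul' _ _ := rfl
  map_star' _ := rfl

theorem continuous_repProductMap (e : TopGroupoidIso G H) : Continuous (repProductMap e) := by
  refine AddMonoidHomClass.continuous_of_bound (repProductMap e) 1 fun a => ?_
  rw [one_mul]
  exact lp.norm_le_of_forall_le (norm_nonneg a) fun π =>
    lp.norm_apply_le_norm ENNReal.top_ne_zero a (π.transport e.symm)

theorem repProductMap_symm (e : TopGroupoidIso G H) (a : RepProduct G) :
    repProductMap e.symm (repProductMap e a) = a := by
  refine lp.ext (funext fun π => ?_)
  exact eq_of_heq (congr_arg_heq (fun ρ => a ρ) (π.transport_symm_transport e))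

theorem repProductMap_generator (e : TopGroupoidIso G H) {a : RepProduct G}
    (ha : ∃ f : C_c(G, ℂ), ∀ π : StarRep G, a π = π.rep f) :
    ∃ f : C_c(H, ℂ), ∀ π : StarRep H, repProductMap e a π = π.rep f := by
  obtain ⟨f, hf⟩ := ha
  exact ⟨f.comp e.symm.toHomeomorph.toCocompactMap, fun π => hf (π.transport e.symm)⟩

theorem repProductMap_mem (e : TopGroupoidIso G H) {a : RepProduct G}
    (ha : a ∈ groupoidCStarSubalgebra G) : repProductMap e a ∈ groupoidCStarSubalgebra H := by
  -- Generators go to generators, hence the generated *-algebra into the generated *-algebra;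
  -- continuity handles the closure.
  refine map_mem_closure (continuous_repProductMap e) ha fun b hb => ?_
  have h1 := NonUnitalStarAlgebra.adjoin_le (R := ℂ)
    (S := (NonUnitalStarAlgebra.adjoin ℂ {a : RepProduct H | ∃ f : C_c(H, ℂ),
      ∀ π : StarRep H, a π = π.rep f}).comap (repProductMap e))
    (s := {a : RepProduct G | ∃ f : C_c(G, ℂ), ∀ π : StarRep G, a π = π.rep f})
    fun b hb => NonUnitalStarAlgebra.subset_adjoin ℂ _ (repProductMap_generator e hb)
  exact h1 hb

/-- Isomorphic topological groupoids have *-isomorphic C*-algebras. -/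
noncomputable def TopGroupoidIso.groupoidCStarEquiv (e : TopGroupoidIso G H) :
    GroupoidCStar G ≃⋆ₐ[ℂ] GroupoidCStar H where
  toFun a := ⟨repProductMap e a.1, repProductMap_mem e a.2⟩
  invFun a := ⟨repProductMap e.symm a.1, repProductMap_mem e.symm a.2⟩
  left_inv a := Subtype.ext (repProductMap_symm e a.1)
  right_inv a := Subtype.ext (repProductMap_symm e.symm a.1)
  map_mul' _ _ := rfl
  map_add' _ _ := rfl
  map_star' _ := rfl
  map_smul' _ _ := rfl

end CStar

end TilingTight

theorem mainTheorem1 {n N : ℕ} {p : TilingTight.Prototiles n N} (T : TilingTight.Tiling p)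
    (hflc : TilingTight.FiniteLocalComplexity T)
    (hrep : TilingTight.Repetitive T)
    (haper : TilingTight.StronglyAperiodic T) :
    (TilingTight.IsTopologicalGroupoid (TilingTight.RPunc T) ∧
      TilingTight.IsTopologicalGroupoid
        (TilingTight.TightGroupoid (TilingTight.PatternSemigroup T)) ∧
      Nonempty (TilingTight.TopGroupoidIso (TilingTight.RPunc T)
        (TilingTight.TightGroupoid (TilingTight.PatternSemigroup T)))) ∧
    Nonempty (TilingTight.GroupoidCStar
        (TilingTight.TightGroupoid (TilingTight.PatternSemigroup T)) ≃⋆ₐ[ℂ]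
      TilingTight.GroupoidCStar (TilingTight.RPunc T)) := by
  let e := TilingTight.RPunc.tightIso hflc haper
  have hR := TilingTight.RPunc.isTopologicalGroupoid haper
  exact ⟨⟨hR, e.isTopologicalGroupoid hR, ⟨e⟩⟩, ⟨e.symm.groupoidCStarEquiv⟩⟩
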